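/- Consider $\min_{x\in\mathbb R^d}P(x)=\frac1n\sum_{\tau=1}^n f^{(\tau)}(x)+\psi(x)$ with $f^{(\tau)}=\frac1m\sum_{i=1}^m f_i^{(\tau)}$, $d,n,m\ge1$, where each $f_i^{(\tau)}$ is convex and $L$-smooth, each $f^{(\tau)}$ is $\bar L$-smooth, $\frac1n\sum_\tau f^{(\tau)}$ is $L_f$-smooth, and $\psi$ is $\lambda$-strongly convex ($\lambda>0$) and $L_\psi$-smooth. A superscript $*$ on $P$ or $G_k$ denotes the minimum. Let $Q,Q_1$ be contraction compressors with parameters $\delta,\delta_1\in(0,1]$, i.e. $\mathbb E\|x-Q(x)\|^2\le(1-\delta)\|x\|^2$ for all $x$, and similarly for $Q_1$, $\delta_1$. Run Catalyst with $\kappa\ge0$, $q=\lambda/(\lambda+\kappa)$, $\alpha_0=\sqrt q$, $0<\rho_0<\sqrt q$, $y^0=x^0$ and $\epsilon_k=\frac29(P(x^0)-P^*)(1-\rho_0)^k$: for $k\ge1$, $x^k$ is an approximate minimizer of $G_k(x)=P(x)+\frac\kappa2\|x-y^{k-1}\|^2$, $\alpha_k\in(0,1]$ solves $\alpha_k^2=(1-\alpha_k)\alpha_{k-1}^2+q\alpha_k$,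 and $y^k=x^k+\beta_k(x^k-x^{k-1})$ with $\beta_k=\frac{\alpha_{k-1}(1-\alpha_{k-1})}{\alpha_{k-1}^2+\alpha_k}$. The point $x^k$ is computed by EC-LSVRG (without regularizer) applied to the components $F_i^{(\tau)}=f_i^{(\tau)}+\psi+\frac\kappa2\|\cdot-y^{k-1}\|^2$, $F^{(\tau)}=\frac1m\sum_iF_i^{(\tau)}$. With stepsize $\eta$ and probability $p$, its iteration is: sample $i^\tau\in\{1,\dots,m\}$ uniformly on each node; $g_\tau=\nabla F^{(\tau)}_{i^\tau}(x)-\nabla F^{(\tau)}_{i^\tau}(w)+\nabla F^{(\tau)}(w)-h_\tau$; $y_\tau=Q(\eta g_\tau+e_\tau)$; $e_\tau^+=e_\tau+\eta g_\tau-y_\tau$; $z_\tau=Q_1(\nabla F^{(\tau)}(w)-h_\tau)$; $h_\tau^+=h_\tau+z_\tau$; $x^+=x-\frac1n\sum_\tau(y_\tau+\eta h_\tau)$; $w^+=x$ with probability $p$ and $w^+=w$ otherwise, all random choices being independent. It starts from $x=w=x^{k-1}$, $e_\tau=0$, $h_\tau=\nabla f^{(\tau)}(x^{k-1})+\nabla\psi(x^{k-1})+\kappa(x^{k-1}-y^{k-1})$.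 Let $\bar x^K_{(k)}$ be the weighted average of its iterates $x^0,\dots,x^K$ with weights proportional to $(1-\theta)^{-(j+1)}$, $\theta=\min\{\frac{(\lambda+\kappa)\eta}2,\frac\delta4,\frac{\delta_1}4,\frac p4\}$. Put $T_k=\inf\{K\ge1: G_k(\bar x_{(k)}^K)-G_k^*\le\epsilon_k\}$ and $x^k=\bar x^{T_k}_{(k)}$. Write $\ell_f=L_f+L_\psi+\kappa$, $\bar\ell=\bar L+L_\psi+\kappa$, $\ell=L+L_\psi+\kappa$ and $\Lambda=1+\log\frac1{\sqrt q-\rho_0}$. For all $0<c_1\le c_2$ there are constants $c_0,C>0$, depending only on $c_1,c_2$, such that if $p\in(0,1]$, $c_1\delta_1\le p\le c_2\delta_1$, and $$\eta=c_0\Big/\Big(\ell_f+\tfrac{\ell}{n}+\tfrac{\sqrt{(1-\delta)\ell_f\bar\ell}}{\delta}+\tfrac{\sqrt{(1-\delta)\ell_f\ell}}{\sqrt\delta}\Big),$$ then the following hold. (1) For every $k\ge1$, $$\mathbb E[T_k]\le C\,\Lambda\Big(\tfrac1\delta+\tfrac1{\delta_1}+\tfrac{\sqrt{(1-\delta)\ell_f\bar\ell}}{\delta(\lambda+\kappa)}+\tfrac{L_f+L_\psi}{\lambda+\kappa}+\tfrac{L}{n(\lambda+\kappa)}+\tfrac{\sqrt{(1-\delta)\ell_f\ell}}{\sqrt\delta(\lambda+\kappa)}\Big).$$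 (2) For every $\epsilon>0$, with $N=\max\{0,\lceil\frac1{\rho_0}\log\frac{C(P(x^0)-P^*)}{(\sqrt q-\rho_0)^2\epsilon}\rceil\}$ ($N=0$ if $P(x^0)=P^*$), one has $P(x^N)-P^*\le\epsilon$ almost surely. If moreover $\delta_1=\delta$, and if sending an uncompressed vector costs $U\ge0$ (one per outer iteration) and a compressed one costs $r\ge0$ (two per inner iteration), the expected communication cost per node of the first $N$ outer iterations is at most $$N\Big(U+\tfrac{C\,r\,\Lambda}{\delta}\Big(1+\tfrac{\sqrt{\ell_f\bar\ell}+L_f+L_\psi+L/n+\sqrt{\ell_f\ell}}{\lambda+\kappa}\Big)\Big).$$ -/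

import Mathlib

open MeasureTheory ProbabilityTheory
open scoped ENNReal NNReal

noncomputable section

namespace ECCatalyst

/-- The Euclidean space `ℝ^d`. -/
abbrev Vec (d : ℕ) := EuclideanSpace ℝ (Fin d)

/-- `g` is `L`-smooth: differentiable with `L`-Lipschitz gradient. -/
def IsSmooth {d : ℕ} (L : ℝ) (g : Vec d → ℝ) : Prop :=
  Differentiable ℝ g ∧ ∀ x y, ‖gradient g x - gradient g y‖ ≤ L * ‖x - y‖

/-- The randomized map `x ↦ Q x s`, with internal randomness `s ∼ ν`, is a contraction compressor
with parameter `δ`: `E‖x - Q(x)‖² ≤ (1 - δ)‖x‖²` for every `x`. -/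
structure IsContractionCompressor {d : ℕ} {S : Type*} [MeasurableSpace S] (ν : Measure S)
    (Q : Vec d → S → Vec d) (δ : ℝ) : Prop where
  measurable : Measurable (Function.uncurry Q)
  pos : 0 < δ
  le_one : δ ≤ 1
  contraction : ∀ x, ∫⁻ s, ‖x - Q x s‖ₑ ^ 2 ∂ν ≤ ENNReal.ofReal ((1 - δ) * ‖x‖ ^ 2)

/-! ### The inner method: EC-LSVRG without regularizer -/

/-- The randomness of one iteration of EC-LSVRG: the sampled index on each node, the internal
randomness of `Q` and of `Q₁` on each node, and the coin deciding the check point update. -/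
abbrev Seed (n m : ℕ) (S S₁ : Type*) :=
  (Fin n → Fin m) × (Fin n → S) × (Fin n → S₁) × Bool

/-- The law of a seed: all coordinates independent, indices uniform on the `m` samples,
compressor randomness with laws `ν`, `ν₁`, and a coin with success probability `p`. -/
def seedLaw (n m : ℕ) {S S₁ : Type*} [MeasurableSpace S] [MeasurableSpace S₁]
    (ν : Measure S) (ν₁ : Measure S₁) (p : ℝ) : Measure (Seed n m S S₁) :=
  (Measure.pi fun _ : Fin n => (m : ℝ≥0∞)⁻¹ • (Measure.count : Measure (Fin m))).prod
    ((Measure.pi fun _ : Fin n => ν).prod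
      ((Measure.pi fun _ : Fin n => ν₁).prod
        (ENNReal.ofReal p • Measure.dirac true + ENNReal.ofReal (1 - p) • Measure.dirac false)))

/-- The variables of EC-LSVRG: iterate `x`, check point `w`, local errors `e`, local shifts
`h`, and the averaged shift `hAvg`. -/
structure ECState (d n : ℕ) where
  x : Vec d
  w : Vec d
  e : Fin n → Vec d
  h : Fin n → Vec d
  hAvg : Vec d

/-- The initial state: `x = w = x⁰`, zero errors, given local shifts `h⁰`. -/
def ecInit {d n : ℕ} (x₀ : Vec d) (h₀ : Fin n → Vec d) : ECState d n where
  x := x₀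
  w := x₀
  e := fun _ => 0
  h := h₀
  hAvg := (n : ℝ)⁻¹ • ∑ τ, h₀ τ

/-- One iteration of EC-LSVRG with stepsize `η` for the problem
`min_x (1/n) ∑_τ (1/m) ∑_i F τ i x`. -/
def ecStep {d n m : ℕ} {S S₁ : Type*} (F : Fin n → Fin m → Vec d → ℝ)
    (Q : Vec d → S → Vec d) (Q₁ : Vec d → S₁ → Vec d) (η : ℝ)
    (s : ECState d n) (z : Seed n m S S₁) : ECState d n :=
  let gradNode : Fin n → Vec d → Vec d :=
    fun τ => gradient (fun v => (m : ℝ)⁻¹ * ∑ i, F τ i v)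
  let g : Fin n → Vec d := fun τ =>
    gradient (F τ (z.1 τ)) s.x - gradient (F τ (z.1 τ)) s.w + gradNode τ s.w - s.h τ
  let y : Fin n → Vec d := fun τ => Q (η • g τ + s.e τ) (z.2.1 τ)
  let c : Fin n → Vec d := fun τ => Q₁ (gradNode τ s.w - s.h τ) (z.2.2.1 τ)
  { x := s.x - ((n : ℝ)⁻¹ • ∑ τ, y τ + η • s.hAvg)
    w := if z.2.2.2 = true then s.x else s.w
    e := fun τ => s.e τ + η • g τ - y τ
    h := fun τ => s.h τ + c τ
    hAvg := s.hAvg + (n : ℝ)⁻¹ • ∑ τ, c τ }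

/-- The state of EC-LSVRG after `K` iterations, driven by the seeds `z 0, z 1, …`. -/
def ecState {d n m : ℕ} {S S₁ : Type*} (F : Fin n → Fin m → Vec d → ℝ)
    (Q : Vec d → S → Vec d) (Q₁ : Vec d → S₁ → Vec d) (η : ℝ)
    (s₀ : ECState d n) (z : ℕ → Seed n m S S₁) : ℕ → ECState d n
  | 0 => s₀
  | K + 1 => ecStep F Q Q₁ η (ecState F Q Q₁ η s₀ z K) (z K)

/-- The weighted average `(∑_{j ≤ K} w_j)⁻¹ ∑_{j ≤ K} w_j x^j` with `w_j = (1 - θ)^{-(j+1)}`. -/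
def weightedAverage {d : ℕ} (θ : ℝ) (x : ℕ → Vec d) (K : ℕ) : Vec d :=
  (∑ j ∈ Finset.range (K + 1), ((1 - θ) ^ (j + 1))⁻¹)⁻¹ •
    ∑ j ∈ Finset.range (K + 1), ((1 - θ) ^ (j + 1))⁻¹ • x j

/-! ### The problem and the outer method -/

/-- The data of a run of Catalyst with EC-LSVRG as inner method: the functions of the problem
`P = (1/n) ∑_τ (1/m) ∑_i f τ i + ψ`, the compressors `Q`, `Q₁` and their parameters `δ`, `δ₁`,
the strong convexity parameter `lam`, the Catalyst parameters `κ`, `ρ₀`, `α`, the EC-LSVRG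
parameters `p`, `η`, and the starting point `x₀`. -/
structure Run (d n m : ℕ) (S S₁ : Type*) where
  f : Fin n → Fin m → Vec d → ℝ
  ψ : Vec d → ℝ
  Q : Vec d → S → Vec d
  Q₁ : Vec d → S₁ → Vec d
  δ : ℝ
  δ₁ : ℝ
  lam : ℝ
  κ : ℝ
  ρ₀ : ℝ
  α : ℕ → ℝ
  p : ℝ
  η : ℝ
  x₀ : Vec d

namespace Run

variable {d n m : ℕ} {S S₁ : Type*} (A : Run d n m S S₁)

/-- The local loss `f^{(τ)} = (1/m) ∑_i f_i^{(τ)}`. -/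
def fNode (τ : Fin n) (x : Vec d) : ℝ := (m : ℝ)⁻¹ * ∑ i, A.f τ i x

/-- The average loss `(1/n) ∑_τ f^{(τ)}`. -/
def fAvg (x : Vec d) : ℝ := (n : ℝ)⁻¹ * ∑ τ, A.fNode τ x

/-- The objective `P`. -/
def P (x : Vec d) : ℝ := A.fAvg x + A.ψ x

/-- The minimum of `P`. -/
def Pmin : ℝ := ⨅ x, A.P x

/-- The objective `G(x) = P(x) + (κ/2)‖x - y‖²` of the subproblem with prox center `y`. -/
def G (y x : Vec d) : ℝ := A.P x + A.κ / 2 * ‖x - y‖ ^ 2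

/-- The minimum of the subproblem. -/
def Gmin (y : Vec d) : ℝ := ⨅ x, A.G y x

/-- The component functions handed to EC-LSVRG for the subproblem: `ψ` and the quadratic term
are moved to each `f_i^{(τ)}`. -/
def subComp (y : Vec d) (τ : Fin n) (i : Fin m) (x : Vec d) : ℝ :=
  A.f τ i x + A.ψ x + A.κ / 2 * ‖x - y‖ ^ 2

/-- The smoothness and convexity assumptions on the problem: the average loss is `Lf`-smooth,
each `f^{(τ)}` is `Lbar`-smooth, each `f_i^{(τ)}` is convex and `L`-smooth, and `ψ` is
`lam`-strongly convex and `Lψ`-smooth. -/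
structure PrimalAssumption (Lf Lbar L Lψ : ℝ) : Prop where
  convex : ∀ τ i, ConvexOn ℝ Set.univ (A.f τ i)
  smooth_avg : IsSmooth Lf A.fAvg
  smooth_node : ∀ τ, IsSmooth Lbar (A.fNode τ)
  smooth_comp : ∀ τ i, IsSmooth L (A.f τ i)
  lam_pos : 0 < A.lam
  strong : StrongConvexOn Set.univ A.lam A.ψ
  smooth_reg : IsSmooth Lψ A.ψ

/-- `q = λ / (λ + κ)`. -/
def q : ℝ := A.lam / (A.lam + A.κ)

/-- The parameters of Catalyst: `κ ≥ 0`, `0 < ρ₀ < √q`, `α₀ = √q`, and `α_k` the solution of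
`α_k² = (1 - α_k) α_{k-1}² + q α_k` in the unit interval (for `κ = 0` it equals `1`). -/
structure CatalystParams : Prop where
  κ_nonneg : 0 ≤ A.κ
  ρ₀_pos : 0 < A.ρ₀
  ρ₀_lt : A.ρ₀ < √A.q
  α_zero : A.α 0 = √A.q
  α_mem : ∀ k, 0 < A.α (k + 1) ∧ A.α (k + 1) ≤ 1
  α_eq : ∀ k, A.α (k + 1) ^ 2 = (1 - A.α (k + 1)) * A.α k ^ 2 + A.q * A.α (k + 1)

/-- The accuracy `ε_k = (2/9) (P(x⁰) - P*) (1 - ρ₀)^k` of the `k`-th subproblem. -/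
def ε (k : ℕ) : ℝ := 2 / 9 * (A.P A.x₀ - A.Pmin) * (1 - A.ρ₀) ^ k

/-- `β_k = α_{k-1} (1 - α_{k-1}) / (α_{k-1}² + α_k)`, for `k ≥ 1`. -/
def β (k : ℕ) : ℝ :=
  A.α (k - 1) * (1 - A.α (k - 1)) / (A.α (k - 1) ^ 2 + A.α k)

/-- `θ = min {(λ + κ) η / 2, δ / 4, δ₁ / 4, p / 4}`, which fixes the averaging weights. -/
def θ : ℝ :=
  min (min ((A.lam + A.κ) * A.η / 2) (A.δ / 4)) (min (A.δ₁ / 4) (A.p / 4))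

/-- The initial local shifts: the exact local gradients of the subproblem at `x`. -/
def initShift (x y : Vec d) (τ : Fin n) : Vec d :=
  gradient (A.fNode τ) x + gradient A.ψ x + A.κ • (x - y)

/-- The iterate `x^K` of EC-LSVRG on the subproblem with prox center `s.2`, warm-started at
`s.1`. -/
def innerIterate (s : Vec d × Vec d) (z : ℕ → Seed n m S S₁) (K : ℕ) : Vec d :=
  (ecState (A.subComp s.2) A.Q A.Q₁ A.η (ecInit s.1 (A.initShift s.1 s.2)) z K).x

/-- The averaged iterate `x̄^K` of EC-LSVRG on that subproblem. -/
def innerAverage (s : Vec d × Vec d) (z : ℕ → Seed n m S S₁) (K : ℕ) : Vec d :=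
  weightedAverage A.θ (A.innerIterate s z) K

/-- `inf {K ≥ 1 : G(x̄^K) - G* ≤ acc}`, which is `⊤` if there is no such `K`. -/
def stopTime (acc : ℝ) (s : Vec d × Vec d) (z : ℕ → Seed n m S S₁) : ℕ∞ :=
  sInf ((fun K : ℕ => (K : ℕ∞)) ''
    {K : ℕ | 1 ≤ K ∧ A.G s.2 (A.innerAverage s z K) - A.Gmin s.2 ≤ acc})

/-- The pair `(x^k, y^k)` of Catalyst, where the `K`-th inner iteration inside the `k`-th outer
iteration is driven by the seed `z k K`. (If the inner loop never stops, which is irrelevant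
outside a null event, its starting point is returned.) -/
def outer (z : ℕ → ℕ → Seed n m S S₁) : ℕ → Vec d × Vec d
  | 0 => (A.x₀, A.x₀)
  | k + 1 =>
    let s := outer z k
    let x' := A.innerAverage s (z (k + 1)) (A.stopTime (A.ε (k + 1)) s (z (k + 1))).toNat
    (x', x' + A.β (k + 1) • (x' - s.1))

/-- The number `T_k` of inner iterations in the `k`-th outer iteration, `k ≥ 1`. -/
def T (z : ℕ → ℕ → Seed n m S S₁) (k : ℕ) : ℕ∞ :=
  A.stopTime (A.ε k) (A.outer z (k - 1)) (z k)

/-- The communication cost per node of the first `N` outer iterations, when an uncompressed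
vector costs `U` and a compressed one costs `r`: one uncompressed vector per outer iteration for
the initial shift, two compressed vectors (outputs of `Q` and `Q₁`) per inner iteration. -/
def commCost (U r : ℝ≥0) (z : ℕ → ℕ → Seed n m S S₁) (N : ℕ) : ℝ≥0∞ :=
  ∑ k ∈ Finset.Icc 1 N, ((U : ℝ≥0∞) + 2 * (r : ℝ≥0∞) * (A.T z k : ℝ≥0∞))

/-- The stepsize rule, up to the constant `c₀`, in terms of the smoothness constants of the
functions of the subproblem. -/
def stepsize (c₀ Lf Lbar L Lψ : ℝ) : ℝ :=
  c₀ / ((Lf + Lψ + A.κ) + (L + Lψ + A.κ) / n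
    + √((1 - A.δ) * (Lf + Lψ + A.κ) * (Lbar + Lψ + A.κ)) / A.δ
    + √((1 - A.δ) * (Lf + Lψ + A.κ) * (L + Lψ + A.κ)) / √A.δ)

/-- The bound on the expected number of inner iterations, up to constants and logarithms. -/
def iterBound (Lf Lbar L Lψ : ℝ) : ℝ :=
  1 / A.δ + 1 / A.δ₁
    + √((1 - A.δ) * (Lf + Lψ + A.κ) * (Lbar + Lψ + A.κ)) / (A.δ * (A.lam + A.κ))
    + (Lf + Lψ) / (A.lam + A.κ) + L / (n * (A.lam + A.κ))
    + √((1 - A.δ) * (Lf + Lψ + A.κ) * (L + Lψ + A.κ)) / (√A.δ * (A.lam + A.κ))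

/-- A quantity not involving the compressor parameters, such that the iteration bound is at most
a constant times it divided by `δ` when `δ₁ = δ`. -/
def condBound (Lf Lbar L Lψ : ℝ) : ℝ :=
  1 + (√((Lf + Lψ + A.κ) * (Lbar + Lψ + A.κ)) + (Lf + Lψ) + L / n
    + √((Lf + Lψ + A.κ) * (L + Lψ + A.κ))) / (A.lam + A.κ)

/-- The logarithmic factor `1 + log (1 / (√q - ρ₀))`. -/
def logFactor : ℝ := 1 + Real.log (1 / (√A.q - A.ρ₀))

/-- The number `⌈(1/ρ₀) log (C (P(x⁰) - P*) / ((√q - ρ₀)² acc))⌉` of outer iterations. -/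
def outerBound (C acc : ℝ) : ℕ :=
  ⌈1 / A.ρ₀ * Real.log (C * (A.P A.x₀ - A.Pmin) / ((√A.q - A.ρ₀) ^ 2 * acc))⌉₊

end Run

end ECCatalyst

end

namespace ECCatalyst

variable {d : ℕ}

/-! ### Gradients of smooth convex functions -/

/-! The inner and the outer method are analysed separately, each through a Lyapunov function, and
joined by a deterministic bound on the quality of the warm start.

Inner method. The virtual iterate `virt` (the iterate minus the mean local error) moves exactly as
uncompressed variance-reduced SGD, because the output of `Q` cancels (`virt_ecStep`). Compression
enters only because gradients are evaluated at `x` and not at the virtual point. The weighted sum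
`potential` of squared distance, local errors, shift errors and check point gap contracts in
expectation by `1 - θ` and also pays for the gap at `x` (`potential_decrease`). Summing with weights
`(1 - θ)^{-(j+1)}` and using convexity gives a linear rate for the averaged iterate. Since the
errors vanish initially and the shifts are exact, the rate is in terms of the initial gap alone
(`lintegral_gap_weightedAverage_le`). If the initial gap is at most `R` times the accuracy, Markov's
inequality yields geometric tails for the stopping time, whose mean is therefore of order `log R /
θ` (`lintegral_count_le`).

Outer method. As `α₀ = √q`, all `α_k` equal `√q` and the extrapolation is constant. The function
`lyap` contracts by `1 - √q` up to an error controlled by the subproblem accuracy (`lyap_step`), so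
it stays below `lyapBound`, a multiple of `ε_k` (`le_of_quadratic_recursion`). Consequently the next
subproblem starts with a gap at most `45 / (√q - ρ₀)^3` times its accuracy (`warm_start_gap_le`),
which explains the factor `Λ`.

Coupling. The outer bound at step `k` holds almost surely only if all earlier inner loops stopped.
The induction in `ae_lyap_outer_le` alternates: the bound at `k` makes the next stopping time
integrable, hence almost surely finite, which gives the bound at `k + 1`. The seeds of each outer
iteration are independent of the earlier ones, so the inner analysis applies with a frozen starting
pair. -/

theorem hasGradientAt_add {f g : Vec d → ℝ} {f' g' x : Vec d} (hf : HasGradientAt f f' x)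
    (hg : HasGradientAt g g' x) : HasGradientAt (fun v => f v + g v) (f' + g') x := by
  rw [hasGradientAt_iff_hasFDerivAt] at *
  rw [map_add]
  exact hf.add hg

theorem hasGradientAt_const_mul {f : Vec d → ℝ} {f' x : Vec d} (c : ℝ)
    (hf : HasGradientAt f f' x) : HasGradientAt (fun v => c * f v) (c • f') x := by
  rw [hasGradientAt_iff_hasFDerivAt] at *
  rw [map_smul]
  exact hf.const_mul c

theorem hasGradientAt_sum {ι : Type*} (s : Finset ι) {f : ι → Vec d → ℝ} {f' : ι → Vec d}
    {x : Vec d} (hf : ∀ i ∈ s, HasGradientAt (f i) (f' i) x) :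
    HasGradientAt (fun v => ∑ i ∈ s, f i v) (∑ i ∈ s, f' i) x := by
  simp only [hasGradientAt_iff_hasFDerivAt] at *
  rw [map_sum]
  exact HasFDerivAt.fun_sum hf

theorem hasGradientAt_half_mul_norm_sub_sq (c : ℝ) (y x : Vec d) :
    HasGradientAt (fun v => c / 2 * ‖v - y‖ ^ 2) (c • (x - y)) x := by
  rw [hasGradientAt_iff_hasFDerivAt]
  have h : HasFDerivAt (fun v : Vec d => v - y) (ContinuousLinearMap.id ℝ (Vec d)) x :=
    (hasFDerivAt_id x).sub_const y
  refine ((h.norm_sq).const_mul (c / 2)).congr_fderiv ?_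
  ext v
  simp [InnerProductSpace.toDual_apply_apply]
  ring

theorem IsSmooth.hasGradientAt {L : ℝ} {g : Vec d → ℝ} (h : IsSmooth L g) (x : Vec d) :
    HasGradientAt g (gradient g x) x :=
  (h.1 x).hasGradientAt

theorem IsSmooth.of_hasGradientAt {L : ℝ} {g : Vec d → ℝ} {g' : Vec d → Vec d}
    (h : ∀ x, HasGradientAt g (g' x) x) (hL : ∀ x y, ‖g' x - g' y‖ ≤ L * ‖x - y‖) :
    IsSmooth L g := by
  refine ⟨fun x => (h x).differentiableAt, fun x y => ?_⟩
  rw [(h x).gradient, (h y).gradient]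
  exact hL x y

theorem IsSmooth.add {L M : ℝ} {f g : Vec d → ℝ} (hf : IsSmooth L f) (hg : IsSmooth M g) :
    IsSmooth (L + M) (fun x => f x + g x) := by
  refine IsSmooth.of_hasGradientAt
    (fun x => hasGradientAt_add (hf.hasGradientAt x) (hg.hasGradientAt x)) fun x y => ?_
  rw [add_sub_add_comm, add_mul]
  exact (norm_add_le _ _).trans (add_le_add (hf.2 x y) (hg.2 x y))

theorem isSmooth_half_mul_norm_sub_sq {c : ℝ} (hc : 0 ≤ c) (y : Vec d) :
    IsSmooth c (fun v => c / 2 * ‖v - y‖ ^ 2) := by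
  refine IsSmooth.of_hasGradientAt (hasGradientAt_half_mul_norm_sub_sq c y) fun u v => ?_
  rw [← smul_sub, sub_sub_sub_cancel_right, norm_smul, Real.norm_of_nonneg hc]

theorem IsSmooth.nonneg {L : ℝ} {g : Vec d → ℝ} (hd : 0 < d) (h : IsSmooth L g) : 0 ≤ L := by
  have h1 := (norm_nonneg _).trans (h.2 (EuclideanSpace.single ⟨0, hd⟩ 1) 0)
  simpa using h1

theorem IsSmooth.continuous_gradient {L : ℝ} {g : Vec d → ℝ} (hd : 0 < d) (h : IsSmooth L g) :
    Continuous (gradient g) := by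
  refine (LipschitzWith.of_dist_le_mul (K := ⟨L, h.nonneg hd⟩) fun x y => ?_).continuous
  rw [dist_eq_norm, dist_eq_norm]
  exact h.2 x y

theorem IsSmooth.continuous {L : ℝ} {g : Vec d → ℝ} (h : IsSmooth L g) : Continuous g :=
  h.1.continuous

theorem hasDerivAt_comp_line {g : Vec d → ℝ} {x v : Vec d} {t : ℝ} {g' : Vec d}
    (h : HasGradientAt g g' (x + t • v)) :
    HasDerivAt (fun s : ℝ => g (x + s • v)) (inner ℝ g' v) t := by
  have h1 : HasDerivAt (fun s : ℝ => x + s • v) v t := by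
    simpa using ((hasDerivAt_id t).smul_const v).const_add x
  have h2 := (hasGradientAt_iff_hasFDerivAt.1 h).comp_hasDerivAt t h1
  simpa [Function.comp_def, InnerProductSpace.toDual_apply_apply] using h2

/-- Along the segment, the derivative of `φ` is nonpositive by Cauchy–Schwarz and the Lipschitz
bound on the gradient; the claim is `φ 1 ≤ φ 0`. -/
theorem IsSmooth.descent {L : ℝ} {g : Vec d → ℝ} (h : IsSmooth L g) (x y : Vec d) :
    g y ≤ g x + inner ℝ (gradient g x) (y - x) + L / 2 * ‖y - x‖ ^ 2 := by
  set v := y - x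
  set φ : ℝ → ℝ := fun t => g (x + t • v) - t * inner ℝ (gradient g x) v - L / 2 * ‖v‖ ^ 2 * t ^ 2
    with hφ
  have hder : ∀ t, HasDerivAt φ (inner ℝ (gradient g (x + t • v)) v - inner ℝ (gradient g x) v
      - L * ‖v‖ ^ 2 * t) t := by
    intro t
    have h1 := hasDerivAt_comp_line (h.hasGradientAt (x + t • v))
    have h2 := (h1.sub ((hasDerivAt_id t).mul_const (inner ℝ (gradient g x) v))).sub
      (((hasDerivAt_id t).pow 2).const_mul (L / 2 * ‖v‖ ^ 2))
    refine h2.congr_deriv ?_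
    simp
    ring
  have hanti : AntitoneOn φ (Set.Icc 0 1) := by
    refine antitoneOn_of_deriv_nonpos (convex_Icc 0 1)
      (fun t _ => (hder t).continuousAt.continuousWithinAt)
      (fun t _ => (hder t).differentiableAt.differentiableWithinAt) fun t ht => ?_
    rw [interior_Icc] at ht
    rw [(hder t).deriv, ← inner_sub_left]
    have h1 := real_inner_le_norm (gradient g (x + t • v) - gradient g x) v
    have h2 := h.2 (x + t • v) x
    rw [add_sub_cancel_left, norm_smul, Real.norm_of_nonneg ht.1.le] at h2
    nlinarith [mul_le_mul_of_nonneg_right h2 (norm_nonneg v)]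
  have := hanti (Set.left_mem_Icc.2 zero_le_one) (Set.right_mem_Icc.2 zero_le_one) zero_le_one
  simp [hφ, v] at this ⊢
  linarith

theorem inner_gradient_le_sub {f : Vec d → ℝ} {f' x : Vec d} (hc : ConvexOn ℝ Set.univ f)
    (h : HasGradientAt f f' x) (y : Vec d) : f x + inner ℝ f' (y - x) ≤ f y := by
  have hc1 : ConvexOn ℝ Set.univ (fun s : ℝ => f (x + s • (y - x))) := by
    have := hc.comp_affineMap (AffineMap.lineMap x y)
    simpa [Function.comp_def, AffineMap.lineMap_apply, add_comm] using this
  have hder : HasDerivAt (fun s : ℝ => f (x + s • (y - x))) (inner ℝ f' (y - x)) 0 :=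
    hasDerivAt_comp_line (by simpa using h)
  have := hc1.le_slope_of_hasDerivAt (Set.mem_univ 0) (Set.mem_univ 1) zero_lt_one hder
  simp [slope_def_field] at this
  linarith

/-- Subtracting `m / 2 * ‖v‖ ^ 2` leaves a convex function, to which the first-order inequality
applies. -/
theorem strongConvexOn_add_inner_gradient_le {f : Vec d → ℝ} {m : ℝ} {f' x : Vec d}
    (hc : StrongConvexOn Set.univ m f) (h : HasGradientAt f f' x) (y : Vec d) :
    f x + inner ℝ f' (y - x) + m / 2 * ‖y - x‖ ^ 2 ≤ f y := by
  have hg := hasGradientAt_add h (hasGradientAt_half_mul_norm_sub_sq (-m) 0 x)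
  have h1 : ConvexOn ℝ Set.univ fun v => f v + -m / 2 * ‖v - 0‖ ^ 2 := by
    refine (strongConvexOn_iff_convex.1 hc).congr fun v _ => ?_
    simp
    ring
  have := inner_gradient_le_sub h1 hg y
  simp only [sub_zero, inner_add_left, inner_smul_left, conj_trivial] at this
  have h2 := norm_sub_sq_real y x
  have h3 : inner ℝ x (y - x) = inner ℝ x y - ‖x‖ ^ 2 := by
    rw [inner_sub_right, real_inner_self_eq_norm_sq]
  rw [h3] at this
  rw [h2, real_inner_comm x y]
  linarith

/-- At the point `x - L⁻¹ • v`, with `v` the gradient difference, the descent upper bound from `x`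
is compared with the tangent lower bound from `y`. Applied with `y` a minimizer, this turns gradient
differences into function gaps. -/
theorem norm_gradient_sub_sq_le {L : ℝ} {f : Vec d → ℝ} (hd : 0 < d)
    (hc : ConvexOn ℝ Set.univ f) (h : IsSmooth L f) (x y : Vec d) :
    ‖gradient f x - gradient f y‖ ^ 2
      ≤ 2 * L * (f x - f y - inner ℝ (gradient f y) (x - y)) := by
  rcases (h.nonneg hd).eq_or_lt with h0 | h0
  · have h1 := h.2 x y
    rw [← h0, zero_mul] at h1
    have h2 : ‖gradient f x - gradient f y‖ = 0 := le_antisymm h1 (norm_nonneg _)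
    rw [h2, ← h0]
    simp
  · set v := gradient f x - gradient f y with hv
    have h1 := h.descent x (x - L⁻¹ • v)
    have h2 := inner_gradient_le_sub hc (h.hasGradientAt y) (x - L⁻¹ • v)
    have h3 : x - L⁻¹ • v - x = - (L⁻¹ • v) := by abel
    have h4 : x - L⁻¹ • v - y = (x - y) - L⁻¹ • v := by abel
    rw [h3, norm_neg, norm_smul, inner_neg_right, inner_smul_right, Real.norm_of_nonneg
      (inv_nonneg.2 h0.le)] at h1
    rw [h4, inner_sub_right, inner_smul_right] at h2
    have h5 : inner ℝ (gradient f x) v - inner ℝ (gradient f y) v = ‖v‖ ^ 2 := by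
      rw [← inner_sub_left, ← hv, real_inner_self_eq_norm_sq]
    have h6 : L⁻¹ * inner ℝ (gradient f x) v - L⁻¹ * inner ℝ (gradient f y) v
        = L⁻¹ * ‖v‖ ^ 2 := by rw [← mul_sub, h5]
    have h7 : L / 2 * (L⁻¹ * ‖v‖) ^ 2 = L⁻¹ * ‖v‖ ^ 2 / 2 := by
      field_simp
    have h8 : L⁻¹ * ‖v‖ ^ 2 ≤ 2 * (f x - f y - inner ℝ (gradient f y) (x - y)) := by linarith
    have h9 := mul_le_mul_of_nonneg_left h8 h0.le
    rw [mul_inv_cancel_left₀ h0.ne'] at h9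
    linarith

/-- The sublevel set of `g 0` lies in a ball of radius `2 / m * ‖a‖`, so a continuous `g` attains
its minimum. -/
theorem exists_isMinOn_of_quadratic_lower_bound {g : Vec d → ℝ} (hg : Continuous g) {a : Vec d}
    {m : ℝ} (hm : 0 < m) (h : ∀ x, g 0 + inner ℝ a x + m / 2 * ‖x‖ ^ 2 ≤ g x) :
    ∃ x₀, ∀ x, g x₀ ≤ g x := by
  refine Continuous.exists_forall_le_of_isBounded (x₀ := 0) hg ?_
  refine (Metric.isBounded_closedBall (x := (0 : Vec d)) (r := 2 / m * ‖a‖)).subset fun x hx => ?_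
  rw [mem_closedBall_zero_iff]
  simp only [Set.mem_ofPred_eq] at hx
  have h1 := h x
  have h2 := neg_le_of_abs_le (abs_real_inner_le_norm a x)
  by_contra! hlt
  have h3 : ‖a‖ < m / 2 * ‖x‖ := by
    have := mul_lt_mul_of_pos_left hlt (half_pos hm)
    calc ‖a‖ = m / 2 * (2 / m * ‖a‖) := by field_simp
      _ < _ := this
  have hx0 : 0 < ‖x‖ := lt_of_le_of_lt (by positivity) hlt
  nlinarith [mul_lt_mul_of_pos_right h3 hx0]

theorem gradient_eq_zero_of_forall_le {g : Vec d → ℝ} {x : Vec d} (h : ∀ y, g x ≤ g y) :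
    gradient g x = 0 := by
  have h1 : IsLocalMin g x := Filter.Eventually.of_forall h
  simp [gradient, h1.fderiv_eq_zero]

end ECCatalyst

/-! ### Inequalities for squared norms, and second moments of independent samples. -/

namespace ECCatalyst

variable {d n m : ℕ}

theorem norm_add_sq_le_two_mul (a b : Vec d) : ‖a + b‖ ^ 2 ≤ 2 * (‖a‖ ^ 2 + ‖b‖ ^ 2) := by
  have := parallelogram_law_with_norm ℝ a b
  nlinarith [sq_nonneg ‖a - b‖]

theorem norm_sub_sq_le_two_mul (a b : Vec d) : ‖a - b‖ ^ 2 ≤ 2 * (‖a‖ ^ 2 + ‖b‖ ^ 2) := by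
  simpa [sub_eq_add_neg] using norm_add_sq_le_two_mul a (-b)

theorem norm_add_sq_le_of_pos {s : ℝ} (hs : 0 < s) (a b : Vec d) :
    ‖a + b‖ ^ 2 ≤ (1 + s⁻¹) * ‖a‖ ^ 2 + (1 + s) * ‖b‖ ^ 2 := by
  have h1 := real_inner_le_norm a b
  have h2 : 2 * (‖a‖ * ‖b‖) ≤ s⁻¹ * ‖a‖ ^ 2 + s * ‖b‖ ^ 2 := by
    have h3 : 0 ≤ s⁻¹ * (‖a‖ - s * ‖b‖) ^ 2 := by positivity
    have h4 : s⁻¹ * (‖a‖ - s * ‖b‖) ^ 2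
        = s⁻¹ * ‖a‖ ^ 2 + s * ‖b‖ ^ 2 - 2 * (‖a‖ * ‖b‖) := by
      field_simp
      ring
    linarith
  rw [norm_add_sq_real]
  linarith

/-! ### Sums of independent uniform samples -/

/-- The uniform distribution on `m` samples. -/
noncomputable abbrev unif (m : ℕ) : Measure (Fin m) :=
  (m : ℝ≥0∞)⁻¹ • (Measure.count : Measure (Fin m))

theorem isProbabilityMeasure_unif (hm : 0 < m) : IsProbabilityMeasure (unif m) := by
  refine ⟨?_⟩
  rw [Measure.smul_apply, Measure.count_univ]
  simp [ENNReal.inv_mul_cancel, hm.ne']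

theorem integral_unif {E : Type*} [NormedAddCommGroup E] [NormedSpace ℝ E]
    [CompleteSpace E] (g : Fin m → E) : ∫ i, g i ∂(unif m) = (m : ℝ)⁻¹ • ∑ i, g i := by
  rw [integral_smul_measure, integral_countable (.of_finite)]
  simp [tsum_fintype, Measure.real]

theorem lintegral_unif_ofReal {g : Fin m → ℝ} (hg : ∀ i, 0 ≤ g i) :
    ∫⁻ i, ENNReal.ofReal (g i) ∂(unif m) = ENNReal.ofReal ((m : ℝ)⁻¹ * ∑ i, g i) := by
  rw [lintegral_smul_measure, lintegral_count, tsum_fintype,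
    ENNReal.ofReal_mul (by positivity), ENNReal.ofReal_sum_of_nonneg fun i _ => hg i]
  rcases m.eq_zero_or_pos with rfl | hm
  · simp
  · rw [ENNReal.ofReal_inv_of_pos (by positivity), ENNReal.ofReal_natCast, smul_eq_mul]

/-- The summands are independent and centred, so cross terms vanish and only the variances add up.
This is the source of the gain `1 / n` in the sampling noise. -/
theorem integral_norm_add_sum_sq (hm : 0 < m) (b : Vec d) (c : Fin n → Fin m → Vec d)
    (hc : ∀ τ, ∑ i, c τ i = 0) :
    ∫ z, ‖b + ∑ τ, c τ (z τ)‖ ^ 2 ∂(Measure.pi fun _ : Fin n => unif m)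
      = ‖b‖ ^ 2 + ∑ τ, (m : ℝ)⁻¹ * ∑ i, ‖c τ i‖ ^ 2 := by
  have := isProbabilityMeasure_unif hm
  set P := Measure.pi fun _ : Fin n => unif m
  have hint : ∀ {E : Type} [NormedAddCommGroup E] (g : (Fin n → Fin m) → E), Integrable g P :=
    fun g => Integrable.of_finite
  have heval : ∀ {E : Type} [NormedAddCommGroup E] [NormedSpace ℝ E] [CompleteSpace E]
      (τ : Fin n) (g : Fin m → E),
      ∫ z, g (z τ) ∂P = (m : ℝ)⁻¹ • ∑ i, g i := by
    intro E _ _ _ τ g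
    rw [← integral_unif, ← (measurePreserving_eval (fun _ : Fin n => unif m) τ).map_eq,
      integral_map (measurable_pi_apply τ).aemeasurable
        (StronglyMeasurable.of_discrete).aestronglyMeasurable]
  have hmean : ∀ τ, ∫ z, c τ (z τ) ∂P = 0 := by
    intro τ
    rw [heval, hc, smul_zero]
  have hcross : ∀ τ σ, τ ≠ σ → ∫ z, inner ℝ (c τ (z τ)) (c σ (z σ)) ∂P = 0 := by
    intro τ σ hne
    have hI : iIndepFun (fun (τ : Fin n) (z : Fin n → Fin m) => c τ (z τ)) P :=
      iIndepFun_pi fun τ => (Measurable.of_discrete).aemeasurable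
    have := (hI.indepFun hne).integral_bilin (hint _) (hint _) (innerSL ℝ)
    rw [hmean, map_zero] at this
    exact this
  have hexp : ∀ z : Fin n → Fin m, ‖b + ∑ τ, c τ (z τ)‖ ^ 2
      = ‖b‖ ^ 2 + 2 * inner ℝ b (∑ τ, c τ (z τ))
        + ∑ τ, ∑ σ, inner ℝ (c τ (z τ)) (c σ (z σ)) := by
    intro z
    rw [norm_add_sq_real, ← real_inner_self_eq_norm_sq (∑ τ, c τ (z τ)), sum_inner]
    simp_rw [inner_sum]
  simp_rw [hexp]
  rw [integral_add (hint _) (hint _), integral_add (hint _) (hint _), integral_const_mul,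
    integral_inner (hint _), integral_finsetSum _ fun _ _ => hint _,
    integral_finsetSum _ fun _ _ => hint _]
  simp_rw [hmean, integral_finsetSum _ fun _ _ => hint _]
  have hdiag : ∀ τ, ∑ σ, ∫ z, inner ℝ (c τ (z τ)) (c σ (z σ)) ∂P
      = (m : ℝ)⁻¹ * ∑ i, ‖c τ i‖ ^ 2 := by
    intro τ
    rw [Finset.sum_eq_single τ (fun σ _ h => hcross τ σ h.symm) (by simp)]
    simp_rw [real_inner_self_eq_norm_sq]
    exact heval τ fun i => ‖c τ i‖ ^ 2
  simp_rw [hdiag]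
  simp

theorem sum_sub_mean (hm : 0 < m) (u : Fin m → Vec d) :
    ∑ i, (u i - (m : ℝ)⁻¹ • ∑ j, u j) = 0 := by
  have : (m : ℝ) ≠ 0 := by positivity
  rw [Finset.sum_sub_distrib, Finset.sum_const, Finset.card_univ, Fintype.card_fin,
    ← Nat.cast_smul_eq_nsmul ℝ, smul_smul, mul_inv_cancel₀ this, one_smul, sub_self]

/-- Bias–variance decomposition. It also yields that the mean minimizes the mean square deviation,
and Jensen's inequality for the squared norm. -/
theorem mean_norm_add_sq (hm : 0 < m) (b : Vec d) (u : Fin m → Vec d) :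
    (m : ℝ)⁻¹ * ∑ i, ‖b + u i‖ ^ 2 = ‖b + (m : ℝ)⁻¹ • ∑ i, u i‖ ^ 2
      + (m : ℝ)⁻¹ * ∑ i, ‖u i - (m : ℝ)⁻¹ • ∑ j, u j‖ ^ 2 := by
  set ub := (m : ℝ)⁻¹ • ∑ j, u j with hub
  have hm' : (m : ℝ) ≠ 0 := by positivity
  have h : ∀ i, ‖b + u i‖ ^ 2
      = ‖b + ub‖ ^ 2 + 2 * inner ℝ (b + ub) (u i - ub) + ‖u i - ub‖ ^ 2 := by
    intro i
    rw [← norm_add_sq_real, add_add_sub_cancel]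
  simp_rw [h, Finset.sum_add_distrib, ← Finset.mul_sum, ← inner_sum, hub, sum_sub_mean hm]
  simp [hm', mul_add]

theorem mean_norm_sub_mean_sq_le (hm : 0 < m) (u : Fin m → Vec d) (a : Vec d) :
    (m : ℝ)⁻¹ * ∑ i, ‖u i - (m : ℝ)⁻¹ • ∑ j, u j‖ ^ 2
      ≤ (m : ℝ)⁻¹ * ∑ i, ‖u i - a‖ ^ 2 := by
  have h := mean_norm_add_sq hm (-a) u
  simp_rw [neg_add_eq_sub] at h
  rw [h]
  exact le_add_of_nonneg_left (sq_nonneg _)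

theorem norm_mean_sq_le (u : Fin n → Vec d) :
    ‖(n : ℝ)⁻¹ • ∑ τ, u τ‖ ^ 2 ≤ (n : ℝ)⁻¹ * ∑ τ, ‖u τ‖ ^ 2 := by
  rcases n.eq_zero_or_pos with rfl | hn
  · simp
  · have := mean_norm_add_sq hn 0 u
    simp only [zero_add] at this
    rw [this]
    exact le_add_of_nonneg_right (by positivity)

theorem lintegral_norm_sub_smul_mean_sq (hm : 0 < m) (a : Vec d) (η : ℝ)
    (u : Fin n → Fin m → Vec d) :
    ∫⁻ z, ENNReal.ofReal (‖a - η • ((n : ℝ)⁻¹ • ∑ τ, u τ (z τ))‖ ^ 2)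
        ∂(Measure.pi fun _ : Fin n => unif m)
      = ENNReal.ofReal (‖a - η • ((n : ℝ)⁻¹ • ∑ τ, (m : ℝ)⁻¹ • ∑ i, u τ i)‖ ^ 2
        + (η / n) ^ 2 * ∑ τ, (m : ℝ)⁻¹ * ∑ i, ‖u τ i - (m : ℝ)⁻¹ • ∑ j, u τ j‖ ^ 2) := by
  have := isProbabilityMeasure_unif hm
  rw [← ofReal_integral_eq_lintegral_ofReal .of_finite (.of_forall fun z => sq_nonneg _)]
  congr 1
  set ub : Fin n → Vec d := fun τ => (m : ℝ)⁻¹ • ∑ i, u τ i with hub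
  have h := integral_norm_add_sum_sq hm (a - η • ((n : ℝ)⁻¹ • ∑ τ, ub τ))
    (fun τ i => (-(η / n)) • (u τ i - ub τ))
    (fun τ => by rw [← Finset.smul_sum, sum_sub_mean hm, smul_zero])
  have h1 : ∀ z : Fin n → Fin m, a - η • ((n : ℝ)⁻¹ • ∑ τ, u τ (z τ))
      = a - η • ((n : ℝ)⁻¹ • ∑ τ, ub τ) + ∑ τ, (-(η / n)) • (u τ (z τ) - ub τ) := by
    intro z
    rw [← Finset.smul_sum (s := Finset.univ) (r := -(η / n)), Finset.sum_sub_distrib]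
    module
  simp_rw [h1, h]
  congr 1
  rw [Finset.mul_sum]
  refine Finset.sum_congr rfl fun τ _ => ?_
  simp_rw [norm_smul, mul_pow, ← Finset.mul_sum]
  rw [norm_neg, Real.norm_eq_abs, sq_abs]
  ring

end ECCatalyst

namespace ECCatalyst

variable {d n m : ℕ}

/-! ### The finite-sum problem solved by EC-LSVRG -/

/-- The local function `F^{(τ)} = (1/m) ∑_i F_i^{(τ)}`. -/
noncomputable def nodeFun (F : Fin n → Fin m → Vec d → ℝ) (τ : Fin n) (v : Vec d) : ℝ :=
  (m : ℝ)⁻¹ * ∑ i, F τ i v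

/-- The objective `(1/n) ∑_τ F^{(τ)}`. -/
noncomputable def avgFun (F : Fin n → Fin m → Vec d → ℝ) (v : Vec d) : ℝ :=
  (n : ℝ)⁻¹ * ∑ τ, nodeFun F τ v

/-- The assumptions on a finite-sum problem under which EC-LSVRG is analysed. -/
structure FiniteSumProblem (F : Fin n → Fin m → Vec d → ℝ) (μc ℓf ℓb ℓ : ℝ) (xs : Vec d) :
    Prop where
  dim_pos : 0 < d
  nodes_pos : 0 < n
  samples_pos : 0 < m
  convex : ∀ τ i, ConvexOn ℝ Set.univ (F τ i)
  smooth_comp : ∀ τ i, IsSmooth ℓ (F τ i)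
  smooth_node : ∀ τ, IsSmooth ℓb (nodeFun F τ)
  smooth_avg : IsSmooth ℓf (avgFun F)
  mu_pos : 0 < μc
  strong : ∀ x y, avgFun F x + inner ℝ (gradient (avgFun F) x) (y - x) + μc / 2 * ‖y - x‖ ^ 2
    ≤ avgFun F y
  isMin : ∀ x, avgFun F xs ≤ avgFun F x

theorem convexOn_const_mul_sum {ι : Type*} (s : Finset ι) {c : ℝ} (hc : 0 ≤ c)
    {f : ι → Vec d → ℝ} (hf : ∀ i ∈ s, ConvexOn ℝ Set.univ (f i)) :
    ConvexOn ℝ Set.univ fun v => c * ∑ i ∈ s, f i v := by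
  have h : ConvexOn ℝ Set.univ fun v => ∑ i ∈ s, f i v := by
    refine ⟨convex_univ, fun x _ y _ a b ha hb hab => ?_⟩
    rw [Finset.smul_sum, Finset.smul_sum, ← Finset.sum_add_distrib]
    exact Finset.sum_le_sum fun i hi => (hf i hi).2 (Set.mem_univ x) (Set.mem_univ y) ha hb hab
  exact h.smul hc

namespace FiniteSumProblem

variable {F : Fin n → Fin m → Vec d → ℝ} {μc ℓf ℓb ℓ : ℝ} {xs : Vec d}

theorem gradient_nodeFun (h : FiniteSumProblem F μc ℓf ℓb ℓ xs) (τ : Fin n) (x : Vec d) :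
    gradient (nodeFun F τ) x = (m : ℝ)⁻¹ • ∑ i, gradient (F τ i) x :=
  (hasGradientAt_const_mul _ (hasGradientAt_sum _ fun i _ =>
    (h.smooth_comp τ i).hasGradientAt x)).gradient

theorem gradient_avgFun (h : FiniteSumProblem F μc ℓf ℓb ℓ xs) (x : Vec d) :
    gradient (avgFun F) x = (n : ℝ)⁻¹ • ∑ τ, gradient (nodeFun F τ) x :=
  (hasGradientAt_const_mul _ (hasGradientAt_sum _ fun τ _ =>
    (h.smooth_node τ).hasGradientAt x)).gradient

theorem gradient_min (h : FiniteSumProblem F μc ℓf ℓb ℓ xs) : gradient (avgFun F) xs = 0 :=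
  gradient_eq_zero_of_forall_le h.isMin

theorem convex_node (h : FiniteSumProblem F μc ℓf ℓb ℓ xs) (τ : Fin n) :
    ConvexOn ℝ Set.univ (nodeFun F τ) :=
  convexOn_const_mul_sum _ (by positivity) fun i _ => h.convex τ i

theorem convex_avg (h : FiniteSumProblem F μc ℓf ℓb ℓ xs) : ConvexOn ℝ Set.univ (avgFun F) :=
  convexOn_const_mul_sum _ (by positivity) fun τ _ => h.convex_node τ

/-- After averaging the componentwise bound, the linear terms combine into the gradient of the full
objective at `xs`, which is zero, although the individual gradients at `xs` need not vanish. -/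
theorem mean_gradient_comp_le (h : FiniteSumProblem F μc ℓf ℓb ℓ xs) (x : Vec d) :
    (n : ℝ)⁻¹ * ∑ τ, (m : ℝ)⁻¹ * ∑ i, ‖gradient (F τ i) x - gradient (F τ i) xs‖ ^ 2
      ≤ 2 * ℓ * (avgFun F x - avgFun F xs) := by
  calc _ ≤ (n : ℝ)⁻¹ * ∑ τ, (m : ℝ)⁻¹ * ∑ i,
        2 * ℓ * (F τ i x - F τ i xs - inner ℝ (gradient (F τ i) xs) (x - xs)) := by
        gcongr with τ _ i _
        exact norm_gradient_sub_sq_le h.dim_pos (h.convex τ i) (h.smooth_comp τ i) x xs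
    _ = 2 * ℓ * (avgFun F x - avgFun F xs - inner ℝ (gradient (avgFun F) xs) (x - xs)) := by
        rw [h.gradient_avgFun]
        simp_rw [h.gradient_nodeFun, avgFun, nodeFun, inner_smul_left, sum_inner, inner_smul_left,
          sum_inner]
        simp only [Finset.mul_sum, ← Finset.sum_sub_distrib, Finset.mul_sum]
        refine Finset.sum_congr rfl fun τ _ => Finset.sum_congr rfl fun i _ => ?_
        simp
        ring
    _ = _ := by rw [h.gradient_min, inner_zero_left, sub_zero]

theorem mean_gradient_node_le (h : FiniteSumProblem F μc ℓf ℓb ℓ xs) (x : Vec d) :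
    (n : ℝ)⁻¹ * ∑ τ, ‖gradient (nodeFun F τ) x - gradient (nodeFun F τ) xs‖ ^ 2
      ≤ 2 * ℓb * (avgFun F x - avgFun F xs) := by
  calc _ ≤ (n : ℝ)⁻¹ * ∑ τ, 2 * ℓb * (nodeFun F τ x - nodeFun F τ xs
          - inner ℝ (gradient (nodeFun F τ) xs) (x - xs)) := by
        gcongr with τ _
        exact norm_gradient_sub_sq_le h.dim_pos (h.convex_node τ) (h.smooth_node τ) x xs
    _ = 2 * ℓb * (avgFun F x - avgFun F xs - inner ℝ (gradient (avgFun F) xs) (x - xs)) := by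
        rw [h.gradient_avgFun]
        simp_rw [avgFun, inner_smul_left, sum_inner, conj_trivial, ← Finset.mul_sum,
          Finset.sum_sub_distrib]
        ring
    _ = _ := by rw [h.gradient_min, inner_zero_left, sub_zero]

theorem norm_gradient_avgFun_sq_le (h : FiniteSumProblem F μc ℓf ℓb ℓ xs) (x : Vec d) :
    ‖gradient (avgFun F) x‖ ^ 2 ≤ 2 * ℓf * (avgFun F x - avgFun F xs) := by
  have := norm_gradient_sub_sq_le h.dim_pos h.convex_avg h.smooth_avg x xs
  simpa [h.gradient_min] using this

theorem gap_nonneg (h : FiniteSumProblem F μc ℓf ℓb ℓ xs) (x : Vec d) :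
    0 ≤ avgFun F x - avgFun F xs :=
  sub_nonneg.2 (h.isMin x)

theorem gap_ge (h : FiniteSumProblem F μc ℓf ℓb ℓ xs) (x : Vec d) :
    μc / 2 * ‖x - xs‖ ^ 2 ≤ avgFun F x - avgFun F xs := by
  have := h.strong xs x
  rw [h.gradient_min, inner_zero_left] at this
  linarith

theorem inner_gradient_ge (h : FiniteSumProblem F μc ℓf ℓb ℓ xs) (x : Vec d) :
    avgFun F x - avgFun F xs + μc / 2 * ‖x - xs‖ ^ 2
      ≤ inner ℝ (gradient (avgFun F) x) (x - xs) := by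
  have := h.strong x xs
  rw [← neg_sub x xs, inner_neg_right, norm_neg] at this
  linarith

/-- The quadratic upper and lower bounds are compared at a unit vector, which exists because `0 <
d`. -/
theorem mu_le (h : FiniteSumProblem F μc ℓf ℓb ℓ xs) : μc ≤ ℓf := by
  set e : Vec d := EuclideanSpace.single ⟨0, h.dim_pos⟩ 1
  have he : ‖e‖ = 1 := by simp [e]
  have h1 := h.smooth_avg.descent 0 e
  have h2 := h.strong 0 e
  rw [sub_zero, he] at h1 h2
  linarith

theorem lf_pos (h : FiniteSumProblem F μc ℓf ℓb ℓ xs) : 0 < ℓf := h.mu_pos.trans_le h.mu_le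

theorem l_nonneg (h : FiniteSumProblem F μc ℓf ℓb ℓ xs) : 0 ≤ ℓ :=
  (h.smooth_comp ⟨0, h.nodes_pos⟩ ⟨0, h.samples_pos⟩).nonneg h.dim_pos

theorem lb_nonneg (h : FiniteSumProblem F μc ℓf ℓb ℓ xs) : 0 ≤ ℓb :=
  (h.smooth_node ⟨0, h.nodes_pos⟩).nonneg h.dim_pos

theorem mean_gradient_comp_sub_le (h : FiniteSumProblem F μc ℓf ℓb ℓ xs) (x w : Vec d) :
    (n : ℝ)⁻¹ * ∑ τ, (m : ℝ)⁻¹ * ∑ i, ‖gradient (F τ i) x - gradient (F τ i) w‖ ^ 2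
      ≤ 4 * ℓ * ((avgFun F x - avgFun F xs) + (avgFun F w - avgFun F xs)) := by
  have hx := h.mean_gradient_comp_le x
  have hw := h.mean_gradient_comp_le w
  calc _ ≤ (n : ℝ)⁻¹ * ∑ τ, (m : ℝ)⁻¹ * ∑ i,
        (2 * ‖gradient (F τ i) x - gradient (F τ i) xs‖ ^ 2
          + 2 * ‖gradient (F τ i) w - gradient (F τ i) xs‖ ^ 2) := by
        gcongr with τ _ i _
        rw [← sub_sub_sub_cancel_right _ _ (gradient (F τ i) xs), ← mul_add]
        exact norm_sub_sq_le_two_mul _ _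
    _ = 2 * ((n : ℝ)⁻¹ * ∑ τ, (m : ℝ)⁻¹ * ∑ i, ‖gradient (F τ i) x - gradient (F τ i) xs‖ ^ 2)
        + 2 * ((n : ℝ)⁻¹ * ∑ τ, (m : ℝ)⁻¹ * ∑ i,
            ‖gradient (F τ i) w - gradient (F τ i) xs‖ ^ 2) := by
        simp_rw [Finset.mul_sum, ← Finset.sum_add_distrib]
        refine Finset.sum_congr rfl fun τ _ => Finset.sum_congr rfl fun i _ => ?_
        ring
    _ ≤ _ := by linarith

end FiniteSumProblem

end ECCatalyst

namespace ECCatalyst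

variable {d n m : ℕ} {S S₁ : Type*}

/-! ### One iteration of EC-LSVRG -/

/-- The virtual iterate `x - (1/n) ∑_τ e_τ`. -/
noncomputable def virt (s : ECState d n) : Vec d := s.x - (n : ℝ)⁻¹ • ∑ τ, s.e τ

/-- The mean squared norm of the local errors. -/
noncomputable def errSq (s : ECState d n) : ℝ := (n : ℝ)⁻¹ * ∑ τ, ‖s.e τ‖ ^ 2

/-- The mean squared distance of the local shifts from the local gradients at the check point. -/
noncomputable def shiftSq (F : Fin n → Fin m → Vec d → ℝ) (s : ECState d n) : ℝ :=
  (n : ℝ)⁻¹ * ∑ τ, ‖gradient (nodeFun F τ) s.w - s.h τ‖ ^ 2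

/-- The variance-reduced local gradient estimator. -/
noncomputable def estim (F : Fin n → Fin m → Vec d → ℝ) (x w : Vec d) (τ : Fin n) (i : Fin m) :
    Vec d :=
  gradient (F τ i) x - gradient (F τ i) w + gradient (nodeFun F τ) w

theorem errSq_nonneg (s : ECState d n) : 0 ≤ errSq s := by unfold errSq; positivity

theorem shiftSq_nonneg (F : Fin n → Fin m → Vec d → ℝ) (s : ECState d n) : 0 ≤ shiftSq F s := by
  unfold shiftSq; positivity

theorem ecStep_e (F : Fin n → Fin m → Vec d → ℝ) (Q : Vec d → S → Vec d)
    (Q₁ : Vec d → S₁ → Vec d) (η : ℝ) (s : ECState d n) (z : Seed n m S S₁) (τ : Fin n) :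
    (ecStep F Q Q₁ η s z).e τ = (s.e τ + η • (estim F s.x s.w τ (z.1 τ) - s.h τ))
      - Q (s.e τ + η • (estim F s.x s.w τ (z.1 τ) - s.h τ)) (z.2.1 τ) := by
  rw [add_comm (s.e τ)]
  simp only [ecStep, estim]
  rw [add_comm (s.e τ)]
  rfl

theorem ecStep_x (F : Fin n → Fin m → Vec d → ℝ) (Q : Vec d → S → Vec d)
    (Q₁ : Vec d → S₁ → Vec d) (η : ℝ) (s : ECState d n) (z : Seed n m S S₁) :
    (ecStep F Q Q₁ η s z).x = s.x - ((n : ℝ)⁻¹ • ∑ τ,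
      Q (s.e τ + η • (estim F s.x s.w τ (z.1 τ) - s.h τ)) (z.2.1 τ) + η • s.hAvg) := by
  simp only [add_comm (s.e _)]
  rfl

/-- The compressed messages are subtracted both from `x` and from the errors, hence cancel, and the
local shifts cancel against `hAvg`. What remains is a step with the variance-reduced estimator, free
of compressor randomness. -/
theorem virt_ecStep (F : Fin n → Fin m → Vec d → ℝ) (Q : Vec d → S → Vec d)
    (Q₁ : Vec d → S₁ → Vec d) (η : ℝ) (s : ECState d n) (hs : s.hAvg = (n : ℝ)⁻¹ • ∑ τ, s.h τ)
    (z : Seed n m S S₁) :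
    virt (ecStep F Q Q₁ η s z)
      = virt s - η • ((n : ℝ)⁻¹ • ∑ τ, estim F s.x s.w τ (z.1 τ)) := by
  simp only [virt, ecStep_x, ecStep_e, hs, Finset.sum_sub_distrib, Finset.sum_add_distrib, smul_sub,
    smul_add, ← Finset.smul_sum]
  module

theorem hAvg_ecStep (F : Fin n → Fin m → Vec d → ℝ) (Q : Vec d → S → Vec d)
    (Q₁ : Vec d → S₁ → Vec d) (η : ℝ) (s : ECState d n) (hs : s.hAvg = (n : ℝ)⁻¹ • ∑ τ, s.h τ)
    (z : Seed n m S S₁) :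
    (ecStep F Q Q₁ η s z).hAvg = (n : ℝ)⁻¹ • ∑ τ, (ecStep F Q Q₁ η s z).h τ := by
  simp only [ecStep, hs, Finset.sum_add_distrib, smul_add]

variable {F : Fin n → Fin m → Vec d → ℝ} {μc ℓf ℓb ℓ : ℝ} {xs : Vec d}

theorem FiniteSumProblem.mean_estim (h : FiniteSumProblem F μc ℓf ℓb ℓ xs) (x w : Vec d)
    (τ : Fin n) : (m : ℝ)⁻¹ • ∑ i, estim F x w τ i = gradient (nodeFun F τ) x := by
  have hm : (m : ℝ) ≠ 0 := by exact_mod_cast h.samples_pos.ne'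
  simp only [estim, Finset.sum_add_distrib, Finset.sum_sub_distrib, smul_add, smul_sub,
    ← h.gradient_nodeFun]
  rw [Finset.sum_const, Finset.card_univ, Fintype.card_fin, ← Nat.cast_smul_eq_nsmul ℝ, smul_smul,
    inv_mul_cancel₀ hm, one_smul, sub_add_cancel]

/-- The variance is at most the second moment about the gradient at the check point, which leaves
only the differences of component gradients at `x` and `w`. The noise thus disappears as both points
approach the minimizer. -/
theorem FiniteSumProblem.mean_var_estim_le (h : FiniteSumProblem F μc ℓf ℓb ℓ xs) (x w : Vec d) :
    (n : ℝ)⁻¹ * ∑ τ, (m : ℝ)⁻¹ * ∑ i,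
        ‖estim F x w τ i - (m : ℝ)⁻¹ • ∑ j, estim F x w τ j‖ ^ 2
      ≤ 4 * ℓ * ((avgFun F x - avgFun F xs) + (avgFun F w - avgFun F xs)) := by
  refine le_trans ?_ (h.mean_gradient_comp_sub_le x w)
  refine mul_le_mul_of_nonneg_left (Finset.sum_le_sum fun τ _ => ?_) (by positivity)
  refine (mean_norm_sub_mean_sq_le h.samples_pos _ (gradient (nodeFun F τ) w)).trans ?_
  simp [estim]

/-- The bound on the squared distance of the virtual iterate from the minimizer. -/
theorem FiniteSumProblem.virt_bound (h : FiniteSumProblem F μc ℓf ℓb ℓ xs) {η : ℝ} (hη : 0 < η)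
    (s : ECState d n) :
    ‖(virt s - xs) - η • ((n : ℝ)⁻¹ • ∑ τ, (m : ℝ)⁻¹ • ∑ i, estim F s.x s.w τ i)‖ ^ 2
        + (η / n) ^ 2 * ∑ τ, (m : ℝ)⁻¹ * ∑ i,
          ‖estim F s.x s.w τ i - (m : ℝ)⁻¹ • ∑ j, estim F s.x s.w τ j‖ ^ 2
      ≤ (1 - μc * η / 2) * ‖virt s - xs‖ ^ 2 - η * (avgFun F s.x - avgFun F xs)
        + 3 * η * ℓf * errSq s + 2 * η ^ 2 * ℓf * (avgFun F s.x - avgFun F xs)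
        + 4 * η ^ 2 * (ℓ / n) * ((avgFun F s.x - avgFun F xs) + (avgFun F s.w - avgFun F xs)) := by
  have hvar := h.mean_var_estim_le s.x s.w
  simp_rw [h.mean_estim] at hvar ⊢
  rw [← h.gradient_avgFun]
  set gx := avgFun F s.x - avgFun F xs
  set gw := avgFun F s.w - avgFun F xs
  set D := gradient (avgFun F) s.x
  set eb := (n : ℝ)⁻¹ • ∑ τ, s.e τ with heb
  have hvar' : (η / n) ^ 2 * ∑ τ, (m : ℝ)⁻¹ * ∑ i,
      ‖estim F s.x s.w τ i - gradient (nodeFun F τ) s.x‖ ^ 2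
        ≤ 4 * η ^ 2 * (ℓ / n) * (gx + gw) := by
    have := mul_le_mul_of_nonneg_left hvar (show 0 ≤ η ^ 2 * (n : ℝ)⁻¹ by positivity)
    refine le_trans (le_of_eq ?_) (this.trans (le_of_eq ?_))
    · rw [← mul_assoc]; congr 1; field_simp
    · field_simp
  have hE : ‖eb‖ ^ 2 ≤ errSq s := norm_mean_sq_le _
  have hD := h.norm_gradient_avgFun_sq_le s.x
  have hin := h.inner_gradient_ge s.x
  have hV : virt s - xs = (s.x - xs) - eb := by simp only [virt, heb]; abel
  have hlf := h.lf_pos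
  have hVle : ‖virt s - xs‖ ^ 2 ≤ 2 * (‖s.x - xs‖ ^ 2 + ‖eb‖ ^ 2) := by
    rw [hV]; exact norm_sub_sq_le_two_mul _ _
  -- The Young parameter `2 * ℓf` makes the term in `‖D‖ ^ 2` at most the gap, so only half of the
  -- descent is spent on replacing `x` by the virtual point.
  have hcross : inner ℝ D eb ≤ ℓf * ‖eb‖ ^ 2 + gx / 2 := by
    have h1 := norm_add_sq_le_of_pos (s := 2 * ℓf) (by positivity) D eb
    rw [norm_add_sq_real] at h1
    have h2 : (2 * ℓf)⁻¹ * ‖D‖ ^ 2 ≤ gx := by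
      rw [inv_mul_le_iff₀ (by positivity)]; exact hD
    linarith
  rw [norm_sub_sq_real, inner_smul_right, real_inner_comm, norm_smul, Real.norm_of_nonneg hη.le,
    mul_pow]
  have hin2 : inner ℝ D (virt s - xs) = inner ℝ D (s.x - xs) - inner ℝ D eb := by
    rw [hV, inner_sub_right]
  have hmu := h.mu_pos
  -- The coefficient `3 / 2` is `1` from the cross term plus `1 / 2` from moving the strong
  -- convexity term to the virtual point, where `μc ≤ ℓf` is used.
  have key : gx / 2 + μc / 4 * ‖virt s - xs‖ ^ 2 - 3 / 2 * ℓf * errSq s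
      ≤ inner ℝ D (virt s - xs) := by
    have e1 : μc / 2 * ‖eb‖ ^ 2 ≤ ℓf / 2 * ‖eb‖ ^ 2 := by
      have := h.mu_le
      gcongr
    have e2 : μc / 4 * ‖virt s - xs‖ ^ 2 ≤ μc / 4 * (2 * (‖s.x - xs‖ ^ 2 + ‖eb‖ ^ 2)) := by
      gcongr
    have e3 : 3 / 2 * ℓf * ‖eb‖ ^ 2 ≤ 3 / 2 * ℓf * errSq s := by gcongr
    rw [hin2]
    linarith
  have k1 := mul_le_mul_of_nonneg_left key (show 0 ≤ 2 * η by positivity)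
  have k2 := mul_le_mul_of_nonneg_left hD (show 0 ≤ η ^ 2 by positivity)
  linarith

theorem FiniteSumProblem.mean_gradient_node_sub_le (h : FiniteSumProblem F μc ℓf ℓb ℓ xs)
    (x w : Vec d) :
    (n : ℝ)⁻¹ * ∑ τ, ‖gradient (nodeFun F τ) x - gradient (nodeFun F τ) w‖ ^ 2
      ≤ 4 * ℓb * ((avgFun F x - avgFun F xs) + (avgFun F w - avgFun F xs)) := by
  have hx := h.mean_gradient_node_le x
  have hw := h.mean_gradient_node_le w
  calc _ ≤ (n : ℝ)⁻¹ * ∑ τ, (2 * ‖gradient (nodeFun F τ) x - gradient (nodeFun F τ) xs‖ ^ 2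
          + 2 * ‖gradient (nodeFun F τ) w - gradient (nodeFun F τ) xs‖ ^ 2) := by
        gcongr with τ _
        rw [← sub_sub_sub_cancel_right _ _ (gradient (nodeFun F τ) xs), ← mul_add]
        exact norm_sub_sq_le_two_mul _ _
    _ = 2 * ((n : ℝ)⁻¹ * ∑ τ, ‖gradient (nodeFun F τ) x - gradient (nodeFun F τ) xs‖ ^ 2)
        + 2 * ((n : ℝ)⁻¹ * ∑ τ, ‖gradient (nodeFun F τ) w - gradient (nodeFun F τ) xs‖ ^ 2) := by
        rw [Finset.sum_add_distrib, ← Finset.mul_sum, ← Finset.mul_sum]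
        ring
    _ ≤ _ := by linarith

/-- The bound on the mean squared local errors. -/
theorem FiniteSumProblem.err_bound (h : FiniteSumProblem F μc ℓf ℓb ℓ xs) {η δ : ℝ}
    (hδ : 0 < δ) (hδ' : δ ≤ 1) (s : ECState d n) :
    (n : ℝ)⁻¹ * ∑ τ, (1 - δ) * ((m : ℝ)⁻¹ * ∑ i,
        ‖s.e τ + η • (estim F s.x s.w τ i - s.h τ)‖ ^ 2)
      ≤ (1 - δ / 2) * errSq s
        + (1 - δ) * (3 / δ) * η ^ 2 * (8 * ℓb * ((avgFun F s.x - avgFun F xs)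
          + (avgFun F s.w - avgFun F xs)) + 2 * shiftSq F s)
        + (1 - δ) * η ^ 2 * (4 * ℓ * ((avgFun F s.x - avgFun F xs)
          + (avgFun F s.w - avgFun F xs))) := by
  have hvar := h.mean_var_estim_le s.x s.w
  have hnode := h.mean_gradient_node_sub_le s.x s.w
  set g2 := (avgFun F s.x - avgFun F xs) + (avgFun F s.w - avgFun F xs)
  have hδ1 : 0 ≤ 1 - δ := sub_nonneg.2 hδ'
  have hper : ∀ τ, (1 - δ) * ((m : ℝ)⁻¹ * ∑ i, ‖s.e τ + η • (estim F s.x s.w τ i - s.h τ)‖ ^ 2)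
      ≤ (1 - δ / 2) * ‖s.e τ‖ ^ 2 + (1 - δ) * (3 / δ) * η ^ 2 *
          (2 * ‖gradient (nodeFun F τ) s.x - gradient (nodeFun F τ) s.w‖ ^ 2
            + 2 * ‖gradient (nodeFun F τ) s.w - s.h τ‖ ^ 2)
        + (1 - δ) * η ^ 2 * ((m : ℝ)⁻¹ * ∑ i,
            ‖estim F s.x s.w τ i - (m : ℝ)⁻¹ • ∑ j, estim F s.x s.w τ j‖ ^ 2) := by
    intro τ
    have hmean : (m : ℝ)⁻¹ • ∑ i, η • (estim F s.x s.w τ i - s.h τ)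
        = η • (gradient (nodeFun F τ) s.x - s.h τ) := by
      have hm : (m : ℝ) ≠ 0 := by exact_mod_cast h.samples_pos.ne'
      rw [← Finset.smul_sum, Finset.sum_sub_distrib, ← h.mean_estim s.x s.w τ, smul_comm,
        smul_sub, Finset.sum_const, Finset.card_univ, Fintype.card_fin,
        ← Nat.cast_smul_eq_nsmul ℝ, smul_smul, inv_mul_cancel₀ hm, one_smul]
    -- The mean is separated from the noise before Young's inequality is applied. Only the mean part
    -- then pays the factor `3 / δ`; this is why `ℓ` enters the stepsize with `1 / √δ` while `ℓb`
    -- enters with `1 / δ`.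
    rw [mean_norm_add_sq h.samples_pos, hmean]
    simp_rw [← smul_sub, h.mean_estim, sub_sub_sub_cancel_right, norm_smul, mul_pow,
      ← Finset.mul_sum, Real.norm_eq_abs, sq_abs]
    -- With parameter `δ / 2` the old error keeps the factor `(1 - δ) * (1 + δ / 2) ≤ 1 - δ / 2`.
    have h1 := norm_add_sq_le_of_pos (s := δ / 2) (by positivity)
      (η • (gradient (nodeFun F τ) s.x - s.h τ)) (s.e τ)
    rw [add_comm, norm_smul, mul_pow, Real.norm_eq_abs, sq_abs] at h1
    have h2 : ‖gradient (nodeFun F τ) s.x - s.h τ‖ ^ 2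
        ≤ 2 * ‖gradient (nodeFun F τ) s.x - gradient (nodeFun F τ) s.w‖ ^ 2
            + 2 * ‖gradient (nodeFun F τ) s.w - s.h τ‖ ^ 2 := by
      rw [← sub_add_sub_cancel _ (gradient (nodeFun F τ) s.w), ← mul_add]
      exact norm_add_sq_le_two_mul _ _
    have h3 : 1 + (δ / 2)⁻¹ ≤ 3 / δ := by
      rw [inv_div, ← sub_nonneg]
      have : 3 / δ - (1 + 2 / δ) = (1 - δ) / δ := by field_simp; ring
      rw [this]; positivity
    have h4 : (1 - δ) * (1 + δ / 2) ≤ 1 - δ / 2 := by nlinarith [sq_nonneg δ]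
    calc _ = (1 - δ) * ‖s.e τ + η • (gradient (nodeFun F τ) s.x - s.h τ)‖ ^ 2
          + (1 - δ) * η ^ 2 * ((m : ℝ)⁻¹ * ∑ i,
            ‖estim F s.x s.w τ i - gradient (nodeFun F τ) s.x‖ ^ 2) := by ring
      _ ≤ ((1 - δ / 2) * ‖s.e τ‖ ^ 2 + (1 - δ) * (3 / δ) * η ^ 2 *
          (2 * ‖gradient (nodeFun F τ) s.x - gradient (nodeFun F τ) s.w‖ ^ 2
            + 2 * ‖gradient (nodeFun F τ) s.w - s.h τ‖ ^ 2)) + _ := by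
        gcongr
        calc _ ≤ (1 - δ) * ((1 + (δ / 2)⁻¹) * (η ^ 2 *
              ‖gradient (nodeFun F τ) s.x - s.h τ‖ ^ 2) + (1 + δ / 2) * ‖s.e τ‖ ^ 2) := by
              gcongr
          _ = (1 - δ) * (1 + δ / 2) * ‖s.e τ‖ ^ 2 + (1 - δ) * (1 + (δ / 2)⁻¹) * η ^ 2 *
              ‖gradient (nodeFun F τ) s.x - s.h τ‖ ^ 2 := by ring
          _ ≤ _ := by gcongr
  calc _ ≤ (n : ℝ)⁻¹ * ∑ τ, ((1 - δ / 2) * ‖s.e τ‖ ^ 2 + (1 - δ) * (3 / δ) * η ^ 2 *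
          (2 * ‖gradient (nodeFun F τ) s.x - gradient (nodeFun F τ) s.w‖ ^ 2
            + 2 * ‖gradient (nodeFun F τ) s.w - s.h τ‖ ^ 2)
        + (1 - δ) * η ^ 2 * ((m : ℝ)⁻¹ * ∑ i,
            ‖estim F s.x s.w τ i - (m : ℝ)⁻¹ • ∑ j, estim F s.x s.w τ j‖ ^ 2)) := by
        gcongr with τ _
        exact hper τ
    _ = (1 - δ / 2) * errSq s + (1 - δ) * (3 / δ) * η ^ 2 * (2 * ((n : ℝ)⁻¹ * ∑ τ,
          ‖gradient (nodeFun F τ) s.x - gradient (nodeFun F τ) s.w‖ ^ 2) + 2 * shiftSq F s)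
        + (1 - δ) * η ^ 2 * ((n : ℝ)⁻¹ * ∑ τ, (m : ℝ)⁻¹ * ∑ i,
            ‖estim F s.x s.w τ i - (m : ℝ)⁻¹ • ∑ j, estim F s.x s.w τ j‖ ^ 2) := by
        rw [errSq, shiftSq, Finset.sum_add_distrib, Finset.sum_add_distrib, ← Finset.mul_sum,
          ← Finset.mul_sum, ← Finset.mul_sum, Finset.sum_add_distrib, ← Finset.mul_sum,
          ← Finset.mul_sum]
        ring
    _ ≤ _ := by
        have hnode' : 2 * ((n : ℝ)⁻¹ * ∑ τ, ‖gradient (nodeFun F τ) s.x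
          - gradient (nodeFun F τ) s.w‖ ^ 2) ≤ 8 * ℓb * g2 := by linarith
        gcongr

/-- The bound on the mean squared error of the local shifts. -/
theorem FiniteSumProblem.shift_bound (h : FiniteSumProblem F μc ℓf ℓb ℓ xs) {δ₁ p : ℝ}
    (hδ : 0 < δ₁) (hp : 0 < p) (s : ECState d n) :
    (n : ℝ)⁻¹ * ∑ τ, (p * ((1 + (δ₁ / (2 * p))⁻¹) *
        ‖gradient (nodeFun F τ) s.x - gradient (nodeFun F τ) s.w‖ ^ 2
        + (1 + δ₁ / (2 * p)) * ((1 - δ₁) * ‖gradient (nodeFun F τ) s.w - s.h τ‖ ^ 2))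
        + (1 - p) * ((1 - δ₁) * ‖gradient (nodeFun F τ) s.w - s.h τ‖ ^ 2))
      ≤ (1 - δ₁ / 2) * shiftSq F s + p * (1 + 2 * (p / δ₁)) * (4 * ℓb * ((avgFun F s.x
        - avgFun F xs) + (avgFun F s.w - avgFun F xs))) := by
  have hnode := h.mean_gradient_node_sub_le s.x s.w
  have hs := shiftSq_nonneg F s
  set g2 := (avgFun F s.x - avgFun F xs) + (avgFun F s.w - avgFun F xs)
  calc _ = p * (1 + 2 * (p / δ₁)) * ((n : ℝ)⁻¹ * ∑ τ,
          ‖gradient (nodeFun F τ) s.x - gradient (nodeFun F τ) s.w‖ ^ 2)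
        + (1 + δ₁ / 2) * (1 - δ₁) * shiftSq F s := by
        -- The Young parameter `δ₁ / (2 * p)` is paid only when the check point moves, so on average
        -- over the coin the old shift error grows by `p * (1 + δ₁ / (2 * p)) + (1 - p) = 1 + δ₁ /
        -- 2`, which the factor `1 - δ₁` outweighs.
        have : ∀ a b : ℝ, p * ((1 + (δ₁ / (2 * p))⁻¹) * a + (1 + δ₁ / (2 * p)) * ((1 - δ₁) * b))
            + (1 - p) * ((1 - δ₁) * b)
            = p * (1 + 2 * (p / δ₁)) * a + (1 + δ₁ / 2) * (1 - δ₁) * b := by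
          intro a b
          field_simp
          ring
        simp_rw [this]
        rw [shiftSq, Finset.sum_add_distrib, ← Finset.mul_sum, ← Finset.mul_sum]
        ring
    _ ≤ p * (1 + 2 * (p / δ₁)) * (4 * ℓb * g2) + (1 - δ₁ / 2) * shiftSq F s := by
        gcongr
        nlinarith [sq_nonneg δ₁]
    _ = _ := by ring

end ECCatalyst

namespace ECCatalyst

variable {d n m : ℕ} {S S₁ : Type*}

/-! ### Expectations over one seed -/

/-- The law of a coin with success probability `p`. -/
noncomputable abbrev coinLaw (p : ℝ) : Measure Bool :=
  ENNReal.ofReal p • Measure.dirac true + ENNReal.ofReal (1 - p) • Measure.dirac false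

theorem isProbabilityMeasure_coinLaw {p : ℝ} (hp : 0 ≤ p) (hp' : p ≤ 1) :
    IsProbabilityMeasure (coinLaw p) := by
  refine ⟨?_⟩
  simp [← ENNReal.ofReal_add hp (sub_nonneg.2 hp')]

theorem lintegral_coinLaw (p : ℝ) (g : Bool → ℝ≥0∞) :
    ∫⁻ b, g b ∂(coinLaw p) = ENNReal.ofReal p * g true + ENNReal.ofReal (1 - p) * g false := by
  simp [lintegral_add_measure, lintegral_smul_measure]

theorem ofReal_norm_sq (x : Vec d) : ENNReal.ofReal (‖x‖ ^ 2) = ‖x‖ₑ ^ 2 := by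
  rw [ENNReal.ofReal_pow (norm_nonneg _), ofReal_norm]

section

variable [MeasurableSpace S] [MeasurableSpace S₁] {ν : Measure S} [IsProbabilityMeasure ν]
  {ν₁ : Measure S₁} [IsProbabilityMeasure ν₁] {p : ℝ}

theorem measurePreserving_index (hm : 0 < m) (hp : 0 ≤ p) (hp' : p ≤ 1) :
    MeasurePreserving (fun z : Seed n m S S₁ => z.1) (seedLaw n m ν ν₁ p)
      (Measure.pi fun _ : Fin n => unif m) := by
  have := isProbabilityMeasure_unif hm
  have := isProbabilityMeasure_coinLaw hp hp'
  exact measurePreserving_fst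

theorem measurePreserving_index_compressor (hm : 0 < m) (hp : 0 ≤ p) (hp' : p ≤ 1) (τ : Fin n) :
    MeasurePreserving (fun z : Seed n m S S₁ => (z.1 τ, z.2.1 τ)) (seedLaw n m ν ν₁ p)
      ((unif m).prod ν) := by
  have := isProbabilityMeasure_unif hm
  have := isProbabilityMeasure_coinLaw hp hp'
  exact (measurePreserving_eval (fun _ : Fin n => unif m) τ).prod
    ((measurePreserving_eval (fun _ : Fin n => ν) τ).comp measurePreserving_fst)

theorem measurePreserving_compressor_coin (hm : 0 < m) (hp : 0 ≤ p) (hp' : p ≤ 1) (τ : Fin n) :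
    MeasurePreserving (fun z : Seed n m S S₁ => (z.2.2.1 τ, z.2.2.2)) (seedLaw n m ν ν₁ p)
      (ν₁.prod (coinLaw p)) := by
  have := isProbabilityMeasure_unif hm
  have := isProbabilityMeasure_coinLaw hp hp'
  exact ((measurePreserving_eval (fun _ : Fin n => ν₁) τ).prod (MeasurePreserving.id _)).comp
    (measurePreserving_snd.comp measurePreserving_snd)

theorem measurePreserving_coin (hm : 0 < m) (hp : 0 ≤ p) (hp' : p ≤ 1) :
    MeasurePreserving (fun z : Seed n m S S₁ => z.2.2.2) (seedLaw n m ν ν₁ p) (coinLaw p) := by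
  have := isProbabilityMeasure_unif hm
  have := isProbabilityMeasure_coinLaw hp hp'
  exact measurePreserving_snd.comp (measurePreserving_snd.comp measurePreserving_snd)

variable {F : Fin n → Fin m → Vec d → ℝ} {μc ℓf ℓb ℓ : ℝ} {xs : Vec d}
  {Q : Vec d → S → Vec d} {Q₁ : Vec d → S₁ → Vec d} {δ δ₁ η : ℝ}

theorem FiniteSumProblem.lintegral_virt (h : FiniteSumProblem F μc ℓf ℓb ℓ xs) (hp : 0 ≤ p)
    (hp' : p ≤ 1) (s : ECState d n) (hs : s.hAvg = (n : ℝ)⁻¹ • ∑ τ, s.h τ) :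
    ∫⁻ z, ENNReal.ofReal (‖virt (ecStep F Q Q₁ η s z) - xs‖ ^ 2) ∂(seedLaw n m ν ν₁ p)
      = ENNReal.ofReal (
        ‖(virt s - xs) - η • ((n : ℝ)⁻¹ • ∑ τ, (m : ℝ)⁻¹ • ∑ i, estim F s.x s.w τ i)‖ ^ 2
        + (η / n) ^ 2 * ∑ τ, (m : ℝ)⁻¹ * ∑ i,
          ‖estim F s.x s.w τ i - (m : ℝ)⁻¹ • ∑ j, estim F s.x s.w τ j‖ ^ 2) := by
  rw [← lintegral_norm_sub_smul_mean_sq h.samples_pos,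
    ← (measurePreserving_index (ν := ν) (ν₁ := ν₁) h.samples_pos hp hp').lintegral_comp
      Measurable.of_discrete]
  refine lintegral_congr fun z => ?_
  rw [virt_ecStep _ _ _ _ _ hs, sub_right_comm]

theorem lintegral_ofReal_mean {α : Type*} [MeasurableSpace α] {P : Measure α}
    {g : Fin n → α → ℝ} (hg : ∀ τ, Measurable (g τ)) (hg' : ∀ τ a, 0 ≤ g τ a) {b : Fin n → ℝ}
    (hb : ∀ τ, 0 ≤ b τ) (h : ∀ τ, ∫⁻ a, ENNReal.ofReal (g τ a) ∂P ≤ ENNReal.ofReal (b τ)) :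
    ∫⁻ a, ENNReal.ofReal ((n : ℝ)⁻¹ * ∑ τ, g τ a) ∂P
      ≤ ENNReal.ofReal ((n : ℝ)⁻¹ * ∑ τ, b τ) := by
  have hn : 0 ≤ (n : ℝ)⁻¹ := by positivity
  simp_rw [ENNReal.ofReal_mul hn, ENNReal.ofReal_sum_of_nonneg fun τ _ => hg' τ _,
    ENNReal.ofReal_sum_of_nonneg fun τ _ => hb τ]
  rw [lintegral_const_mul _ (Finset.measurable_sum _ fun τ _ => (hg τ).ennreal_ofReal),
    lintegral_finsetSum _ fun τ _ => (hg τ).ennreal_ofReal]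
  gcongr with τ _
  exact h τ

/-- The new local error is the compression residual of a vector depending only on the sampled index;
the contraction property applies once the index is fixed. -/
theorem FiniteSumProblem.lintegral_err (h : FiniteSumProblem F μc ℓf ℓb ℓ xs)
    (hQ : IsContractionCompressor ν Q δ) (hp : 0 ≤ p) (hp' : p ≤ 1) (s : ECState d n) :
    ∫⁻ z, ENNReal.ofReal (errSq (ecStep F Q Q₁ η s z)) ∂(seedLaw n m ν ν₁ p)
      ≤ ENNReal.ofReal ((n : ℝ)⁻¹ * ∑ τ, (1 - δ) * ((m : ℝ)⁻¹ * ∑ i,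
        ‖s.e τ + η • (estim F s.x s.w τ i - s.h τ)‖ ^ 2)) := by
  have := isProbabilityMeasure_unif h.samples_pos
  have hδ : 0 ≤ 1 - δ := sub_nonneg.2 hQ.le_one
  set v : Fin n → Fin m → Vec d := fun τ i => s.e τ + η • (estim F s.x s.w τ i - s.h τ) with hv
  have hmeas : ∀ τ, Measurable fun y : Fin m × S => ‖v τ y.1 - Q (v τ y.1) y.2‖ ^ 2 := by
    intro τ
    have h1 : Measurable fun y : Fin m × S => v τ y.1 :=
      (Measurable.of_discrete (f := v τ)).comp measurable_fst
    exact (h1.sub (hQ.measurable.comp (h1.prodMk measurable_snd))).norm.pow_const 2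
  have hmp := measurePreserving_index_compressor (n := n) (ν := ν) (ν₁ := ν₁) h.samples_pos hp hp'
  simp_rw [errSq, ecStep_e]
  refine lintegral_ofReal_mean (fun τ => (hmeas τ).comp (hmp τ).measurable)
    (fun τ z => sq_nonneg _) (fun τ => by positivity) fun τ => ?_
  calc _ = ∫⁻ y, ENNReal.ofReal (‖v τ y.1 - Q (v τ y.1) y.2‖ ^ 2) ∂((unif m).prod ν) :=
        (hmp τ).lintegral_comp (hmeas τ).ennreal_ofReal
    _ = ∫⁻ i, ∫⁻ t, ENNReal.ofReal (‖v τ i - Q (v τ i) t‖ ^ 2) ∂ν ∂(unif m) :=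
        lintegral_prod _ (hmeas τ).ennreal_ofReal.aemeasurable
    _ ≤ ∫⁻ i, ENNReal.ofReal ((1 - δ) * ‖v τ i‖ ^ 2) ∂(unif m) := by
        refine lintegral_mono fun i => ?_
        simp_rw [ofReal_norm_sq]
        exact hQ.contraction _
    _ = _ := by
        rw [lintegral_unif_ofReal fun i => by positivity, ← Finset.mul_sum, mul_left_comm]

/-- The new shift error is the residual of `Q₁` at the old one plus, when the coin succeeds, the
jump of the local gradient from `w` to `x`. Young's inequality is used only on that event. -/
theorem FiniteSumProblem.lintegral_shift (h : FiniteSumProblem F μc ℓf ℓb ℓ xs)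
    (hQ₁ : IsContractionCompressor ν₁ Q₁ δ₁) (hp : 0 < p) (hp' : p ≤ 1) (s : ECState d n) :
    ∫⁻ z, ENNReal.ofReal (shiftSq F (ecStep F Q Q₁ η s z)) ∂(seedLaw n m ν ν₁ p)
      ≤ ENNReal.ofReal ((n : ℝ)⁻¹ * ∑ τ, (p * ((1 + (δ₁ / (2 * p))⁻¹) *
        ‖gradient (nodeFun F τ) s.x - gradient (nodeFun F τ) s.w‖ ^ 2
        + (1 + δ₁ / (2 * p)) * ((1 - δ₁) * ‖gradient (nodeFun F τ) s.w - s.h τ‖ ^ 2))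
        + (1 - p) * ((1 - δ₁) * ‖gradient (nodeFun F τ) s.w - s.h τ‖ ^ 2))) := by
  have := isProbabilityMeasure_coinLaw hp.le hp'
  have hδ : 0 ≤ 1 - δ₁ := sub_nonneg.2 hQ₁.le_one
  have hδ0 := hQ₁.pos
  have hp1 : 0 ≤ 1 - p := sub_nonneg.2 hp'
  set a : Fin n → Vec d := fun τ => gradient (nodeFun F τ) s.x - gradient (nodeFun F τ) s.w
  set c : Fin n → Vec d := fun τ => gradient (nodeFun F τ) s.w - s.h τ with hc
  set g : Fin n → S₁ × Bool → ℝ := fun τ y =>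
    ‖(if y.2 = true then a τ else 0) + (c τ - Q₁ (c τ) y.1)‖ ^ 2 with hg
  have hmeasQ : ∀ τ, Measurable fun t => c τ - Q₁ (c τ) t := fun τ =>
    (hQ₁.measurable.comp measurable_prodMk_left).const_sub _
  have hmeas : ∀ τ, Measurable (g τ) := by
    intro τ
    have h1 : Measurable fun y : S₁ × Bool => if y.2 = true then a τ else 0 :=
      (Measurable.of_discrete (f := fun b : Bool => if b = true then a τ else 0)).comp
        measurable_snd
    exact (h1.add ((hmeasQ τ).comp measurable_fst)).norm.pow_const 2
  have hmp := measurePreserving_compressor_coin (n := n) (ν := ν) (ν₁ := ν₁) h.samples_pos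
    hp.le hp'
  have hstep : ∀ z, shiftSq F (ecStep F Q Q₁ η s z)
      = (n : ℝ)⁻¹ * ∑ τ, g τ (z.2.2.1 τ, z.2.2.2) := by
    intro z
    rw [shiftSq]
    congr 1
    refine Finset.sum_congr rfl fun τ _ => ?_
    have hh : (ecStep F Q Q₁ η s z).h τ = s.h τ + Q₁ (c τ) (z.2.2.1 τ) := rfl
    have hw : (ecStep F Q Q₁ η s z).w = if z.2.2.2 = true then s.x else s.w := rfl
    rw [hh, hw]
    simp only [hg]
    congr 2
    split_ifs
    · simp only [a, hc]; abel
    · simp only [hc]; abel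
  simp_rw [hstep]
  refine lintegral_ofReal_mean (fun τ => (hmeas τ).comp (hmp τ).measurable)
    (fun τ z => sq_nonneg _) (fun τ => by positivity) fun τ => ?_
  have hcontr : ∫⁻ t, ENNReal.ofReal (‖c τ - Q₁ (c τ) t‖ ^ 2) ∂ν₁
      ≤ ENNReal.ofReal ((1 - δ₁) * ‖c τ‖ ^ 2) := by
    simp_rw [ofReal_norm_sq]
    exact hQ₁.contraction _
  have hmq : Measurable fun t => ENNReal.ofReal (‖c τ - Q₁ (c τ) t‖ ^ 2) :=
    ((hmeasQ τ).norm.pow_const 2).ennreal_ofReal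
  have hs0 : 0 < δ₁ / (2 * p) := by positivity
  calc _ = ∫⁻ y, ENNReal.ofReal (g τ y) ∂(ν₁.prod (coinLaw p)) :=
        (hmp τ).lintegral_comp (hmeas τ).ennreal_ofReal
    _ = ∫⁻ t, (ENNReal.ofReal p * ENNReal.ofReal (‖a τ + (c τ - Q₁ (c τ) t)‖ ^ 2)
          + ENNReal.ofReal (1 - p) * ENNReal.ofReal (‖c τ - Q₁ (c τ) t‖ ^ 2)) ∂ν₁ := by
        rw [lintegral_prod _ (hmeas τ).ennreal_ofReal.aemeasurable]
        simp_rw [lintegral_coinLaw]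
        simp [hg]
    _ ≤ ∫⁻ t, (ENNReal.ofReal p * (ENNReal.ofReal ((1 + (δ₁ / (2 * p))⁻¹) * ‖a τ‖ ^ 2)
          + ENNReal.ofReal (1 + δ₁ / (2 * p)) * ENNReal.ofReal (‖c τ - Q₁ (c τ) t‖ ^ 2))
          + ENNReal.ofReal (1 - p) * ENNReal.ofReal (‖c τ - Q₁ (c τ) t‖ ^ 2)) ∂ν₁ := by
        refine lintegral_mono fun t => ?_
        gcongr
        rw [← ENNReal.ofReal_mul (by positivity), ← ENNReal.ofReal_add (by positivity)
          (by positivity)]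
        exact ENNReal.ofReal_le_ofReal (norm_add_sq_le_of_pos hs0 _ _)
    _ = ENNReal.ofReal p * (ENNReal.ofReal ((1 + (δ₁ / (2 * p))⁻¹) * ‖a τ‖ ^ 2)
          + ENNReal.ofReal (1 + δ₁ / (2 * p)) *
            ∫⁻ t, ENNReal.ofReal (‖c τ - Q₁ (c τ) t‖ ^ 2) ∂ν₁)
          + ENNReal.ofReal (1 - p) * ∫⁻ t, ENNReal.ofReal (‖c τ - Q₁ (c τ) t‖ ^ 2) ∂ν₁ := by
        rw [lintegral_add_left (by fun_prop), lintegral_const_mul _ (by fun_prop),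
          lintegral_const_mul _ hmq, lintegral_add_left (by fun_prop), lintegral_const_mul _ hmq,
          lintegral_const, measure_univ, mul_one]
    _ ≤ ENNReal.ofReal p * (ENNReal.ofReal ((1 + (δ₁ / (2 * p))⁻¹) * ‖a τ‖ ^ 2)
          + ENNReal.ofReal (1 + δ₁ / (2 * p)) * ENNReal.ofReal ((1 - δ₁) * ‖c τ‖ ^ 2))
          + ENNReal.ofReal (1 - p) * ENNReal.ofReal ((1 - δ₁) * ‖c τ‖ ^ 2) := by
        gcongr
    _ = _ := by
        rw [← ENNReal.ofReal_mul (p := 1 + δ₁ / (2 * p)) (by positivity),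
          ← ENNReal.ofReal_add (by positivity) (by positivity), ← ENNReal.ofReal_mul hp.le,
          ← ENNReal.ofReal_mul hp1, ← ENNReal.ofReal_add (by positivity) (by positivity)]

theorem FiniteSumProblem.lintegral_gap (h : FiniteSumProblem F μc ℓf ℓb ℓ xs) (hp : 0 ≤ p)
    (hp' : p ≤ 1) (s : ECState d n) :
    ∫⁻ z, ENNReal.ofReal (avgFun F (ecStep F Q Q₁ η s z).w - avgFun F xs) ∂(seedLaw n m ν ν₁ p)
      = ENNReal.ofReal (p * (avgFun F s.x - avgFun F xs)
        + (1 - p) * (avgFun F s.w - avgFun F xs)) := by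
  have h1 := (measurePreserving_coin (n := n) (ν := ν) (ν₁ := ν₁) h.samples_pos hp
    hp').lintegral_comp (f := fun b => ENNReal.ofReal (avgFun F (if b = true then s.x else s.w)
      - avgFun F xs)) Measurable.of_discrete
  have hp1 : 0 ≤ 1 - p := sub_nonneg.2 hp'
  have hx := h.gap_nonneg s.x
  have hw := h.gap_nonneg s.w
  rw [ENNReal.ofReal_add (by positivity) (by positivity), ENNReal.ofReal_mul hp,
    ENNReal.ofReal_mul hp1]
  rw [lintegral_coinLaw] at h1
  exact h1

end

end ECCatalyst

namespace ECCatalyst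

variable {d n m : ℕ} {S S₁ : Type*}

/-! ### Measurability of the EC-LSVRG iteration -/

/-- The variables of EC-LSVRG as a tuple. -/
def ECState.toProd (s : ECState d n) :
    Vec d × Vec d × (Fin n → Vec d) × (Fin n → Vec d) × Vec d :=
  (s.x, s.w, s.e, s.h, s.hAvg)

instance : MeasurableSpace (ECState d n) := MeasurableSpace.comap ECState.toProd inferInstance

theorem measurable_toProd : Measurable (ECState.toProd : ECState d n → _) :=
  comap_measurable _

section

variable {α : Type*} {_ : MeasurableSpace α}

theorem measurable_ecState_iff {f : α → ECState d n} :
    Measurable f ↔ (Measurable fun a => (f a).x) ∧ (Measurable fun a => (f a).w) ∧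
      (∀ τ, Measurable fun a => (f a).e τ) ∧ (∀ τ, Measurable fun a => (f a).h τ) ∧
      Measurable fun a => (f a).hAvg := by
  constructor
  · intro hf
    have h := measurable_toProd.comp hf
    exact ⟨h.fst, h.snd.fst, fun τ => (measurable_pi_apply τ).comp h.snd.snd.fst,
      fun τ => (measurable_pi_apply τ).comp h.snd.snd.snd.fst, h.snd.snd.snd.snd⟩
  · rintro ⟨hx, hw, he, hh, ha⟩
    rw [measurable_comap_iff]
    exact hx.prodMk (hw.prodMk ((measurable_pi_iff.2 he).prodMk
      ((measurable_pi_iff.2 hh).prodMk ha)))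

variable [MeasurableSpace S] [MeasurableSpace S₁]

/-- The components `F a` depend on the parameter because the prox center of a subproblem is itself
random. Measurability of their gradients along measurable points is therefore what is assumed. -/
theorem measurable_ecStep {F : α → Fin n → Fin m → Vec d → ℝ} {Q : Vec d → S → Vec d}
    {Q₁ : Vec d → S₁ → Vec d} {η : ℝ} (hQ : Measurable (Function.uncurry Q))
    (hQ₁ : Measurable (Function.uncurry Q₁))
    (hF : ∀ τ i (x : α → Vec d), Measurable x → Measurable fun a => gradient (F a τ i) (x a))
    (hN : ∀ τ (x : α → Vec d), Measurable x → Measurable fun a => gradient (nodeFun (F a) τ) (x a))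
    {s : α → ECState d n} (hs : Measurable s) {z : α → Seed n m S S₁} (hz : Measurable z) :
    Measurable fun a => ecStep (F a) Q Q₁ η (s a) (z a) := by
  obtain ⟨hx, hw, he, hh, ha⟩ := measurable_ecState_iff.1 hs
  have hidx : ∀ τ (x : α → Vec d), Measurable x →
      Measurable fun a => gradient (F a τ ((z a).1 τ)) (x a) := by
    intro τ x hx
    have h1 : Measurable fun y : Fin m × α => gradient (F y.2 τ y.1) (x y.2) :=
      measurable_from_prod_countable_right fun i => hF τ i x hx
    exact h1.comp (((measurable_pi_apply τ).comp hz.fst).prodMk measurable_id)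
  have hg : ∀ τ, Measurable fun a => (s a).e τ
      + η • (estim (F a) (s a).x (s a).w τ ((z a).1 τ) - (s a).h τ) := fun τ =>
    (he τ).add (((((hidx τ _ hx).sub (hidx τ _ hw)).add (hN τ _ hw)).sub (hh τ)).const_smul η)
  have hy : ∀ τ, Measurable fun a => Q ((s a).e τ
      + η • (estim (F a) (s a).x (s a).w τ ((z a).1 τ) - (s a).h τ)) ((z a).2.1 τ) := fun τ =>
    hQ.comp ((hg τ).prodMk ((measurable_pi_apply τ).comp hz.snd.fst))
  have hc : ∀ τ, Measurable fun a => Q₁ (gradient (nodeFun (F a) τ) (s a).w - (s a).h τ)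
      ((z a).2.2.1 τ) := fun τ =>
    hQ₁.comp (((hN τ _ hw).sub (hh τ)).prodMk ((measurable_pi_apply τ).comp hz.snd.snd.fst))
  refine measurable_ecState_iff.2 ⟨?_, ?_, fun τ => ?_, fun τ => (hh τ).add (hc τ), ?_⟩
  · simp_rw [ecStep_x]
    exact hx.sub (((Finset.measurable_fun_sum Finset.univ fun τ _ => hy τ).const_smul (n : ℝ)⁻¹).add
      (ha.const_smul η))
  · exact Measurable.ite (measurableSet_eq_fun hz.snd.snd.snd measurable_const) hx hw
  · simp_rw [ecStep_e]
    exact (hg τ).sub (hy τ)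
  · exact ha.add ((Finset.measurable_fun_sum Finset.univ fun τ _ => hc τ).const_smul (n : ℝ)⁻¹)

/-- Only the seeds before `K` are assumed measurable, so the lemma applies with the σ-algebra of the
past and yields independence of the next seed. -/
theorem measurable_ecState {F : α → Fin n → Fin m → Vec d → ℝ} {Q : Vec d → S → Vec d}
    {Q₁ : Vec d → S₁ → Vec d} {η : ℝ} (hQ : Measurable (Function.uncurry Q))
    (hQ₁ : Measurable (Function.uncurry Q₁))
    (hF : ∀ τ i (x : α → Vec d), Measurable x → Measurable fun a => gradient (F a τ i) (x a))
    (hN : ∀ τ (x : α → Vec d), Measurable x → Measurable fun a => gradient (nodeFun (F a) τ) (x a))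
    {s : α → ECState d n} (hs : Measurable s) {z : α → ℕ → Seed n m S S₁} (K : ℕ)
    (hz : ∀ k < K, Measurable fun a => z a k) :
    Measurable fun a => ecState (F a) Q Q₁ η (s a) (z a) K := by
  induction K with
  | zero => exact hs
  | succ K ih =>
    exact measurable_ecStep hQ hQ₁ hF hN (ih fun k hk => hz k (hk.trans K.lt_succ_self))
      (hz K K.lt_succ_self)

end

end ECCatalyst

namespace ECCatalyst

variable {d n m : ℕ} {S S₁ : Type*}

/-! ### Decrease of the potential -/

/-- The parameters of EC-LSVRG together with the stepsize conditions used in its analysis. -/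
structure StepParams (n : ℕ) (μc ℓf ℓb ℓ δ δ₁ p η θ : ℝ) : Prop where
  η_pos : 0 < η
  δ_pos : 0 < δ
  δ_le : δ ≤ 1
  δ₁_pos : 0 < δ₁
  p_pos : 0 < p
  p_le : p ≤ 1
  θ_pos : 0 < θ
  θ_le_mu : θ ≤ μc * η / 2
  θ_le_δ : θ ≤ δ / 4
  θ_le_δ₁ : θ ≤ δ₁ / 4
  θ_le_p : θ ≤ p / 4
  lf_le : η * ℓf ≤ 1 / 16
  noise_le : 4 * η ^ 2 * (ℓ / n)
    + 12 * η * ℓf / δ * ((1 - δ) * (3 / δ) * η ^ 2 * (8 * ℓb) + (1 - δ) * η ^ 2 * (4 * ℓ))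
    + 288 * η ^ 3 * ℓf * (1 - δ) / (δ ^ 2 * δ₁) * (p * (1 + 2 * (p / δ₁)) * (4 * ℓb)) ≤ η / 16

/-- The potential of EC-LSVRG. -/
noncomputable def potential (F : Fin n → Fin m → Vec d → ℝ) (xs : Vec d) (ℓf δ δ₁ p η : ℝ)
    (s : ECState d n) : ℝ :=
  ‖virt s - xs‖ ^ 2 + 12 * η * ℓf / δ * errSq s
    + 288 * η ^ 3 * ℓf * (1 - δ) / (δ ^ 2 * δ₁) * shiftSq F s
    + η / (8 * p) * (avgFun F s.w - avgFun F xs)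

/-- Each weight is chosen so that half of its own contraction pays a debt and the rest covers `θ`. A
quarter `δ / 4` of the error term absorbs `3 * η * ℓf * E`, and `δ₁ / 4` of the shift term absorbs
the shift error fed into `E'`. The check point term releases `η / 8 * gw`, which covers the noise `η
/ 16` and the share `η / 32` of `θ`. For `gx` the total charge is `1/8 + 1/16 + 1/8 + 1/2 ≤ 1` times
`η`. -/
theorem StepParams.potential_decrease {μc ℓf ℓb ℓ δ δ₁ p η θ V E H gx gw X E' H' : ℝ}
    (c : StepParams n μc ℓf ℓb ℓ δ δ₁ p η θ) (hlf : 0 < ℓf) (hV : 0 ≤ V) (hE : 0 ≤ E)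
    (hH : 0 ≤ H) (hgx : 0 ≤ gx) (hgw : 0 ≤ gw)
    (hX : X ≤ (1 - μc * η / 2) * V - η * gx + 3 * η * ℓf * E + 2 * η ^ 2 * ℓf * gx
      + 4 * η ^ 2 * (ℓ / n) * (gx + gw))
    (hE' : E' ≤ (1 - δ / 2) * E + (1 - δ) * (3 / δ) * η ^ 2 * (8 * ℓb * (gx + gw) + 2 * H)
      + (1 - δ) * η ^ 2 * (4 * ℓ * (gx + gw)))
    (hH' : H' ≤ (1 - δ₁ / 2) * H + p * (1 + 2 * (p / δ₁)) * (4 * ℓb * (gx + gw))) :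
    X + 12 * η * ℓf / δ * E' + 288 * η ^ 3 * ℓf * (1 - δ) / (δ ^ 2 * δ₁) * H'
        + η / (8 * p) * (p * gx + (1 - p) * gw) + η / 2 * gx
      ≤ (1 - θ) * (V + 12 * η * ℓf / δ * E + 288 * η ^ 3 * ℓf * (1 - δ) / (δ ^ 2 * δ₁) * H
        + η / (8 * p) * gw) := by
  obtain ⟨hη, hδ, hδ', hδ₁, hp, hp', hθ, hθμ, hθδ, hθδ₁, hθp, hlf', hnoise⟩ := c
  have h1δ : 0 ≤ 1 - δ := sub_nonneg.2 hδ'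
  set A := 12 * η * ℓf / δ with hA
  set B := 288 * η ^ 3 * ℓf * (1 - δ) / (δ ^ 2 * δ₁) with hB
  set D := η / (8 * p) with hD
  have hA0 : 0 ≤ A := by positivity
  have hB0 : 0 ≤ B := by positivity
  have hD0 : 0 ≤ D := by positivity
  have hAδ : A * (δ / 4) = 3 * η * ℓf := by rw [hA]; field_simp; norm_num
  have hBδ : B * (δ₁ / 4) = A * ((1 - δ) * (3 / δ) * η ^ 2 * 2) := by
    rw [hA, hB]; field_simp; ring
  have hDp : D * p = η / 8 := by rw [hD]; field_simp
  have e1 := mul_le_mul_of_nonneg_left hE' hA0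
  have e2 := mul_le_mul_of_nonneg_left hH' hB0
  have e3 := mul_le_mul_of_nonneg_right hθμ hV
  have e4 := mul_le_mul_of_nonneg_right hθδ (mul_nonneg hA0 hE)
  have e5 := mul_le_mul_of_nonneg_right hθδ₁ (mul_nonneg hB0 hH)
  have e6 := mul_le_mul_of_nonneg_right hθp (mul_nonneg hD0 hgw)
  have e7 := mul_le_mul_of_nonneg_right hnoise (add_nonneg hgx hgw)
  have e8 := mul_le_mul_of_nonneg_left hlf' (mul_nonneg hη.le hgx)
  have f1 : δ / 4 * (A * E) = 3 * η * ℓf * E := by rw [← hAδ]; ring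
  have f2 : δ₁ / 4 * (B * H) = A * ((1 - δ) * (3 / δ) * η ^ 2 * 2) * H := by rw [← hBδ]; ring
  have f3 : p / 4 * (D * gw) = η / 32 * gw := by
    rw [show p / 4 * (D * gw) = D * p / 4 * gw by ring, hDp]; ring
  have f4 : D * (p * gx + (1 - p) * gw) = η / 8 * gx + D * gw - η / 8 * gw := by
    rw [← hDp]; ring
  have f5 : A * (δ / 2 * E) = 2 * (3 * η * ℓf * E) := by rw [← f1]; ring
  have f6 : B * (δ₁ / 2 * H) = 2 * (A * ((1 - δ) * (3 / δ) * η ^ 2 * 2) * H) := by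
    rw [← f2]; ring
  have f7 : 0 ≤ η * gw := mul_nonneg hη.le hgw
  have f8 : 0 ≤ η * gx := mul_nonneg hη.le hgx
  rw [f4]
  -- With these products treated as atoms, the claim is a linear combination of the inequalities
  -- above.
  generalize hM : (1 - δ) * (3 / δ) * η ^ 2 = M at *
  generalize hR : p * (1 + 2 * (p / δ₁)) = R at *
  linarith

section

variable [MeasurableSpace S] [MeasurableSpace S₁] {ν : Measure S} [IsProbabilityMeasure ν]
  {ν₁ : Measure S₁} [IsProbabilityMeasure ν₁] {p : ℝ}
  {F : Fin n → Fin m → Vec d → ℝ} {μc ℓf ℓb ℓ : ℝ} {xs : Vec d}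
  {Q : Vec d → S → Vec d} {Q₁ : Vec d → S₁ → Vec d} {δ δ₁ η θ : ℝ}

theorem FiniteSumProblem.measurable_gradient_comp {α : Type*} {_ : MeasurableSpace α}
    (h : FiniteSumProblem F μc ℓf ℓb ℓ xs) (τ : Fin n) (i : Fin m) (x : α → Vec d)
    (hx : Measurable x) : Measurable fun a => gradient (F τ i) (x a) :=
  ((h.smooth_comp τ i).continuous_gradient h.dim_pos).measurable.comp hx

theorem FiniteSumProblem.measurable_gradient_node {α : Type*} {_ : MeasurableSpace α}
    (h : FiniteSumProblem F μc ℓf ℓb ℓ xs) (τ : Fin n) (x : α → Vec d) (hx : Measurable x) :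
    Measurable fun a => gradient (nodeFun F τ) (x a) :=
  ((h.smooth_node τ).continuous_gradient h.dim_pos).measurable.comp hx

theorem measurable_virt : Measurable (virt : ECState d n → Vec d) := by
  obtain ⟨hx, -, he, -, -⟩ := measurable_ecState_iff.1 (measurable_id (α := ECState d n))
  exact hx.sub ((Finset.measurable_fun_sum Finset.univ fun τ _ => he τ).const_smul (n : ℝ)⁻¹)

theorem measurable_errSq : Measurable (errSq : ECState d n → ℝ) := by
  obtain ⟨-, -, he, -, -⟩ := measurable_ecState_iff.1 (measurable_id (α := ECState d n))
  exact (Finset.measurable_fun_sum Finset.univ fun τ _ => (he τ).norm.pow_const 2).const_mul _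

theorem FiniteSumProblem.measurable_shiftSq (h : FiniteSumProblem F μc ℓf ℓb ℓ xs) :
    Measurable (shiftSq F) := by
  obtain ⟨-, hw, -, hh, -⟩ := measurable_ecState_iff.1 (measurable_id (α := ECState d n))
  exact (Finset.measurable_fun_sum Finset.univ fun τ _ =>
    ((h.measurable_gradient_node τ _ hw).sub (hh τ)).norm.pow_const 2).const_mul _

theorem FiniteSumProblem.measurable_gap {α : Type*} {_ : MeasurableSpace α}
    (h : FiniteSumProblem F μc ℓf ℓb ℓ xs) {x : α → Vec d} (hx : Measurable x) :
    Measurable fun a => avgFun F (x a) - avgFun F xs :=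
  (h.smooth_avg.continuous.measurable.comp hx).sub_const _

theorem FiniteSumProblem.measurable_potential (h : FiniteSumProblem F μc ℓf ℓb ℓ xs) :
    Measurable (potential F xs ℓf δ δ₁ p η) := by
  obtain ⟨-, hw, -, -, -⟩ := measurable_ecState_iff.1 (measurable_id (α := ECState d n))
  exact ((((measurable_virt.sub_const xs).norm.pow_const 2).add
    (measurable_errSq.const_mul _)).add (h.measurable_shiftSq.const_mul _)).add
    ((h.measurable_gap hw).const_mul _)

theorem FiniteSumProblem.lintegral_potential_ecStep (h : FiniteSumProblem F μc ℓf ℓb ℓ xs)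
    (hQ : IsContractionCompressor ν Q δ) (hQ₁ : IsContractionCompressor ν₁ Q₁ δ₁)
    (c : StepParams n μc ℓf ℓb ℓ δ δ₁ p η θ) (s : ECState d n)
    (hs : s.hAvg = (n : ℝ)⁻¹ • ∑ τ, s.h τ) :
    ∫⁻ z, ENNReal.ofReal (potential F xs ℓf δ δ₁ p η (ecStep F Q Q₁ η s z))
        ∂(seedLaw n m ν ν₁ p)
      + ENNReal.ofReal (η / 2 * (avgFun F s.x - avgFun F xs))
      ≤ ENNReal.ofReal (1 - θ) * ENNReal.ofReal (potential F xs ℓf δ δ₁ p η s) := by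
  have hx := h.gap_nonneg s.x
  have hw := h.gap_nonneg s.w
  have hη := c.η_pos
  have hδ := c.δ_pos
  have hδ₁ := c.δ₁_pos
  have hlf := h.lf_pos
  have h1δ : 0 ≤ 1 - δ := sub_nonneg.2 c.δ_le
  have h1δ₁ : 0 ≤ 1 - δ₁ := sub_nonneg.2 hQ₁.le_one
  have hp := c.p_pos
  have h1p : 0 ≤ 1 - p := sub_nonneg.2 c.p_le
  have hθ : 0 ≤ 1 - θ := by have := c.θ_le_p; have := c.p_le; linarith
  have hdec := c.potential_decrease hlf (sq_nonneg ‖virt s - xs‖) (errSq_nonneg s)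
    (shiftSq_nonneg F s) hx hw (h.virt_bound hη s) (h.err_bound hδ c.δ_le s)
    (h.shift_bound hδ₁ hp s)
  have iX := h.lintegral_virt (ν := ν) (ν₁ := ν₁) (Q := Q) (Q₁ := Q₁) (η := η) hp.le c.p_le s hs
  have iE := h.lintegral_err (ν₁ := ν₁) (Q₁ := Q₁) (η := η) hQ hp.le c.p_le s
  have iH := h.lintegral_shift (ν := ν) (Q := Q) (η := η) hQ₁ hp c.p_le s
  have iW := h.lintegral_gap (ν := ν) (ν₁ := ν₁) (Q := Q) (Q₁ := Q₁) (η := η) hp.le c.p_le s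
  set A := 12 * η * ℓf / δ
  set B := 288 * η ^ 3 * ℓf * (1 - δ) / (δ ^ 2 * δ₁)
  set D := η / (8 * p)
  have hA0 : 0 ≤ A := by positivity
  have hB0 : 0 ≤ B := by positivity
  have hD0 : 0 ≤ D := by positivity
  have hstep : Measurable fun z : Seed n m S S₁ => ecStep F Q Q₁ η s z :=
    measurable_ecStep (F := fun _ => F) hQ.measurable hQ₁.measurable
      (fun τ i x hx => h.measurable_gradient_comp τ i x hx)
      (fun τ x hx => h.measurable_gradient_node τ x hx) measurable_const measurable_id
  have mX : Measurable fun z : Seed n m S S₁ =>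
      ENNReal.ofReal (‖virt (ecStep F Q Q₁ η s z) - xs‖ ^ 2) :=
    (((measurable_virt.comp hstep).sub_const xs).norm.pow_const 2).ennreal_ofReal
  have mE : Measurable fun z : Seed n m S S₁ => ENNReal.ofReal (errSq (ecStep F Q Q₁ η s z)) :=
    (measurable_errSq.comp hstep).ennreal_ofReal
  have mH : Measurable fun z : Seed n m S S₁ =>
      ENNReal.ofReal (shiftSq F (ecStep F Q Q₁ η s z)) :=
    (h.measurable_shiftSq.comp hstep).ennreal_ofReal
  have mW : Measurable fun z : Seed n m S S₁ =>
      ENNReal.ofReal (avgFun F (ecStep F Q Q₁ η s z).w - avgFun F xs) :=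
    (h.measurable_gap (measurable_ecState_iff.1 hstep).2.1).ennreal_ofReal
  have hsplit : ∀ z : Seed n m S S₁,
      ENNReal.ofReal (potential F xs ℓf δ δ₁ p η (ecStep F Q Q₁ η s z))
      = ENNReal.ofReal (‖virt (ecStep F Q Q₁ η s z) - xs‖ ^ 2)
        + ENNReal.ofReal A * ENNReal.ofReal (errSq (ecStep F Q Q₁ η s z))
        + ENNReal.ofReal B * ENNReal.ofReal (shiftSq F (ecStep F Q Q₁ η s z))
        + ENNReal.ofReal D
          * ENNReal.ofReal (avgFun F (ecStep F Q Q₁ η s z).w - avgFun F xs) := by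
    intro z
    have g1 := errSq_nonneg (ecStep F Q Q₁ η s z)
    have g2 := shiftSq_nonneg F (ecStep F Q Q₁ η s z)
    have g3 := h.gap_nonneg (ecStep F Q Q₁ η s z).w
    rw [← ENNReal.ofReal_mul hA0, ← ENNReal.ofReal_mul hB0, ← ENNReal.ofReal_mul hD0,
      ← ENNReal.ofReal_add (by positivity) (by positivity),
      ← ENNReal.ofReal_add (by positivity) (by positivity),
      ← ENNReal.ofReal_add (by positivity) (by positivity)]
    rfl
  simp_rw [hsplit]
  rw [lintegral_add_left (by fun_prop), lintegral_add_left (by fun_prop),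
    lintegral_add_left mX, lintegral_const_mul _ mE, lintegral_const_mul _ mH,
    lintegral_const_mul _ mW, iX, iW]
  refine (add_le_add_left (add_le_add_left (add_le_add (add_le_add_right
    (mul_le_mul_right iE _) _) (mul_le_mul_right iH _)) _) _).trans ?_
  rw [← ENNReal.ofReal_mul hA0, ← ENNReal.ofReal_mul hB0, ← ENNReal.ofReal_mul hD0,
    ← ENNReal.ofReal_add (by positivity) (by positivity),
    ← ENNReal.ofReal_add (by positivity) (by positivity),
    ← ENNReal.ofReal_add (by positivity) (by positivity),
    ← ENNReal.ofReal_add (by positivity) (by positivity), ← ENNReal.ofReal_mul hθ]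
  exact ENNReal.ofReal_le_ofReal hdec

end

end ECCatalyst

namespace ECCatalyst

variable {d n m : ℕ} {S S₁ : Type*}

/-! ### Independence -/

section Independence

variable {Ω ι β γ γ' : Type*} {mΩ : MeasurableSpace Ω} {μ : Measure Ω} [MeasurableSpace β]
  [MeasurableSpace γ] [MeasurableSpace γ'] {ζ : ι → Ω → β}

/-- The σ-algebra generated by the variables `ζ i`, `i ∈ s`. -/
abbrev genBy (ζ : ι → Ω → β) (s : Set ι) : MeasurableSpace Ω :=
  ⨆ i ∈ s, MeasurableSpace.comap (ζ i) inferInstance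

theorem measurable_genBy {s : Set ι} {i : ι} (hi : i ∈ s) : Measurable[genBy ζ s] (ζ i) :=
  measurable_iff_comap_le.2
    (le_iSup₂ (f := fun i (_ : i ∈ s) => MeasurableSpace.comap (ζ i) inferInstance) i hi)

theorem genBy_le (hζ : ∀ i, Measurable (ζ i)) (s : Set ι) : genBy ζ s ≤ mΩ :=
  iSup₂_le fun i _ => (hζ i).comap_le

theorem indepFun_of_measurable_genBy (hζ : ∀ i, Measurable (ζ i)) (h : iIndepFun ζ μ)
    {s t : Set ι} (hst : Disjoint s t) {X : Ω → γ} {Y : Ω → γ'} (hX : Measurable[genBy ζ s] X)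
    (hY : Measurable[genBy ζ t] Y) : IndepFun X Y μ := by
  rw [IndepFun_iff_Indep]
  exact indep_of_indep_of_le_left (indep_of_indep_of_le_right
    (indep_iSup_of_disjoint (fun i => (hζ i).comap_le) h.iIndep hst)
    (measurable_iff_comap_le.1 hY)) (measurable_iff_comap_le.1 hX)

theorem lintegral_comp_of_indepFun [IsProbabilityMeasure μ] {X : Ω → γ} {Y : Ω → γ'}
    (hX : Measurable X) (hY : Measurable Y) (h : IndepFun X Y μ) {f : γ → γ' → ℝ≥0∞}
    (hf : Measurable (Function.uncurry f)) :
    ∫⁻ ω, f (X ω) (Y ω) ∂μ = ∫⁻ ω, ∫⁻ y, f (X ω) y ∂(μ.map Y) ∂μ := by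
  have := Measure.isProbabilityMeasure_map (μ := μ) hY.aemeasurable
  have := Measure.isProbabilityMeasure_map (μ := μ) hX.aemeasurable
  have h1 : ∫⁻ ω, f (X ω) (Y ω) ∂μ
      = ∫⁻ z, Function.uncurry f z ∂(μ.map fun ω => (X ω, Y ω)) :=
    (lintegral_map hf (hX.prodMk hY)).symm
  rw [h1, (indepFun_iff_map_prod_eq_prod_map_map hX.aemeasurable hY.aemeasurable).1 h,
    lintegral_prod _ hf.aemeasurable, lintegral_map _ hX]
  · rfl
  · exact hf.lintegral_prod_right

end Independence

/-! ### Convergence of EC-LSVRG -/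

theorem mul_sum_inv_pow {θ : ℝ} (hθ : θ < 1) (N : ℕ) :
    θ * ∑ j ∈ Finset.range N, ((1 - θ) ^ (j + 1))⁻¹ = ((1 - θ) ^ N)⁻¹ - 1 := by
  have h : 1 - θ ≠ 0 := (sub_pos.2 hθ).ne'
  induction N with
  | zero => simp
  | succ N ih =>
    rw [Finset.sum_range_succ, mul_add, ih]
    field_simp
    ring

theorem avgFun_weightedAverage_le {g : Vec d → ℝ} (hg : ConvexOn ℝ Set.univ g) {θ : ℝ}
    (hθ : θ < 1) (x : ℕ → Vec d) (K : ℕ) :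
    (∑ j ∈ Finset.range (K + 1), ((1 - θ) ^ (j + 1))⁻¹) * g (weightedAverage θ x K)
      ≤ ∑ j ∈ Finset.range (K + 1), ((1 - θ) ^ (j + 1))⁻¹ * g (x j) := by
  have h0 : 0 < 1 - θ := sub_pos.2 hθ
  have hW : 0 < ∑ j ∈ Finset.range (K + 1), ((1 - θ) ^ (j + 1))⁻¹ :=
    Finset.sum_pos (fun j _ => by positivity) (by simp)
  have := hg.map_centerMass_le (t := Finset.range (K + 1))
    (w := fun j => ((1 - θ) ^ (j + 1))⁻¹) (p := x) (fun j _ => by positivity) hW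
    (fun j _ => Set.mem_univ _)
  rw [← le_inv_mul_iff₀ hW]
  exact this

theorem hAvg_ecState (F : Fin n → Fin m → Vec d → ℝ) (Q : Vec d → S → Vec d)
    (Q₁ : Vec d → S₁ → Vec d) (η : ℝ) {s : ECState d n} (hs : s.hAvg = (n : ℝ)⁻¹ • ∑ τ, s.h τ)
    (z : ℕ → Seed n m S S₁) (K : ℕ) :
    (ecState F Q Q₁ η s z K).hAvg = (n : ℝ)⁻¹ • ∑ τ, (ecState F Q Q₁ η s z K).h τ := by
  induction K with
  | zero => exact hs
  | succ K ih => exact hAvg_ecStep F Q Q₁ η _ ih _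

section

variable [MeasurableSpace S] [MeasurableSpace S₁] {ν : Measure S} [IsProbabilityMeasure ν]
  {ν₁ : Measure S₁} [IsProbabilityMeasure ν₁] {p : ℝ}
  {F : Fin n → Fin m → Vec d → ℝ} {μc ℓf ℓb ℓ : ℝ} {xs : Vec d}
  {Q : Vec d → S → Vec d} {Q₁ : Vec d → S₁ → Vec d} {δ δ₁ η θ : ℝ}
  {Ω : Type*} {mΩ : MeasurableSpace Ω} {μ : Measure Ω} [IsProbabilityMeasure μ]
  {ξ : ℕ → Ω → Seed n m S S₁}

/-- The state after `K` iterations depends on the seeds before `K` only, so it can be frozen while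
the seed `K` is averaged. -/
theorem FiniteSumProblem.lintegral_potential_succ (h : FiniteSumProblem F μc ℓf ℓb ℓ xs)
    (hQ : IsContractionCompressor ν Q δ) (hQ₁ : IsContractionCompressor ν₁ Q₁ δ₁)
    (c : StepParams n μc ℓf ℓb ℓ δ δ₁ p η θ) (hξ : ∀ K, Measurable (ξ K))
    (hlaw : ∀ K, μ.map (ξ K) = seedLaw n m ν ν₁ p) (hind : iIndepFun ξ μ)
    {s : ECState d n} (hs : s.hAvg = (n : ℝ)⁻¹ • ∑ τ, s.h τ) (K : ℕ) :
    ∫⁻ ω, ENNReal.ofReal (potential F xs ℓf δ δ₁ p η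
        (ecState F Q Q₁ η s (fun k => ξ k ω) (K + 1))) ∂μ
      + ∫⁻ ω, ENNReal.ofReal (η / 2 * (avgFun F (ecState F Q Q₁ η s (fun k => ξ k ω) K).x
        - avgFun F xs)) ∂μ
      ≤ ENNReal.ofReal (1 - θ) * ∫⁻ ω, ENNReal.ofReal (potential F xs ℓf δ δ₁ p η
        (ecState F Q Q₁ η s (fun k => ξ k ω) K)) ∂μ := by
  set st : Ω → ECState d n := fun ω => ecState F Q Q₁ η s (fun k => ξ k ω) K with hst
  have hst_past : Measurable[genBy ξ (Set.Iio K)] st :=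
    measurable_ecState (F := fun _ => F) hQ.measurable hQ₁.measurable
      (fun τ i x hx => h.measurable_gradient_comp τ i x hx)
      (fun τ x hx => h.measurable_gradient_node τ x hx) measurable_const K
      fun k hk => measurable_genBy hk
  have hst_meas : Measurable st := hst_past.mono (genBy_le hξ _) le_rfl
  have hindep : IndepFun st (ξ K) μ :=
    indepFun_of_measurable_genBy hξ hind (s := Set.Iio K) (t := {K}) (by simp) hst_past
      (measurable_genBy rfl)
  have hstep : Measurable fun y : ECState d n × Seed n m S S₁ => ecStep F Q Q₁ η y.1 y.2 :=
    measurable_ecStep (F := fun _ => F) hQ.measurable hQ₁.measurable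
      (fun τ i x hx => h.measurable_gradient_comp τ i x hx)
      (fun τ x hx => h.measurable_gradient_node τ x hx) measurable_fst measurable_snd
  have h1 := lintegral_comp_of_indepFun hst_meas (hξ K) hindep
    (f := fun s z => ENNReal.ofReal (potential F xs ℓf δ δ₁ p η (ecStep F Q Q₁ η s z)))
    (h.measurable_potential.comp hstep).ennreal_ofReal
  rw [hlaw] at h1
  have hpot : Measurable fun ω => ENNReal.ofReal (potential F xs ℓf δ δ₁ p η (st ω)) :=
    (h.measurable_potential.comp hst_meas).ennreal_ofReal
  have hgap : Measurable fun ω => ENNReal.ofReal (η / 2 * (avgFun F (st ω).x - avgFun F xs)) :=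
    ((h.measurable_gap (measurable_ecState_iff.1 hst_meas).1).const_mul _).ennreal_ofReal
  rw [← lintegral_const_mul _ hpot]
  change ∫⁻ ω, ENNReal.ofReal (potential F xs ℓf δ δ₁ p η (ecStep F Q Q₁ η (st ω) (ξ K ω))) ∂μ
    + _ ≤ _
  rw [h1, ← lintegral_add_right _ hgap]
  exact lintegral_mono fun ω =>
    h.lintegral_potential_ecStep hQ hQ₁ c _ (hAvg_ecState _ _ _ _ hs _ _)

/-- The one-step inequality multiplied by `(1 - θ)^{-(K+1)}` telescopes. -/
theorem FiniteSumProblem.sum_lintegral_gap_le (h : FiniteSumProblem F μc ℓf ℓb ℓ xs)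
    (hQ : IsContractionCompressor ν Q δ) (hQ₁ : IsContractionCompressor ν₁ Q₁ δ₁)
    (c : StepParams n μc ℓf ℓb ℓ δ δ₁ p η θ) (hξ : ∀ K, Measurable (ξ K))
    (hlaw : ∀ K, μ.map (ξ K) = seedLaw n m ν ν₁ p) (hind : iIndepFun ξ μ)
    {s : ECState d n} (hs : s.hAvg = (n : ℝ)⁻¹ • ∑ τ, s.h τ) (K : ℕ) :
    ∑ j ∈ Finset.range K, ENNReal.ofReal ((1 - θ) ^ (j + 1))⁻¹ *
        ∫⁻ ω, ENNReal.ofReal (η / 2 * (avgFun F (ecState F Q Q₁ η s (fun k => ξ k ω) j).x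
          - avgFun F xs)) ∂μ
      + ENNReal.ofReal ((1 - θ) ^ K)⁻¹ * ∫⁻ ω, ENNReal.ofReal (potential F xs ℓf δ δ₁ p η
        (ecState F Q Q₁ η s (fun k => ξ k ω) K)) ∂μ
      ≤ ENNReal.ofReal (potential F xs ℓf δ δ₁ p η s) := by
  have hθ : 0 < 1 - θ := by have := c.θ_le_p; have := c.p_le; linarith
  induction K with
  | zero => simp [ecState]
  | succ K ih =>
    refine le_trans ?_ ih
    rw [Finset.sum_range_succ, add_assoc, ← mul_add, add_comm (∫⁻ ω, _ ∂μ)]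
    refine add_le_add_right ((mul_le_mul_right
      (h.lintegral_potential_succ hQ hQ₁ c hξ hlaw hind hs K) _).trans ?_) _
    rw [← mul_assoc, ← ENNReal.ofReal_mul (by positivity)]
    refine le_of_eq ?_
    congr 2
    field_simp
    ring

theorem FiniteSumProblem.lintegral_gap_weightedAverage_le
    (h : FiniteSumProblem F μc ℓf ℓb ℓ xs)
    (hQ : IsContractionCompressor ν Q δ) (hQ₁ : IsContractionCompressor ν₁ Q₁ δ₁)
    (c : StepParams n μc ℓf ℓb ℓ δ δ₁ p η θ) (hξ : ∀ K, Measurable (ξ K))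
    (hlaw : ∀ K, μ.map (ξ K) = seedLaw n m ν ν₁ p) (hind : iIndepFun ξ μ) (x₀ : Vec d) (K : ℕ) :
    ∫⁻ ω, ENNReal.ofReal (avgFun F (weightedAverage θ (fun j => (ecState F Q Q₁ η
        (ecInit x₀ fun τ => gradient (nodeFun F τ) x₀) (fun k => ξ k ω) j).x) K)
          - avgFun F xs) ∂μ
      ≤ ENNReal.ofReal (4 * (avgFun F x₀ - avgFun F xs) / (((1 - θ) ^ (K + 1))⁻¹ - 1)) := by
  have hθ : 0 < 1 - θ := by have := c.θ_le_p; have := c.p_le; linarith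
  have hη := c.η_pos
  have hθ0 := c.θ_pos
  set s₀ : ECState d n := ecInit x₀ fun τ => gradient (nodeFun F τ) x₀ with hs₀
  set x : Ω → ℕ → Vec d := fun ω j => (ecState F Q Q₁ η s₀ (fun k => ξ k ω) j).x with hx
  set W := ∑ j ∈ Finset.range (K + 1), ((1 - θ) ^ (j + 1))⁻¹ with hWdef
  have hW : 0 < W := Finset.sum_pos (fun j _ => by positivity) (by simp)
  have hθW : θ * W = ((1 - θ) ^ (K + 1))⁻¹ - 1 := mul_sum_inv_pow (by linarith) _
  have hsum := h.sum_lintegral_gap_le hQ hQ₁ c hξ hlaw hind (s := s₀) rfl (K + 1)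
  have hxm : ∀ j, Measurable fun ω => x ω j := fun j =>
    (measurable_ecState_iff.1 (measurable_ecState (F := fun _ => F) hQ.measurable hQ₁.measurable
      (fun τ i x hx => h.measurable_gradient_comp τ i x hx)
      (fun τ x hx => h.measurable_gradient_node τ x hx) measurable_const j fun k _ => hξ k)).1
  have hgm : ∀ j, Measurable fun ω =>
      ENNReal.ofReal (η / 2 * (avgFun F (x ω j) - avgFun F xs)) := fun j =>
    ((h.measurable_gap (hxm j)).const_mul _).ennreal_ofReal
  set I := ∫⁻ ω, ENNReal.ofReal (avgFun F (weightedAverage θ (x ω) K) - avgFun F xs) ∂μ with hI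
  have h1 : ENNReal.ofReal (W * (η / 2)) * I
      ≤ ENNReal.ofReal (potential F xs ℓf δ δ₁ p η s₀) := by
    refine le_trans ?_ ((le_add_right le_rfl).trans hsum)
    rw [Finset.sum_congr rfl fun j _ =>
        (lintegral_const_mul (ENNReal.ofReal ((1 - θ) ^ (j + 1))⁻¹) (hgm j)).symm,
      ← lintegral_finsetSum _ fun j _ => (hgm j).const_mul _, hI,
      ← lintegral_const_mul' _ _ ENNReal.ofReal_ne_top]
    refine lintegral_mono fun ω => ?_
    have hg : ∀ j, 0 ≤ avgFun F (x ω j) - avgFun F xs := fun j => h.gap_nonneg _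
    rw [← ENNReal.ofReal_mul (by positivity)]
    have : ∀ j, ENNReal.ofReal ((1 - θ) ^ (j + 1))⁻¹
        * ENNReal.ofReal (η / 2 * (avgFun F (x ω j) - avgFun F xs))
        = ENNReal.ofReal (((1 - θ) ^ (j + 1))⁻¹ * (η / 2 * (avgFun F (x ω j) - avgFun F xs))) :=
      fun j => (ENNReal.ofReal_mul (by positivity)).symm
    rw [Finset.sum_congr rfl fun j _ => this j, ← ENNReal.ofReal_sum_of_nonneg fun j _ =>
      mul_nonneg (by positivity) (mul_nonneg (by positivity) (hg j))]
    refine ENNReal.ofReal_le_ofReal ?_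
    have hJ := avgFun_weightedAverage_le h.convex_avg (θ := θ) (by linarith) (x ω) K
    have hJ2 := mul_le_mul_of_nonneg_left hJ (half_pos hη).le
    calc _ = η / 2 * (W * avgFun F (weightedAverage θ (x ω) K)) - η / 2 * (W * avgFun F xs) := by
          ring
      _ ≤ η / 2 * (∑ j ∈ Finset.range (K + 1), ((1 - θ) ^ (j + 1))⁻¹ * avgFun F (x ω j))
          - η / 2 * (W * avgFun F xs) := by linarith
      _ = _ := by
          rw [hWdef, Finset.sum_mul, ← mul_sub, ← Finset.sum_sub_distrib, Finset.mul_sum]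
          exact Finset.sum_congr rfl fun j _ => by ring
  have hg0 := h.gap_nonneg x₀
  -- With zero errors and exact shifts only two summands survive. The distance is bounded by the gap
  -- through `θ ≤ μc * η / 2` and quadratic growth, the check point term through `θ ≤ p / 4`.
  have h2 : θ * potential F xs ℓf δ δ₁ p η s₀ ≤ 2 * η * (avgFun F x₀ - avgFun F xs) := by
    have e1 : potential F xs ℓf δ δ₁ p η s₀
        = ‖x₀ - xs‖ ^ 2 + η / (8 * p) * (avgFun F x₀ - avgFun F xs) := by
      simp [potential, hs₀, ecInit, virt, errSq, shiftSq]
    have e2 := h.gap_ge x₀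
    have hp := c.p_pos
    have e3 : θ * (η / (8 * p)) ≤ η := by
      have : θ * (η / (8 * p)) ≤ p / 4 * (η / (8 * p)) := by
        have := c.θ_le_p
        gcongr
      have e : p / 4 * (η / (8 * p)) = η / 32 := by field_simp; norm_num
      linarith
    have e4 : θ * ‖x₀ - xs‖ ^ 2 ≤ μc * η / 2 * ‖x₀ - xs‖ ^ 2 := by
      have := c.θ_le_mu
      gcongr
    have e5 := mul_le_mul_of_nonneg_left e2 hη.le
    have e6 := mul_le_mul_of_nonneg_right e3 hg0
    rw [e1]
    linarith
  have hr : 0 < ((1 - θ) ^ (K + 1))⁻¹ - 1 := by rw [← hθW]; positivity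
  have h3 : potential F xs ℓf δ δ₁ p η s₀
      ≤ W * (η / 2) * (4 * (avgFun F x₀ - avgFun F xs) / (((1 - θ) ^ (K + 1))⁻¹ - 1)) := by
    rw [← hθW]
    have : W * (η / 2) * (4 * (avgFun F x₀ - avgFun F xs) / (θ * W))
        = 2 * η * (avgFun F x₀ - avgFun F xs) / θ := by field_simp; norm_num
    rw [this, le_div_iff₀ hθ0]
    linarith
  have h4 := h1.trans (ENNReal.ofReal_le_ofReal h3)
  rw [ENNReal.ofReal_mul (p := W * (η / 2)) (by positivity)] at h4
  exact (ENNReal.mul_le_mul_iff_right (ENNReal.ofReal_pos.2 (by positivity)).ne'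
    ENNReal.ofReal_ne_top).1 h4

end

end ECCatalyst

namespace ECCatalyst

variable {d n m : ℕ} {S S₁ : Type*}

/-! ### The expected number of inner iterations -/

/-- Every index from `K₀` up to the first success at or after `K₀` contributes one to the series.
The right side is measurable in the randomness and needs no optional stopping; if there is no such
success it is infinite. -/
theorem sInf_le_add_tsum (g : ℕ → ℝ) (acc : ℝ) {K₀ : ℕ} (hK₀ : 1 ≤ K₀) :
    ((sInf ((fun K : ℕ => (K : ℕ∞)) '' {K : ℕ | 1 ≤ K ∧ g K ≤ acc}) : ℕ∞) : ℝ≥0∞)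
      ≤ K₀ + ∑' j : ℕ, if acc < g (K₀ + j) then 1 else 0 := by
  by_cases h : ∃ j, g (K₀ + j) ≤ acc
  · classical
    have hmem : Nat.find h + K₀ ∈ {K : ℕ | 1 ≤ K ∧ g K ≤ acc} :=
      ⟨by omega, by rw [add_comm]; exact Nat.find_spec h⟩
    have h1 : sInf ((fun K : ℕ => (K : ℕ∞)) '' {K : ℕ | 1 ≤ K ∧ g K ≤ acc})
        ≤ ((Nat.find h + K₀ : ℕ) : ℕ∞) := sInf_le ⟨_, hmem, rfl⟩
    refine (ENat.toENNReal_le.2 h1).trans ?_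
    rw [ENat.toENNReal_coe, Nat.cast_add, add_comm]
    refine add_le_add_right (le_trans (le_of_eq ?_)
      (ENNReal.sum_le_tsum (Finset.range (Nat.find h)))) _
    rw [Finset.sum_congr rfl fun j hj =>
      if_pos (not_le.1 (Nat.find_min h (Finset.mem_range.1 hj)))]
    simp
  · push Not at h
    simp [h]

/-- Markov's inequality, together with the case `a = 0`, where the integral vanishes. That case
occurs when the starting point of the outer method is already optimal and all accuracies are zero.
-/
theorem measure_lt_le_of_lintegral_le {Ω : Type*} {mΩ : MeasurableSpace Ω} {μ : Measure Ω}
    {f : Ω → ℝ} (hf : Measurable f) {a c : ℝ} (ha : 0 ≤ a)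
    (h : ∫⁻ ω, ENNReal.ofReal (f ω) ∂μ ≤ ENNReal.ofReal (a * c)) :
    μ {ω | a < f ω} ≤ ENNReal.ofReal c := by
  rcases ha.eq_or_lt with rfl | ha
  · rw [zero_mul, ENNReal.ofReal_zero, nonpos_iff_eq_zero,
      lintegral_eq_zero_iff hf.ennreal_ofReal] at h
    refine le_trans (le_of_eq ?_) zero_le
    rw [← compl_compl {ω | 0 < f ω}, ← mem_ae_iff]
    filter_upwards [h] with ω hω
    simpa using hω
  · have h1 := (mul_meas_ge_le_lintegral hf.ennreal_ofReal (ENNReal.ofReal a)).trans h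
    rw [ENNReal.ofReal_mul ha.le, ENNReal.mul_le_mul_iff_right (ENNReal.ofReal_pos.2 ha).ne'
      ENNReal.ofReal_ne_top] at h1
    exact (measure_mono fun ω hω => ENNReal.ofReal_le_ofReal (le_of_lt hω)).trans h1

theorem lintegral_count_le {Ω : Type*} {mΩ : MeasurableSpace Ω} {μ : Measure Ω}
    [IsProbabilityMeasure μ] {g : ℕ → Ω → ℝ} (hg : ∀ K, Measurable (g K)) {acc R θ gap : ℝ}
    (hacc : 0 ≤ acc) (hR : 0 ≤ R) (hθ : 0 < θ) (hθ' : θ < 1) (hgap : gap ≤ R * acc)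
    (h : ∀ K, ∫⁻ ω, ENNReal.ofReal (g K ω) ∂μ
      ≤ ENNReal.ofReal (4 * gap / (((1 - θ) ^ (K + 1))⁻¹ - 1))) :
    ∫⁻ ω, ((⌈Real.log (8 * R + 2) / θ⌉₊ : ℝ≥0∞)
        + ∑' j : ℕ, if acc < g (⌈Real.log (8 * R + 2) / θ⌉₊ + j) ω then 1 else 0) ∂μ
      ≤ ENNReal.ofReal ((Real.log (8 * R + 2) + 2) / θ) := by
  set ℒ := Real.log (8 * R + 2) with hℒ
  have hℒ0 : 0 < ℒ := Real.log_pos (by linarith)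
  set K₀ := ⌈ℒ / θ⌉₊ with hK₀
  have h1θ : 0 < 1 - θ := sub_pos.2 hθ'
  -- At `K₀` the weight reaches `8 * R + 2`. The summand `2` keeps the logarithm positive and
  -- dominates the `-1` in the rate, even if `R = 0`; from `K₀ + j` on, failure has probability at
  -- most `(1 - θ) ^ j`.
  have hpow : 8 * R + 2 ≤ ((1 - θ) ^ K₀)⁻¹ := by
    have h1 : (1 - θ) ^ K₀ ≤ Real.exp (-ℒ) := by
      calc (1 - θ) ^ K₀ ≤ Real.exp (-θ) ^ K₀ := by
            gcongr
            have := Real.add_one_le_exp (-θ)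
            linarith
        _ = Real.exp (-(θ * K₀)) := by rw [← Real.exp_nat_mul]; ring_nf
        _ ≤ _ := by
            gcongr
            have := Nat.le_ceil (ℒ / θ)
            rwa [div_le_iff₀' hθ] at this
    rw [Real.exp_neg, hℒ, Real.exp_log (by positivity)] at h1
    exact (le_inv_comm₀ (by positivity) (by positivity)).1 h1
  have hprob : ∀ j, μ {ω | acc < g (K₀ + j) ω} ≤ ENNReal.ofReal (1 - θ) ^ j := by
    intro j
    have hden : ((1 - θ) ^ j)⁻¹ * (8 * R + 2) ≤ ((1 - θ) ^ (K₀ + j + 1))⁻¹ := by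
      calc _ ≤ ((1 - θ) ^ j)⁻¹ * ((1 - θ) ^ K₀)⁻¹ := by gcongr
        _ = ((1 - θ) ^ (K₀ + j))⁻¹ := by rw [pow_add, mul_inv, mul_comm]
        _ ≤ _ := by
            refine inv_anti₀ (by positivity) ?_
            exact pow_le_pow_of_le_one h1θ.le (by linarith) (Nat.le_succ _)
    have hj1 : 1 ≤ ((1 - θ) ^ j)⁻¹ :=
      (one_le_inv₀ (by positivity)).2 (pow_le_one₀ h1θ.le (by linarith))
    have hden2 : ((1 - θ) ^ j)⁻¹ * (4 * R) ≤ ((1 - θ) ^ (K₀ + j + 1))⁻¹ - 1 := by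
      nlinarith
    have hpos : 0 < ((1 - θ) ^ (K₀ + j + 1))⁻¹ - 1 := by nlinarith
    rw [← ENNReal.ofReal_pow h1θ.le]
    refine measure_lt_le_of_lintegral_le (hg _) hacc ((h _).trans (ENNReal.ofReal_le_ofReal ?_))
    rw [div_le_iff₀ hpos]
    calc 4 * gap ≤ 4 * (R * acc) := by linarith
      _ = acc * (1 - θ) ^ j * (((1 - θ) ^ j)⁻¹ * (4 * R)) := by field_simp
      _ ≤ _ := by gcongr
  have hmeas : ∀ j, Measurable fun ω => if acc < g (K₀ + j) ω then (1 : ℝ≥0∞) else 0 := fun j =>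
    Measurable.ite (measurableSet_lt measurable_const (hg _)) measurable_const measurable_const
  rw [lintegral_add_left measurable_const, lintegral_const, measure_univ, mul_one,
    lintegral_tsum fun j => (hmeas j).aemeasurable]
  have hint : ∀ j, ∫⁻ ω, (if acc < g (K₀ + j) ω then (1 : ℝ≥0∞) else 0) ∂μ
      = μ {ω | acc < g (K₀ + j) ω} := by
    intro j
    rw [← lintegral_indicator_one (measurableSet_lt measurable_const (hg _))]
    refine lintegral_congr fun ω => ?_
    simp [Set.indicator_apply]
  simp_rw [hint]
  refine (add_le_add_right (ENNReal.tsum_le_tsum hprob) _).trans ?_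
  rw [ENNReal.tsum_geometric]
  have e1 : (1 - ENNReal.ofReal (1 - θ))⁻¹ = ENNReal.ofReal θ⁻¹ := by
    rw [← ENNReal.ofReal_one, ← ENNReal.ofReal_sub _ h1θ.le, sub_sub_cancel,
      ENNReal.ofReal_inv_of_pos hθ]
  rw [e1, ← ENNReal.ofReal_natCast, ← ENNReal.ofReal_add (by positivity) (by positivity)]
  refine ENNReal.ofReal_le_ofReal ?_
  -- The extra `2 / θ` pays for rounding up and for the geometric series `1 / θ`.
  have h1 := (Nat.ceil_lt_add_one (div_pos hℒ0 hθ).le).le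
  have h2 : 1 ≤ θ⁻¹ := (one_le_inv₀ hθ).2 hθ'.le
  have h3 : (ℒ + 2) / θ = ℒ / θ + 2 * θ⁻¹ := by ring
  rw [h3]
  linarith

end ECCatalyst

namespace ECCatalyst

theorem convexOn_half_mul_norm_sub_sq {d : ℕ} {c : ℝ} (hc : 0 ≤ c) (y : Vec d) :
    ConvexOn ℝ Set.univ fun x : Vec d => c / 2 * ‖x - y‖ ^ 2 := by
  have h : ConvexOn ℝ Set.univ fun x : Vec d => dist x y ^ 2 :=
    (convexOn_dist y convex_univ).pow (fun _ _ => dist_nonneg) 2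
  have h2 := h.smul (c := c / 2) (by positivity)
  simpa only [dist_eq_norm, smul_eq_mul] using h2

namespace Run

variable {d n m : ℕ} {S S₁ : Type*} {A : Run d n m S S₁} {Lf Lbar L Lψ : ℝ}

/-! ### The subproblem as a finite-sum problem -/

theorem nodeFun_subComp (hm : 0 < m) (y : Vec d) (τ : Fin n) :
    nodeFun (A.subComp y) τ = fun x => A.fNode τ x + A.ψ x + A.κ / 2 * ‖x - y‖ ^ 2 := by
  have hm' : (m : ℝ) ≠ 0 := by positivity
  funext x
  simp only [nodeFun, subComp, fNode, Finset.sum_add_distrib, Finset.sum_const, Finset.card_univ,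
    Fintype.card_fin, nsmul_eq_mul]
  field_simp

theorem avgFun_subComp (hn : 0 < n) (hm : 0 < m) (y : Vec d) :
    avgFun (A.subComp y) = A.G y := by
  have hn' : (n : ℝ) ≠ 0 := by positivity
  funext x
  simp only [avgFun, nodeFun_subComp hm, G, P, fAvg, Finset.sum_add_distrib, Finset.sum_const,
    Finset.card_univ, Fintype.card_fin, nsmul_eq_mul]
  field_simp

namespace PrimalAssumption

theorem convex_fAvg (h : A.PrimalAssumption Lf Lbar L Lψ) : ConvexOn ℝ Set.univ A.fAvg :=
  convexOn_const_mul_sum _ (by positivity) fun τ _ =>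
    convexOn_const_mul_sum _ (by positivity) fun i _ => h.convex τ i

theorem convex_reg (h : A.PrimalAssumption Lf Lbar L Lψ) : ConvexOn ℝ Set.univ A.ψ :=
  UniformConvexOn.convexOn h.strong fun r => by
    have := h.lam_pos
    change 0 ≤ A.lam / 2 * r ^ 2
    positivity

theorem continuous_P (h : A.PrimalAssumption Lf Lbar L Lψ) : Continuous A.P :=
  h.smooth_avg.continuous.add h.smooth_reg.continuous

theorem continuous_G (h : A.PrimalAssumption Lf Lbar L Lψ) {α : Type*} [TopologicalSpace α]
    {y x : α → Vec d} (hy : Continuous y) (hx : Continuous x) :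
    Continuous fun a => A.G (y a) (x a) :=
  (h.continuous_P.comp hx).add (((hx.sub hy).norm.pow 2).const_mul _)

theorem G_quadratic_lower_bound (h : A.PrimalAssumption Lf Lbar L Lψ) (y x u : Vec d) :
    A.G y x + inner ℝ (gradient (A.G y) x) (u - x) + (A.lam + A.κ) / 2 * ‖u - x‖ ^ 2
      ≤ A.G y u := by
  have h1 := inner_gradient_le_sub h.convex_fAvg (h.smooth_avg.hasGradientAt x) u
  have h2 := strongConvexOn_add_inner_gradient_le h.strong (h.smooth_reg.hasGradientAt x) u
  have h3 : gradient (A.G y) x = gradient A.fAvg x + gradient A.ψ x + A.κ • (x - y) :=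
    (hasGradientAt_add (hasGradientAt_add (h.smooth_avg.hasGradientAt x)
      (h.smooth_reg.hasGradientAt x)) (hasGradientAt_half_mul_norm_sub_sq A.κ y x)).gradient
  have h4 : ‖u - y‖ ^ 2 = ‖x - y‖ ^ 2 + 2 * inner ℝ (x - y) (u - x) + ‖u - x‖ ^ 2 := by
    rw [← norm_add_sq_real]
    congr 2
    abel
  rw [h3, inner_add_left, inner_add_left, inner_smul_left, conj_trivial]
  simp only [G, P]
  rw [h4]
  linarith

theorem exists_forall_G_le (h : A.PrimalAssumption Lf Lbar L Lψ) (hκ : 0 ≤ A.κ) (y : Vec d) :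
    ∃ xs, ∀ x, A.G y xs ≤ A.G y x := by
  have hpos := h.lam_pos
  refine exists_isMinOn_of_quadratic_lower_bound (a := gradient (A.G y) 0)
    (m := A.lam + A.κ) ?_ (by positivity) fun x => ?_
  · exact h.continuous_G continuous_const continuous_id
  · simpa using h.G_quadratic_lower_bound y 0 x

end PrimalAssumption

/-- The minimizer of the subproblem with prox center `y`. -/
noncomputable def prox (A : Run d n m S S₁) (y : Vec d) : Vec d :=
  Classical.epsilon fun xs => ∀ x, A.G y xs ≤ A.G y x

namespace PrimalAssumption

theorem G_prox_le (h : A.PrimalAssumption Lf Lbar L Lψ) (hκ : 0 ≤ A.κ) (y x : Vec d) :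
    A.G y (A.prox y) ≤ A.G y x :=
  Classical.epsilon_spec (h.exists_forall_G_le hκ y) x

theorem Gmin_eq (h : A.PrimalAssumption Lf Lbar L Lψ) (hκ : 0 ≤ A.κ) (y : Vec d) :
    A.Gmin y = A.G y (A.prox y) :=
  le_antisymm (ciInf_le ⟨_, by rintro _ ⟨x, rfl⟩; exact h.G_prox_le hκ y x⟩ _)
    (le_ciInf (h.G_prox_le hκ y))

theorem G_growth (h : A.PrimalAssumption Lf Lbar L Lψ) (hκ : 0 ≤ A.κ) (y x : Vec d) :
    A.Gmin y + (A.lam + A.κ) / 2 * ‖x - A.prox y‖ ^ 2 ≤ A.G y x := by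
  have := h.G_quadratic_lower_bound y (A.prox y) x
  rw [gradient_eq_zero_of_forall_le (h.G_prox_le hκ y), inner_zero_left, add_zero] at this
  rw [h.Gmin_eq hκ]
  exact this

/-- Quadratic growth of each subproblem is tested at the minimizer of the other and the two
inequalities are added. The resulting continuity of `prox` gives continuity, hence measurability, of
`Gmin`. -/
theorem norm_prox_sub_le (h : A.PrimalAssumption Lf Lbar L Lψ) (hκ : 0 ≤ A.κ) (y y' : Vec d) :
    ‖A.prox y - A.prox y'‖ ≤ ‖y - y'‖ := by
  set u := A.prox y
  set v := A.prox y'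
  have h1 := h.G_growth hκ y v
  have h2 := h.G_growth hκ y' u
  rw [h.Gmin_eq hκ] at h1 h2
  have h3 : ‖v - y‖ ^ 2 - ‖u - y‖ ^ 2 + ‖u - y'‖ ^ 2 - ‖v - y'‖ ^ 2
      = 2 * inner ℝ (u - v) (y - y') := by
    simp only [norm_sub_sq_real, inner_sub_left, inner_sub_right]
    ring
  have h4 := real_inner_le_norm (u - v) (y - y')
  rw [norm_sub_rev v u] at h1
  simp only [G] at h1 h2
  have hpos := h.lam_pos
  have h5 : (A.lam + A.κ) * ‖u - v‖ ^ 2 ≤ A.κ * (‖u - v‖ * ‖y - y'‖) := by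
    have := mul_le_mul_of_nonneg_left h4 hκ
    have h6 : A.κ / 2 * (‖v - y‖ ^ 2 - ‖u - y‖ ^ 2 + ‖u - y'‖ ^ 2 - ‖v - y'‖ ^ 2)
        = A.κ / 2 * (2 * inner ℝ (u - v) (y - y')) := by rw [h3]
    linarith
  rcases (norm_nonneg (u - v)).eq_or_lt with h0 | h0
  · rw [← h0]; positivity
  · have h6 : (A.lam + A.κ) * ‖u - v‖ ≤ A.κ * ‖y - y'‖ := by
      refine le_of_mul_le_mul_right ?_ h0
      linarith
    have h7 : (A.lam + A.κ) * ‖u - v‖ ≤ (A.lam + A.κ) * ‖y - y'‖ := by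
      refine h6.trans ?_
      gcongr
      linarith
    exact le_of_mul_le_mul_left h7 (by positivity)

theorem continuous_Gmin (h : A.PrimalAssumption Lf Lbar L Lψ) (hκ : 0 ≤ A.κ) :
    Continuous A.Gmin := by
  have hp : Continuous A.prox :=
    (LipschitzWith.of_dist_le_mul (K := 1) fun y y' => by
      simpa [dist_eq_norm] using h.norm_prox_sub_le hκ y y').continuous
  have : A.Gmin = fun y => A.G y (A.prox y) := funext fun y => h.Gmin_eq hκ y
  rw [this]
  exact h.continuous_G continuous_id hp

theorem finiteSumProblem (h : A.PrimalAssumption Lf Lbar L Lψ) (hd : 0 < d) (hn : 0 < n)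
    (hm : 0 < m) (hκ : 0 ≤ A.κ) (y : Vec d) :
    FiniteSumProblem (A.subComp y) (A.lam + A.κ) (Lf + Lψ + A.κ) (Lbar + Lψ + A.κ)
      (L + Lψ + A.κ) (A.prox y) := by
  have hquad := isSmooth_half_mul_norm_sub_sq hκ y
  have hlam := h.lam_pos
  refine ⟨hd, hn, hm, fun τ i => ?_, fun τ i => ?_, fun τ => ?_, ?_, by positivity, ?_, ?_⟩
  · have hq := convexOn_half_mul_norm_sub_sq hκ y
    have h1 := ((h.convex τ i).add h.convex_reg).add hq
    refine h1.congr fun x _ => ?_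
    rfl
  · change IsSmooth _ fun x => A.f τ i x + A.ψ x + A.κ / 2 * ‖x - y‖ ^ 2
    exact ((h.smooth_comp τ i).add h.smooth_reg).add hquad
  · rw [nodeFun_subComp hm]
    exact ((h.smooth_node τ).add h.smooth_reg).add hquad
  · rw [avgFun_subComp hn hm]
    change IsSmooth _ fun x => A.fAvg x + A.ψ x + A.κ / 2 * ‖x - y‖ ^ 2
    exact (h.smooth_avg.add h.smooth_reg).add hquad
  · rw [avgFun_subComp hn hm]
    exact h.G_quadratic_lower_bound y
  · rw [avgFun_subComp hn hm]
    exact h.G_prox_le hκ y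

theorem gradient_nodeFun_subComp (h : A.PrimalAssumption Lf Lbar L Lψ) (hm : 0 < m)
    (y x : Vec d) (τ : Fin n) : gradient (nodeFun (A.subComp y) τ) x = A.initShift x y τ := by
  rw [nodeFun_subComp hm]
  exact (hasGradientAt_add (hasGradientAt_add ((h.smooth_node τ).hasGradientAt x)
    (h.smooth_reg.hasGradientAt x)) (hasGradientAt_half_mul_norm_sub_sq A.κ y x)).gradient

theorem gradient_subComp (h : A.PrimalAssumption Lf Lbar L Lψ)
    (y x : Vec d) (τ : Fin n) (i : Fin m) : gradient (A.subComp y τ i) x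
      = gradient (A.f τ i) x + gradient A.ψ x + A.κ • (x - y) :=
  (hasGradientAt_add (hasGradientAt_add ((h.smooth_comp τ i).hasGradientAt x)
    (h.smooth_reg.hasGradientAt x)) (hasGradientAt_half_mul_norm_sub_sq A.κ y x)).gradient

/-! ### The stepsize rule -/

/-- The stepsize times each of the four terms of its denominator is at most `c₀`. The noise
condition is linear in two of these products and in the squares of the compression terms `a`, `b`;
as `c₀ ≤ 1`, the squares are at most `c₀` too. The constant `340` is `4 + 288 + 48`, and `1152`
comes from the shift error, where `p / δ₁ ≤ c₂`. -/
theorem stepParams (h : A.PrimalAssumption Lf Lbar L Lψ) (hd : 0 < d) (hn : 0 < n)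
    (hm : 0 < m) (hκ : 0 ≤ A.κ) (hδ : 0 < A.δ) (hδ' : A.δ ≤ 1) (hδ₁ : 0 < A.δ₁)
    (hp : 0 < A.p) (hp' : A.p ≤ 1) {c₀ c₂ : ℝ} (hc₀ : 0 < c₀) (hc₂ : 0 < c₂)
    (hpc : A.p ≤ c₂ * A.δ₁)
    (hc : c₀ * (340 + 1152 * (c₂ * (1 + 2 * c₂))) ≤ 1 / 16)
    (hη : A.η = A.stepsize c₀ Lf Lbar L Lψ) :
    StepParams n (A.lam + A.κ) (Lf + Lψ + A.κ) (Lbar + Lψ + A.κ) (L + Lψ + A.κ)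
      A.δ A.δ₁ A.p A.η A.θ := by
  have hF := h.finiteSumProblem hd hn hm hκ 0
  have hlf := hF.lf_pos
  have hl := hF.l_nonneg
  have hlb := hF.lb_nonneg
  have hμ := hF.mu_pos
  have h1δ : 0 ≤ 1 - A.δ := sub_nonneg.2 hδ'
  rw [stepsize] at hη
  set ℓf := Lf + Lψ + A.κ
  set ℓb := Lbar + Lψ + A.κ
  set ℓ := L + Lψ + A.κ
  set a := √((1 - A.δ) * ℓf * ℓb) / A.δ with ha
  set b := √((1 - A.δ) * ℓf * ℓ) / √A.δ with hb
  have ha0 : 0 ≤ a := by positivity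
  have hb0 : 0 ≤ b := by positivity
  have hln : 0 ≤ ℓ / n := by positivity
  have hden : 0 < ℓf + ℓ / n + a + b := by positivity
  have hη0 : 0 < A.η := by rw [hη]; positivity
  have hηden : A.η * (ℓf + ℓ / n + a + b) = c₀ := by rw [hη]; field_simp
  have p1 := mul_nonneg hη0.le hlf.le
  have p2 := mul_nonneg hη0.le hln
  have p3 := mul_nonneg hη0.le ha0
  have p4 := mul_nonneg hη0.le hb0
  have q1 : A.η * ℓf ≤ c₀ := by linarith
  have q2 : A.η * (ℓ / n) ≤ c₀ := by linarith
  have q3 : A.η * a ≤ c₀ := by linarith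
  have q4 : A.η * b ≤ c₀ := by linarith
  have hcc : 0 ≤ c₂ * (1 + 2 * c₂) := by positivity
  have hc1 : c₀ ≤ 1 / 16 := by nlinarith [mul_nonneg hc₀.le hcc]
  have a2 : (A.η * a) ^ 2 = A.η ^ 2 * ((1 - A.δ) * ℓf * ℓb) / A.δ ^ 2 := by
    rw [ha, mul_pow, div_pow, Real.sq_sqrt (by positivity)]
    ring
  have b2 : (A.η * b) ^ 2 = A.η ^ 2 * ((1 - A.δ) * ℓf * ℓ) / A.δ := by
    rw [hb, mul_pow, div_pow, Real.sq_sqrt (by positivity), Real.sq_sqrt hδ.le]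
    ring
  have hsq : ∀ t, 0 ≤ t → t ≤ c₀ → t ^ 2 ≤ c₀ := fun t ht htc => by nlinarith
  have a3 := hsq _ p3 q3
  have b3 := hsq _ p4 q4
  have hθ0 : 0 < A.θ := by
    unfold θ
    simp only [lt_min_iff]
    refine ⟨⟨?_, ?_⟩, ?_, ?_⟩ <;> positivity
  refine ⟨hη0, hδ, hδ', hδ₁, hp, hp', hθ0, (min_le_left _ _).trans (min_le_left _ _),
    (min_le_left _ _).trans (min_le_right _ _), (min_le_right _ _).trans (min_le_left _ _),
    (min_le_right _ _).trans (min_le_right _ _), q1.trans hc1, ?_⟩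
  have hr : A.p / A.δ₁ ≤ c₂ := by rwa [div_le_iff₀ hδ₁]
  have hr0 : 0 ≤ A.p / A.δ₁ := by positivity
  calc _ = A.η * (4 * (A.η * (ℓ / n)) + 288 * (A.η * a) ^ 2 + 48 * (A.η * b) ^ 2
        + 1152 * (A.p / A.δ₁ * (1 + 2 * (A.p / A.δ₁))) * (A.η * a) ^ 2) := by
        rw [a2, b2]
        field_simp
        ring
    _ ≤ A.η * (4 * c₀ + 288 * c₀ + 48 * c₀ + 1152 * (c₂ * (1 + 2 * c₂)) * c₀) := by
        gcongr
    _ = A.η * (c₀ * (340 + 1152 * (c₂ * (1 + 2 * c₂)))) := by ring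
    _ ≤ A.η * (1 / 16) := by gcongr
    _ = _ := by ring

/-- The number `1 / θ` is the reciprocal of one of four terms. In the reciprocal of the stepsize, `κ
/ (λ + κ) ≤ 1 ≤ 1 / δ`, so `κ` drops out of the leading smoothness terms; `c₁ * δ₁ ≤ p` handles the
term in `p`. -/
theorem inv_θ_le (h : A.PrimalAssumption Lf Lbar L Lψ) (hd : 0 < d) (hn : 0 < n)
    (hm : 0 < m) (hκ : 0 ≤ A.κ) (hδ : 0 < A.δ) (hδ' : A.δ ≤ 1) (hδ₁ : 0 < A.δ₁)
    (hδ₁' : A.δ₁ ≤ 1) {c₀ c₁ : ℝ} (hc₀ : 0 < c₀) (hc₁ : 0 < c₁)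
    (hpc : c₁ * A.δ₁ ≤ A.p) (hη : A.η = A.stepsize c₀ Lf Lbar L Lψ) :
    1 / A.θ ≤ (4 / c₀ + 4 + 4 / c₁) * A.iterBound Lf Lbar L Lψ := by
  have hF := h.finiteSumProblem hd hn hm hκ 0
  have hlf := hF.lf_pos
  have hl := hF.l_nonneg
  have hμ := hF.mu_pos
  have h1δ : 0 ≤ 1 - A.δ := sub_nonneg.2 hδ'
  have hLf := h.smooth_avg.nonneg hd
  have hLψ := h.smooth_reg.nonneg hd
  have hL := (h.smooth_comp ⟨0, hn⟩ ⟨0, hm⟩).nonneg hd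
  have hn1 : (1 : ℝ) ≤ n := by exact_mod_cast hn
  rw [stepsize] at hη
  rw [iterBound]
  set a := √((1 - A.δ) * (Lf + Lψ + A.κ) * (Lbar + Lψ + A.κ))
  set b := √((1 - A.δ) * (Lf + Lψ + A.κ) * (L + Lψ + A.κ))
  set μ := A.lam + A.κ with hμdef
  have hp : 0 < A.p := lt_of_lt_of_le (by positivity) hpc
  have i1 : 1 ≤ 1 / A.δ := (one_le_div hδ).2 hδ'
  have i2 : 1 ≤ 1 / A.δ₁ := (one_le_div hδ₁).2 hδ₁'
  have i3 : 0 ≤ a / (A.δ * μ) := by positivity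
  have i4 : 0 ≤ (Lf + Lψ) / μ := by positivity
  have i5 : 0 ≤ L / (n * μ) := by positivity
  have i6 : 0 ≤ b / (√A.δ * μ) := by positivity
  have hμn : μ ≤ n * μ := le_mul_of_one_le_left hμ.le hn1
  have hκμ : A.κ ≤ μ := by have := h.lam_pos; linarith
  have k1 : A.κ / μ ≤ 1 := (div_le_one hμ).2 hκμ
  have k2 : A.κ / (n * μ) ≤ 1 := (div_le_one (by positivity)).2 (hκμ.trans hμn)
  have k3 : Lψ / (n * μ) ≤ (Lf + Lψ) / μ := by
    exact div_le_div₀ (by positivity) (by linarith) hμ hμn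
  set B := 1 / A.δ + 1 / A.δ₁ + a / (A.δ * μ) + (Lf + Lψ) / μ + L / (n * μ)
    + b / (√A.δ * μ) with hB
  have hden : 0 < (Lf + Lψ + A.κ) + (L + Lψ + A.κ) / n + a / A.δ + b / √A.δ := by positivity
  have j1 : 1 / (μ * A.η / 2) ≤ 4 / c₀ * B := by
    have : 1 / (μ * A.η / 2) = 2 / c₀ * ((Lf + Lψ) / μ + A.κ / μ + L / (n * μ) + Lψ / (n * μ)
        + A.κ / (n * μ) + a / (A.δ * μ) + b / (√A.δ * μ)) := by
      have hs : 0 < √A.δ := Real.sqrt_pos.2 hδ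
      have hS : (Lf + Lψ) / μ + A.κ / μ + L / (n * μ) + Lψ / (n * μ) + A.κ / (n * μ)
          + a / (A.δ * μ) + b / (√A.δ * μ)
          = ((Lf + Lψ + A.κ) + (L + Lψ + A.κ) / n + a / A.δ + b / √A.δ) / μ := by
        simp only [add_div, div_div]
        ring
      rw [hη, hS]
      field_simp
    rw [this, show 4 / c₀ * B = 2 / c₀ * (2 * B) by ring]
    gcongr
    linarith
  have j2 : 1 / (A.δ / 4) ≤ 4 * B := by
    rw [one_div_div, show 4 / A.δ = 4 * (1 / A.δ) by ring]
    linarith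
  have j3 : 1 / (A.δ₁ / 4) ≤ 4 * B := by
    rw [one_div_div, show 4 / A.δ₁ = 4 * (1 / A.δ₁) by ring]
    linarith
  have j4 : 1 / (A.p / 4) ≤ 4 / c₁ * B := by
    calc 1 / (A.p / 4) = 4 / A.p := one_div_div _ _
      _ ≤ 4 / (c₁ * A.δ₁) := by gcongr
      _ = 4 / c₁ * (1 / A.δ₁) := by field_simp
      _ ≤ _ := by gcongr; linarith
  have l1 : 0 ≤ 4 / c₀ * B := by positivity
  have l2 : 0 ≤ 4 * B := by positivity
  have l3 : 0 ≤ 4 / c₁ * B := by positivity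
  rw [add_mul, add_mul, θ]
  rcases min_choice (min (μ * A.η / 2) (A.δ / 4)) (min (A.δ₁ / 4) (A.p / 4)) with e | e
  · rw [e]
    rcases min_choice (μ * A.η / 2) (A.δ / 4) with e | e <;> rw [e] <;> linarith
  · rw [e]
    rcases min_choice (A.δ₁ / 4) (A.p / 4) with e | e <;> rw [e] <;> linarith

theorem iterBound_le_condBound (h : A.PrimalAssumption Lf Lbar L Lψ) (hd : 0 < d) (hn : 0 < n)
    (hm : 0 < m) (hκ : 0 ≤ A.κ) (hδ : 0 < A.δ) (hδ' : A.δ ≤ 1) (hδδ : A.δ₁ = A.δ) :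
    A.iterBound Lf Lbar L Lψ ≤ 2 / A.δ * A.condBound Lf Lbar L Lψ := by
  have hF := h.finiteSumProblem hd hn hm hκ 0
  have hlf := hF.lf_pos
  have hl := hF.l_nonneg
  have hlb := hF.lb_nonneg
  have hμ := hF.mu_pos
  have hLf := h.smooth_avg.nonneg hd
  have hLψ := h.smooth_reg.nonneg hd
  have hL := (h.smooth_comp ⟨0, hn⟩ ⟨0, hm⟩).nonneg hd
  have h1 : ∀ t : ℝ, 0 ≤ t → √((1 - A.δ) * (Lf + Lψ + A.κ) * t) ≤ √((Lf + Lψ + A.κ) * t) := by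
    intro t ht
    exact Real.sqrt_le_sqrt (mul_le_mul_of_nonneg_right
      (mul_le_of_le_one_left hlf.le (by linarith)) ht)
  have h2 : A.δ ≤ √A.δ := by
    rw [Real.le_sqrt' hδ]
    nlinarith
  have hinv : 1 ≤ 1 / A.δ := (one_le_div hδ).2 hδ'
  rw [iterBound, condBound, hδδ]
  set μ := A.lam + A.κ
  have hb := h1 _ hlb
  have hl' := h1 _ hl
  generalize √((1 - A.δ) * (Lf + Lψ + A.κ) * (Lbar + Lψ + A.κ)) = ab at *
  generalize √((1 - A.δ) * (Lf + Lψ + A.κ) * (L + Lψ + A.κ)) = al at *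
  calc _ ≤ 1 / A.δ + 1 / A.δ + √((Lf + Lψ + A.κ) * (Lbar + Lψ + A.κ)) / (A.δ * μ)
        + 1 / A.δ * ((Lf + Lψ) / μ) + 1 / A.δ * (L / (n * μ))
        + √((Lf + Lψ + A.κ) * (L + Lψ + A.κ)) / (A.δ * μ) := by
        gcongr
        · exact le_mul_of_one_le_left (by positivity) hinv
        · exact le_mul_of_one_le_left (by positivity) hinv
    _ = 1 / A.δ * (2 + (√((Lf + Lψ + A.κ) * (Lbar + Lψ + A.κ)) + (Lf + Lψ) + L / n
          + √((Lf + Lψ + A.κ) * (L + Lψ + A.κ))) / μ) := by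
        field_simp
        ring
    _ ≤ _ := by
        have : 0 ≤ (√((Lf + Lψ + A.κ) * (Lbar + Lψ + A.κ)) + (Lf + Lψ) + L / n
          + √((Lf + Lψ + A.κ) * (L + Lψ + A.κ))) / μ := by positivity
        rw [show ∀ t, 2 / A.δ * t = 1 / A.δ * (2 * t) by intro t; ring]
        gcongr
        linarith

end PrimalAssumption

end Run

end ECCatalyst

namespace ECCatalyst

namespace Run

variable {d n m : ℕ} {S S₁ : Type*} {A : Run d n m S S₁} {Lf Lbar L Lψ : ℝ}

/-! ### Convergence of the outer method -/

namespace PrimalAssumption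

theorem exists_minimizer (h : A.PrimalAssumption Lf Lbar L Lψ) :
    ∃ xs, A.P xs = A.Pmin ∧ ∀ x, A.Pmin + A.lam / 2 * ‖x - xs‖ ^ 2 ≤ A.P x := by
  have hgrad : ∀ x, HasGradientAt A.P (gradient A.fAvg x + gradient A.ψ x) x := fun x =>
    hasGradientAt_add (h.smooth_avg.hasGradientAt x) (h.smooth_reg.hasGradientAt x)
  have hlow : ∀ x u, A.P x + inner ℝ (gradient A.P x) (u - x) + A.lam / 2 * ‖u - x‖ ^ 2
      ≤ A.P u := by
    intro x u
    have h1 := inner_gradient_le_sub h.convex_fAvg (h.smooth_avg.hasGradientAt x) u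
    have h2 := strongConvexOn_add_inner_gradient_le h.strong (h.smooth_reg.hasGradientAt x) u
    rw [(hgrad x).gradient, inner_add_left]
    simp only [P]
    linarith
  obtain ⟨xs, hxs⟩ := exists_isMinOn_of_quadratic_lower_bound h.continuous_P h.lam_pos
    (a := gradient A.P 0) fun x => by simpa using hlow 0 x
  have hmin : A.P xs = A.Pmin :=
    le_antisymm (le_ciInf hxs) (ciInf_le ⟨_, by rintro _ ⟨x, rfl⟩; exact hxs x⟩ _)
  refine ⟨xs, hmin, fun x => ?_⟩
  have := hlow xs x
  rw [gradient_eq_zero_of_forall_le hxs, inner_zero_left, add_zero] at this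
  rwa [← hmin]

theorem P_convex_combination_le (h : A.PrimalAssumption Lf Lbar L Lψ) {a : ℝ} (ha : 0 ≤ a)
    (ha' : a ≤ 1) (x z : Vec d) : A.P (a • x + (1 - a) • z)
      ≤ a * A.P x + (1 - a) * A.P z - A.lam / 2 * (a * (1 - a)) * ‖x - z‖ ^ 2 := by
  have h1 := h.convex_fAvg.2 (Set.mem_univ x) (Set.mem_univ z) ha (sub_nonneg.2 ha')
    (add_sub_cancel _ _)
  have h2 := h.strong.2 (Set.mem_univ x) (Set.mem_univ z) ha (sub_nonneg.2 ha')
    (add_sub_cancel _ _)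
  simp only [smul_eq_mul] at h1 h2
  simp only [P]
  linarith

theorem Pmin_le_Gmin (h : A.PrimalAssumption Lf Lbar L Lψ) (hκ : 0 ≤ A.κ) (y : Vec d) :
    A.Pmin ≤ A.Gmin y := by
  obtain ⟨xs, -, hg⟩ := h.exists_minimizer
  have hlam := h.lam_pos
  rw [h.Gmin_eq hκ, G]
  have h1 := hg (A.prox y)
  have h2 : 0 ≤ A.lam / 2 * ‖A.prox y - xs‖ ^ 2 := by positivity
  have h3 : 0 ≤ A.κ / 2 * ‖A.prox y - y‖ ^ 2 := by positivity
  linarith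

theorem Pmin_le (h : A.PrimalAssumption Lf Lbar L Lψ) (x : Vec d) : A.Pmin ≤ A.P x := by
  obtain ⟨xs, -, hg⟩ := h.exists_minimizer
  have hlam := h.lam_pos
  have h2 : 0 ≤ A.lam / 2 * ‖x - xs‖ ^ 2 := by positivity
  linarith [hg x]

end PrimalAssumption

/-- The auxiliary point `v = x + ((1 + √q) / √q) (y - x)` of Catalyst. -/
noncomputable def auxPoint (A : Run d n m S S₁) (s : Vec d × Vec d) : Vec d :=
  s.1 + ((1 + √A.q) / √A.q) • (s.2 - s.1)

/-- The Lyapunov function of Catalyst. -/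
noncomputable def lyap (A : Run d n m S S₁) (xs : Vec d) (s : Vec d × Vec d) : ℝ :=
  A.P s.1 - A.Pmin + A.lam / 2 * ‖A.auxPoint s - xs‖ ^ 2

namespace CatalystParams

theorem q_pos (hlam : 0 < A.lam) (c : A.CatalystParams) : 0 < A.q := by
  have := c.κ_nonneg
  unfold q
  positivity

theorem sqrt_q_pos (hlam : 0 < A.lam) (c : A.CatalystParams) : 0 < √A.q :=
  Real.sqrt_pos.2 (c.q_pos hlam)

theorem sqrt_q_le_one (hlam : 0 < A.lam) (c : A.CatalystParams) : √A.q ≤ 1 := by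
  have := c.κ_nonneg
  rw [Real.sqrt_le_one]
  exact (div_le_one (by positivity)).2 (by linarith)

theorem lam_eq (hlam : 0 < A.lam) (c : A.CatalystParams) :
    A.lam = (A.lam + A.κ) * √A.q ^ 2 := by
  have := c.κ_nonneg
  rw [Real.sq_sqrt (c.q_pos hlam).le, q]
  field_simp

/-- The value `√q` is a fixed point: with `α_{k}² = q` the right side of the recursion collapses to
`q`. -/
theorem α_eq_sqrt (hlam : 0 < A.lam) (c : A.CatalystParams) (k : ℕ) : A.α k = √A.q := by
  induction k with
  | zero => exact c.α_zero
  | succ k ih =>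
    have h := c.α_eq k
    rw [ih, Real.sq_sqrt (c.q_pos hlam).le] at h
    rw [eq_comm, Real.sqrt_eq_iff_mul_self_eq (c.q_pos hlam).le (c.α_mem k).1.le]
    linarith

theorem β_eq (hlam : 0 < A.lam) (c : A.CatalystParams) (k : ℕ) :
    A.β k = (1 - √A.q) / (1 + √A.q) := by
  have := c.sqrt_q_pos hlam
  rw [β, c.α_eq_sqrt hlam, c.α_eq_sqrt hlam]
  field_simp
  ring

end CatalystParams

theorem lyap_nonneg (h : A.PrimalAssumption Lf Lbar L Lψ) (xs : Vec d) (s : Vec d × Vec d) :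
    0 ≤ A.lyap xs s := by
  have hlam := h.lam_pos
  have := h.Pmin_le s.1
  have h2 : 0 ≤ A.lam / 2 * ‖A.auxPoint s - xs‖ ^ 2 := by positivity
  unfold lyap
  linarith

/-- One step of Catalyst: the error term `t` comes from the inexact solution of the subproblem. -/
theorem lyap_step (h : A.PrimalAssumption Lf Lbar L Lψ) (c : A.CatalystParams) {xs : Vec d}
    (hmin : A.P xs = A.Pmin) {s : Vec d × Vec d} {x' : Vec d} {e : ℝ}
    (he : A.G s.2 x' - A.Gmin s.2 ≤ e) (k : ℕ) :
    ∃ t, t ^ 2 ≤ 4 * e * A.lyap xs (x', x' + A.β k • (x' - s.1)) ∧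
      A.lyap xs (x', x' + A.β k • (x' - s.1)) ≤ (1 - √A.q) * A.lyap xs s + e + t := by
  have hlam := h.lam_pos
  have hκ := c.κ_nonneg
  have hα := c.sqrt_q_pos hlam
  have hα1 := c.sqrt_q_le_one hlam
  have hlamα := c.lam_eq hlam
  have hβ := c.β_eq hlam k
  obtain ⟨x, y⟩ := s
  simp only at he ⊢
  have hv' : A.auxPoint (x', x' + A.β k • (x' - x)) = x + (1 / √A.q) • (x' - x) := by
    have h1 : (1 + √A.q) / √A.q * ((1 - √A.q) / (1 + √A.q)) = 1 / √A.q - 1 := by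
      field_simp
    rw [auxPoint, hβ]
    simp only [add_sub_cancel_left, smul_smul, h1]
    module
  set v' := A.auxPoint (x', x' + A.β k • (x' - x)) with hv'def
  set v := A.auxPoint (x, y) with hv
  set α := √A.q with hαdef
  set μ := A.lam + A.κ with hμ
  have hμ0 : 0 < μ := by positivity
  have hκμ : A.κ = μ * (1 - α ^ 2) := by linarith
  set u := A.prox y with hu
  -- The approximate minimizer is compared with this point. It satisfies `x' - z = α • (v' - xs)`,
  -- so growth of the subproblem at `z` produces the new distance term.
  set z := α • xs + (1 - α) • x with hz
  have hg1 := h.G_growth hκ y z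
  have hg2 := h.G_growth hκ y x'
  have hzx : x' - z = α • (v' - xs) := by
    rw [hv', hz, smul_sub, smul_add, smul_smul, mul_one_div_cancel hα.ne']
    module
  have hzu : ‖z - u‖ ^ 2
      = ‖x' - u‖ ^ 2 - 2 * (α * inner ℝ (x' - u) (v' - xs)) + α ^ 2 * ‖v' - xs‖ ^ 2 := by
    have : z - u = (x' - u) - α • (v' - xs) := by rw [← hzx]; abel
    rw [this, norm_sub_sq_real, inner_smul_right, norm_smul, Real.norm_of_nonneg hα.le]
    ring
  -- The part in `‖xs - x‖ ^ 2` is exactly what strong convexity of `P` on the segment from `x` to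
  -- `xs` gives back.
  have hzy : A.κ / 2 * ‖z - y‖ ^ 2
      ≤ A.lam * (1 - α) / 2 * (‖v - xs‖ ^ 2 + α * ‖xs - x‖ ^ 2) := by
    have e1 : z - y = (α / (1 + α)) • ((xs - v) + α • (xs - x)) := by
      have h1 : (α / (1 + α)) • ((xs - v) + α • (xs - x))
          = (α / (1 + α) * (1 + α)) • (xs - x) - (α / (1 + α) * ((1 + α) / α)) • (y - x) := by
        rw [hv, auxPoint]
        module
      rw [h1, div_mul_cancel₀ _ (by positivity), div_mul_div_cancel₀ (by positivity),
        div_self hα.ne', hz]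
      module
    have e2 : ‖(xs - v) + α • (xs - x)‖ ^ 2 ≤ (1 + α) * (‖v - xs‖ ^ 2 + α * ‖xs - x‖ ^ 2) := by
      have h1 : 0 ≤ α * ‖(xs - v) - (xs - x)‖ ^ 2 := by positivity
      rw [norm_sub_sq_real] at h1
      rw [norm_add_sq_real, inner_smul_right, norm_smul, Real.norm_of_nonneg hα.le,
        norm_sub_rev v xs]
      linarith
    rw [e1, norm_smul, mul_pow, Real.norm_of_nonneg (by positivity)]
    calc A.κ / 2 * ((α / (1 + α)) ^ 2 * ‖(xs - v) + α • (xs - x)‖ ^ 2)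
        ≤ A.κ / 2 * ((α / (1 + α)) ^ 2 * ((1 + α) * (‖v - xs‖ ^ 2 + α * ‖xs - x‖ ^ 2))) := by
          gcongr
      _ = _ := by
          rw [hκμ, hlamα]
          field_simp
          ring
  have hP := h.P_convex_combination_le hα.le hα1 xs x
  rw [hmin] at hP
  have hS : A.lyap xs (x, y) = A.P x - A.Pmin + A.lam / 2 * ‖v - xs‖ ^ 2 := rfl
  have hS' : A.lyap xs (x', x' + A.β k • (x' - x))
      = A.P x' - A.Pmin + A.lam / 2 * ‖v' - xs‖ ^ 2 := rfl
  have hP' := h.Pmin_le x'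
  -- The error is the cross term in expanding `‖z - u‖ ^ 2` around `x' - u`. Growth bounds `μ * ‖x'
  -- - u‖ ^ 2` by `2 * e`, and `μ * α ^ 2 = λ` bounds the other factor by twice the new Lyapunov
  -- value.
  refine ⟨μ * α * inner ℝ (x' - u) (v' - xs), ?_, ?_⟩
  · have hin := abs_real_inner_le_norm (x' - u) (v' - xs)
    have hin2 : (inner ℝ (x' - u) (v' - xs)) ^ 2 ≤ ‖x' - u‖ ^ 2 * ‖v' - xs‖ ^ 2 := by
      rw [← mul_pow, ← sq_abs]
      gcongr
    have hxu : μ * ‖x' - u‖ ^ 2 ≤ 2 * e := by linarith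
    have hvx : μ * α ^ 2 * ‖v' - xs‖ ^ 2
        ≤ 2 * A.lyap xs (x', x' + A.β k • (x' - x)) := by
      rw [hS', ← hlamα]
      linarith
    calc (μ * α * inner ℝ (x' - u) (v' - xs)) ^ 2
        = (μ * α) ^ 2 * (inner ℝ (x' - u) (v' - xs)) ^ 2 := by ring
      _ ≤ (μ * α) ^ 2 * (‖x' - u‖ ^ 2 * ‖v' - xs‖ ^ 2) := by gcongr
      _ = (μ * ‖x' - u‖ ^ 2) * (μ * α ^ 2 * ‖v' - xs‖ ^ 2) := by ring
      _ ≤ (2 * e) * (2 * A.lyap xs (x', x' + A.β k • (x' - x))) := by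
          have : 0 ≤ μ * ‖x' - u‖ ^ 2 := by positivity
          gcongr
          linarith
      _ = _ := by ring
  · rw [hzu] at hg1
    have hn1 : 0 ≤ μ * ‖x' - u‖ ^ 2 := by positivity
    have hn2 : 0 ≤ A.κ / 2 * ‖x' - y‖ ^ 2 := by positivity
    have hl : μ / 2 * (α ^ 2 * ‖v' - xs‖ ^ 2) = A.lam / 2 * ‖v' - xs‖ ^ 2 := by
      conv_rhs => rw [hlamα]
      ring
    simp only [G] at he hg1
    rw [hS', hS]
    linarith

/-- With `σ = √S'`, `w = √e` and `r = 3 * w / g`, the hypothesis reads `σ² - 2wσ ≤ r² - 3wr + w²`.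
For `σ > r ≥ 3w` this fails, since `σ² - 2wσ` is increasing there. The constant `9` is `3²`. -/
theorem le_of_quadratic_recursion {S' M e t g : ℝ} (he : 0 ≤ e) (hg : 0 < g) (hg' : g ≤ 1)
    (hM : M = 9 * e / g ^ 2) (ht : t ^ 2 ≤ 4 * e * S') (hS' : 0 ≤ S')
    (h : S' ≤ (1 - g) * M + e + t) : S' ≤ M := by
  set σ := √S' with hσ
  set w := √e with hw
  have hσ0 : 0 ≤ σ := Real.sqrt_nonneg _
  have hw0 : 0 ≤ w := Real.sqrt_nonneg _
  have hσ2 : S' = σ ^ 2 := (Real.sq_sqrt hS').symm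
  have hw2 : e = w ^ 2 := (Real.sq_sqrt he).symm
  have ht' : t ≤ 2 * w * σ := by
    refine le_of_sq_le_sq (ht.trans (le_of_eq ?_)) (by positivity)
    rw [hσ2, hw2]
    ring
  set r := 3 * w / g with hr
  have hr3 : 3 * w ≤ r := by rw [hr, le_div_iff₀ hg]; nlinarith
  have hrg : r * g = 3 * w := by rw [hr]; field_simp
  have hM' : M = r ^ 2 := by rw [hM, hw2, hr]; field_simp; ring
  have hgM : g * M = 3 * w * r := by rw [hM', ← hrg]; ring
  have hle : σ ≤ r := by
    by_contra! hlt
    nlinarith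
  rw [hM', hσ2]
  gcongr

section

theorem ε_nonneg (h : A.PrimalAssumption Lf Lbar L Lψ) (c : A.CatalystParams) (k : ℕ) :
    0 ≤ A.ε k := by
  have h1 := sub_nonneg.2 (h.Pmin_le A.x₀)
  have h2 : 0 ≤ 1 - A.ρ₀ := by
    have := c.sqrt_q_le_one h.lam_pos
    have := c.ρ₀_lt
    linarith
  unfold ε
  positivity

theorem ε_succ (k : ℕ) : A.ε (k + 1) = (1 - A.ρ₀) * A.ε k := by
  simp only [ε, pow_succ]
  ring

/-- The bound on the Lyapunov function kept by the outer method. -/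
noncomputable def lyapBound (A : Run d n m S S₁) (k : ℕ) : ℝ := 9 * A.ε k / (√A.q - A.ρ₀) ^ 2

/-- The recursion closes because `(1 - (√q - ρ₀)) * (1 - ρ₀)` exceeds `1 - √q` by `(√q - ρ₀) * ρ₀ ≥
0`, while the bound itself shrinks only by `1 - ρ₀`. -/
theorem lyap_succ_le (h : A.PrimalAssumption Lf Lbar L Lψ) (c : A.CatalystParams) {xs : Vec d}
    (hmin : A.P xs = A.Pmin) {s : Vec d × Vec d} {x' : Vec d} {k : ℕ}
    (hs : A.lyap xs s ≤ A.lyapBound k) (he : A.G s.2 x' - A.Gmin s.2 ≤ A.ε (k + 1)) :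
    A.lyap xs (x', x' + A.β (k + 1) • (x' - s.1)) ≤ A.lyapBound (k + 1) := by
  have hlam := h.lam_pos
  have hα1 := c.sqrt_q_le_one hlam
  have hρ := c.ρ₀_pos
  have hρ' := c.ρ₀_lt
  obtain ⟨t, ht, hle⟩ := lyap_step h c hmin he (k + 1)
  refine le_of_quadratic_recursion (ε_nonneg h c (k + 1)) (sub_pos.2 hρ') (by linarith) rfl ht
    (lyap_nonneg h xs _) (hle.trans ?_)
  have hB : A.lyapBound (k + 1) = (1 - A.ρ₀) * A.lyapBound k := by
    rw [lyapBound, lyapBound, ε_succ]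
    ring
  have hB0 : 0 ≤ A.lyapBound k := (lyap_nonneg h xs s).trans hs
  change _ ≤ (1 - (√A.q - A.ρ₀)) * A.lyapBound (k + 1) + _ + _
  rw [hB]
  have h1 : (1 - √A.q) * A.lyap xs s ≤ (1 - √A.q) * A.lyapBound k :=
    mul_le_mul_of_nonneg_left hs (sub_nonneg.2 hα1)
  have h2 : 0 ≤ (√A.q - A.ρ₀) * A.ρ₀ * A.lyapBound k :=
    mul_nonneg (mul_nonneg (sub_nonneg.2 hρ'.le) hρ.le) hB0
  linarith

/-- Growth bounds the distance term by the initial gap, so the Lyapunov value is at most twice that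
gap, which equals `9 * ε 0`; hence the factor `2 / 9` in `ε`. -/
theorem lyap_zero_le (h : A.PrimalAssumption Lf Lbar L Lψ) (c : A.CatalystParams) {xs : Vec d}
    (hgrow : ∀ x, A.Pmin + A.lam / 2 * ‖x - xs‖ ^ 2 ≤ A.P x) :
    A.lyap xs (A.x₀, A.x₀) ≤ A.lyapBound 0 := by
  have h1 : A.auxPoint (A.x₀, A.x₀) = A.x₀ := by simp [auxPoint]
  have hα1 := c.sqrt_q_le_one h.lam_pos
  have hρ := c.ρ₀_pos
  have h2 : 0 < √A.q - A.ρ₀ := sub_pos.2 c.ρ₀_lt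
  have h3 := hgrow A.x₀
  have h4 := ε_nonneg h c 0
  have h5 : 9 * A.ε 0 ≤ A.lyapBound 0 := by
    rw [lyapBound, le_div_iff₀ (by positivity)]
    refine mul_le_of_le_one_right (by positivity) (pow_le_one₀ h2.le (by linarith))
  have h6 : 9 * A.ε 0 = 2 * (A.P A.x₀ - A.Pmin) := by simp only [ε, pow_zero]; ring
  rw [lyap, h1]
  simp only
  linarith

/-- Both `x` and the auxiliary point are close to `xs`, and `y - x` is a multiple of their
difference with factor at most `√q`. As `κ * q ≤ λ`, the quadratic term is controlled without loss
in `κ`, and the gap is at most five times the Lyapunov value. The third power arises from passing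
from `ε k` to `ε (k + 1)`, using `√q - ρ₀ ≤ 1 - ρ₀`. -/
theorem warm_start_gap_le (h : A.PrimalAssumption Lf Lbar L Lψ) (c : A.CatalystParams)
    {xs : Vec d} (hgrow : ∀ x, A.Pmin + A.lam / 2 * ‖x - xs‖ ^ 2 ≤ A.P x)
    {s : Vec d × Vec d} {k : ℕ} (hs : A.lyap xs s ≤ A.lyapBound k) :
    A.G s.2 s.1 - A.Gmin s.2 ≤ 45 / (√A.q - A.ρ₀) ^ 3 * A.ε (k + 1) := by
  have hlam := h.lam_pos
  have hκ := c.κ_nonneg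
  have hα := c.sqrt_q_pos hlam
  have hα1 := c.sqrt_q_le_one hlam
  have hlamα := c.lam_eq hlam
  have hρ := c.ρ₀_pos
  have hg0 : 0 < √A.q - A.ρ₀ := sub_pos.2 c.ρ₀_lt
  obtain ⟨x, y⟩ := s
  simp only
  have hG := h.Pmin_le_Gmin hκ y
  have hx := hgrow x
  set v := A.auxPoint (x, y) with hv
  have hS : A.lyap xs (x, y) = A.P x - A.Pmin + A.lam / 2 * ‖v - xs‖ ^ 2 := rfl
  have hκα : A.κ * √A.q ^ 2 ≤ A.lam := by
    have : 0 ≤ A.lam * √A.q ^ 2 := by positivity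
    linarith
  have hxy : ‖x - y‖ ^ 2 ≤ √A.q ^ 2 * (2 * (‖v - xs‖ ^ 2 + ‖x - xs‖ ^ 2)) := by
    have e1 : y - x = (√A.q / (1 + √A.q)) • ((v - xs) - (x - xs)) := by
      rw [sub_sub_sub_cancel_right, hv, auxPoint, add_sub_cancel_left, smul_smul,
        div_mul_div_cancel₀ (by positivity), div_self hα.ne', one_smul]
    rw [norm_sub_rev, e1, norm_smul, mul_pow, Real.norm_of_nonneg (by positivity)]
    have e2 : √A.q / (1 + √A.q) ≤ √A.q := div_le_self hα.le (by linarith)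
    gcongr
    exact norm_sub_sq_le_two_mul _ _
  have hquad : A.κ / 2 * ‖x - y‖ ^ 2 ≤ A.lam * (‖v - xs‖ ^ 2 + ‖x - xs‖ ^ 2) := by
    calc _ ≤ A.κ / 2 * (√A.q ^ 2 * (2 * (‖v - xs‖ ^ 2 + ‖x - xs‖ ^ 2))) := by gcongr
      _ = A.κ * √A.q ^ 2 * (‖v - xs‖ ^ 2 + ‖x - xs‖ ^ 2) := by ring
      _ ≤ _ := by gcongr
  have hS0 := lyap_nonneg h xs (x, y)
  have hgap : A.G y x - A.Gmin y ≤ 5 * A.lyap xs (x, y) := by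
    have : 0 ≤ A.lam / 2 * ‖v - xs‖ ^ 2 := by positivity
    simp only [G]
    linarith
  have hε := ε_nonneg h c k
  calc _ ≤ 5 * A.lyap xs (x, y) := hgap
    _ ≤ 5 * A.lyapBound k := by linarith
    _ = 45 / (√A.q - A.ρ₀) ^ 3 * ((√A.q - A.ρ₀) * A.ε k) := by
        rw [lyapBound]
        field_simp
        ring
    _ ≤ _ := by
        rw [ε_succ]
        gcongr

theorem log_le_logFactor (h : A.PrimalAssumption Lf Lbar L Lψ) (c : A.CatalystParams) :
    1 ≤ A.logFactor ∧ Real.log (8 * (45 / (√A.q - A.ρ₀) ^ 3) + 2) + 2 ≤ 8 * A.logFactor := by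
  have hα1 := c.sqrt_q_le_one h.lam_pos
  have hρ := c.ρ₀_pos
  have hg0 : 0 < √A.q - A.ρ₀ := sub_pos.2 c.ρ₀_lt
  have hg1 : √A.q - A.ρ₀ ≤ 1 := by linarith
  rw [logFactor]
  set g := √A.q - A.ρ₀
  have hl : 0 ≤ Real.log (1 / g) := Real.log_nonneg ((one_le_div hg0).2 hg1)
  have h1 : 8 * (45 / g ^ 3) + 2 ≤ 362 * (1 / g) ^ 3 := by
    have : 1 ≤ (1 / g) ^ 3 := one_le_pow₀ ((one_le_div hg0).2 hg1)
    have e : 8 * (45 / g ^ 3) = 360 * (1 / g) ^ 3 := by field_simp; norm_num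
    linarith
  have h2 : Real.log 362 ≤ 6 := by
    rw [Real.log_le_iff_le_exp (by norm_num)]
    have h3 := Real.exp_one_gt_d9
    have h4 : Real.exp 6 = Real.exp 1 ^ 6 := by rw [← Real.exp_nat_mul]; norm_num
    rw [h4]
    calc (362 : ℝ) ≤ 2.7182818283 ^ 6 := by norm_num
      _ ≤ _ := by gcongr
  have h5 : Real.log (8 * (45 / g ^ 3) + 2) ≤ 6 + 3 * Real.log (1 / g) := by
    calc _ ≤ Real.log (362 * (1 / g) ^ 3) := Real.log_le_log (by positivity) h1
      _ = Real.log 362 + 3 * Real.log (1 / g) := by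
          rw [Real.log_mul (by norm_num) (by positivity), Real.log_pow]
          norm_num
      _ ≤ _ := by linarith
  exact ⟨by linarith, by linarith⟩

theorem gap_outerBound_le (h : A.PrimalAssumption Lf Lbar L Lψ) (c : A.CatalystParams)
    {xs : Vec d} {s : Vec d × Vec d} {C acc : ℝ} (hC : 2 ≤ C) (hacc : 0 < acc)
    (hs : A.lyap xs s ≤ A.lyapBound (A.outerBound C acc)) : A.P s.1 - A.Pmin ≤ acc := by
  have hlam := h.lam_pos
  have hα1 := c.sqrt_q_le_one hlam
  have hρ := c.ρ₀_pos
  have hg0 : 0 < √A.q - A.ρ₀ := sub_pos.2 c.ρ₀_lt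
  have h1ρ : 0 ≤ 1 - A.ρ₀ := by linarith
  have hΔ := sub_nonneg.2 (h.Pmin_le A.x₀)
  have h1 : A.P s.1 - A.Pmin ≤ A.lyapBound (A.outerBound C acc) := by
    refine le_trans ?_ hs
    have : 0 ≤ A.lam / 2 * ‖A.auxPoint s - xs‖ ^ 2 := by positivity
    unfold lyap
    linarith
  refine h1.trans ?_
  rw [lyapBound, ε, outerBound]
  set g := √A.q - A.ρ₀
  set Δ := A.P A.x₀ - A.Pmin
  -- If the initial gap is zero, the argument of the logarithm is zero, but then the bound is zero
  -- for every number of iterations.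
  rcases hΔ.eq_or_lt with h0 | h0
  · rw [← h0]
    simpa using hacc.le
  set Y := C * Δ / (g ^ 2 * acc) with hY
  have hY0 : 0 < Y := by positivity
  set N := ⌈1 / A.ρ₀ * Real.log Y⌉₊
  have hN : Real.log Y ≤ A.ρ₀ * N := by
    calc Real.log Y = A.ρ₀ * (1 / A.ρ₀ * Real.log Y) := by field_simp
      _ ≤ _ := by
          gcongr
          exact Nat.le_ceil _
  have hpow : (1 - A.ρ₀) ^ N ≤ Y⁻¹ := by
    calc (1 - A.ρ₀) ^ N ≤ Real.exp (-A.ρ₀) ^ N := by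
          gcongr
          have := Real.add_one_le_exp (-A.ρ₀)
          linarith
      _ = Real.exp (-(A.ρ₀ * N)) := by rw [← Real.exp_nat_mul]; ring_nf
      _ ≤ Real.exp (-Real.log Y) := by gcongr
      _ = _ := by rw [Real.exp_neg, Real.exp_log hY0]
  calc 9 * (2 / 9 * Δ * (1 - A.ρ₀) ^ N) / g ^ 2 ≤ 9 * (2 / 9 * Δ * Y⁻¹) / g ^ 2 := by gcongr
    _ = 2 / C * acc := by rw [hY]; field_simp
    _ ≤ 1 * acc := by
        gcongr
        exact (div_le_one (by linarith)).2 hC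
    _ = acc := one_mul _

end

end Run

end ECCatalyst

/-! ### Freezing an independent variable, and measurability of first hitting indices. -/

namespace ECCatalyst

theorem lintegral_comp_le_of_indepFun {Ω α β : Type*} {_ : MeasurableSpace Ω}
    {_ : MeasurableSpace α} {_ : MeasurableSpace β} {μ : Measure Ω} [IsProbabilityMeasure μ]
    {X : Ω → α} {Z : Ω → β} (hX : Measurable X) (hZ : Measurable Z)
    (hXZ : IndepFun X Z μ) {F : α → β → ℝ≥0∞} (hF : Measurable (Function.uncurry F)) {B : ℝ≥0∞}
    (hB : ∀ᵐ ω ∂μ, ∫⁻ ω', F (X ω) (Z ω') ∂μ ≤ B) : ∫⁻ ω, F (X ω) (Z ω) ∂μ ≤ B := by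
  rw [lintegral_comp_of_indepFun hX hZ hXZ hF]
  calc _ ≤ ∫⁻ _, B ∂μ := by
        refine lintegral_mono_ae ?_
        filter_upwards [hB] with ω hω
        rwa [lintegral_map (f := F (X ω)) (hF.comp measurable_prodMk_left) hZ]
    _ = B := by rw [lintegral_const, measure_univ, mul_one]

/-- For the empty set both sides are `0`: the infimum is `⊤`, which `toNat` sends to `0`. -/
theorem toNat_sInf_image (s : Set ℕ) :
    (sInf ((fun K : ℕ => (K : ℕ∞)) '' s)).toNat = sInf s := by
  rcases s.eq_empty_or_nonempty with rfl | hs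
  · simp
  · rw [sInf_image, ← ENat.natCast_sInf hs, ENat.toNat_natCast]

theorem measurable_nat_sInf {α : Type*} {_ : MeasurableSpace α} {q : ℕ → α → Prop}
    (hq : ∀ K, MeasurableSet {a | q K a}) : Measurable fun a => sInf {K : ℕ | q K a} := by
  refine measurable_to_countable' fun j => ?_
  -- The second set accounts for the default value `0` of the infimum of the empty set.
  have h : (fun a => sInf {K : ℕ | q K a}) ⁻¹' {j}
      = ({a | q j a} ∩ ⋂ i ∈ Set.Iio j, {a | q i a}ᶜ)
        ∪ ({_a | j = 0} ∩ ⋂ i, {a | q i a}ᶜ) := by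
    ext a
    simp only [Set.mem_preimage, Set.mem_singleton_iff, Set.mem_union, Set.mem_inter_iff,
      Set.mem_iInter, Set.mem_compl_iff, Set.mem_Iio]
    constructor
    · rintro rfl
      rcases Set.eq_empty_or_nonempty {K : ℕ | q K a} with he | hne
      · right
        refine ⟨by rw [he, Nat.sInf_empty]; trivial, fun i hi => ?_⟩
        exact Set.eq_empty_iff_forall_notMem.1 he i hi
      · left
        exact ⟨Nat.sInf_mem hne, fun i hi => Nat.notMem_of_lt_sInf hi⟩
    · rintro (⟨hj, hlt⟩ | ⟨hj, hno⟩)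
      · refine le_antisymm (Nat.sInf_le hj) (le_of_not_gt fun hlt' => ?_)
        exact hlt _ hlt' (Nat.sInf_mem (s := {K : ℕ | q K a}) ⟨j, hj⟩)
      · have he : {K : ℕ | q K a} = ∅ := Set.eq_empty_iff_forall_notMem.2 hno
        rw [he, Nat.sInf_empty]
        exact hj.symm
  rw [h]
  refine MeasurableSet.union ?_ ?_
  · exact (hq j).inter (MeasurableSet.biInter (Set.to_countable _) fun i _ => (hq i).compl)
  · exact (MeasurableSet.const _).inter (MeasurableSet.iInter fun i => (hq i).compl)

namespace Run

variable {d n m : ℕ} {S S₁ : Type*} {A : Run d n m S S₁} {Lf Lbar L Lψ : ℝ}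

/-! ### Measurability of the outer method -/

/-- The gap of the averaged inner iterate. -/
noncomputable def innerGap (A : Run d n m S S₁) (s : Vec d × Vec d) (z : ℕ → Seed n m S S₁)
    (K : ℕ) : ℝ :=
  A.G s.2 (A.innerAverage s z K) - A.Gmin s.2

section

variable [MeasurableSpace S] [MeasurableSpace S₁] {α : Type*} {mα : MeasurableSpace α}
  {ν : Measure S} {ν₁ : Measure S₁}

theorem measurable_innerIterate (h : A.PrimalAssumption Lf Lbar L Lψ) (hd : 0 < d) (hm : 0 < m)
    (hQ : Measurable (Function.uncurry A.Q)) (hQ₁ : Measurable (Function.uncurry A.Q₁))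
    {s : α → Vec d × Vec d} (hs : Measurable s) {z : α → ℕ → Seed n m S S₁}
    (hz : ∀ k, Measurable fun a => z a k) (K : ℕ) :
    Measurable fun a => A.innerIterate (s a) (z a) K := by
  have hψ : ∀ x : α → Vec d, Measurable x → Measurable fun a => gradient A.ψ (x a) :=
    fun x hx => (h.smooth_reg.continuous_gradient hd).measurable.comp hx
  have hshift : ∀ τ (x : α → Vec d), Measurable x →
      Measurable fun a => A.initShift (x a) (s a).2 τ := fun τ x hx =>
    ((((h.smooth_node τ).continuous_gradient hd).measurable.comp hx).add (hψ x hx)).add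
      ((hx.sub hs.snd).const_smul A.κ)
  have hstart : Measurable fun a => ecInit (s a).1 (A.initShift (s a).1 (s a).2) :=
    measurable_ecState_iff.2 ⟨hs.fst, hs.fst, fun τ => measurable_const,
      fun τ => hshift τ _ hs.fst,
      (Finset.measurable_fun_sum Finset.univ fun τ _ => hshift τ _ hs.fst).const_smul (n : ℝ)⁻¹⟩
  refine (measurable_ecState_iff.1 (measurable_ecState (F := fun a => A.subComp (s a).2) hQ hQ₁
    (fun τ i x hx => ?_) (fun τ x hx => ?_) hstart K fun k _ => hz k)).1
  · simp_rw [h.gradient_subComp]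
    exact ((((h.smooth_comp τ i).continuous_gradient hd).measurable.comp hx).add (hψ x hx)).add
      ((hx.sub hs.snd).const_smul A.κ)
  · simp_rw [h.gradient_nodeFun_subComp hm]
    exact hshift τ x hx

theorem measurable_innerAverage (h : A.PrimalAssumption Lf Lbar L Lψ) (hd : 0 < d) (hm : 0 < m)
    (hQ : Measurable (Function.uncurry A.Q)) (hQ₁ : Measurable (Function.uncurry A.Q₁))
    {s : α → Vec d × Vec d} (hs : Measurable s) {z : α → ℕ → Seed n m S S₁}
    (hz : ∀ k, Measurable fun a => z a k) (K : ℕ) :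
    Measurable fun a => A.innerAverage (s a) (z a) K := by
  unfold innerAverage weightedAverage
  exact (Finset.measurable_fun_sum (Finset.range (K + 1)) fun j _ =>
    (measurable_innerIterate h hd hm hQ hQ₁ hs hz j).const_smul
      ((1 - A.θ) ^ (j + 1))⁻¹).const_smul (∑ j ∈ Finset.range (K + 1), ((1 - A.θ) ^ (j + 1))⁻¹)⁻¹

theorem measurable_innerGap (h : A.PrimalAssumption Lf Lbar L Lψ) (hκ : 0 ≤ A.κ) (hd : 0 < d)
    (hm : 0 < m)
    (hQ : Measurable (Function.uncurry A.Q)) (hQ₁ : Measurable (Function.uncurry A.Q₁))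
    {s : α → Vec d × Vec d} (hs : Measurable s) {z : α → ℕ → Seed n m S S₁}
    (hz : ∀ k, Measurable fun a => z a k) (K : ℕ) :
    Measurable fun a => A.innerGap (s a) (z a) K := by
  have hx := measurable_innerAverage h hd hm hQ hQ₁ hs hz K
  exact ((h.continuous_P.measurable.comp hx).add
    (((hx.sub hs.snd).norm.pow_const 2).const_mul _)).sub
    ((h.continuous_Gmin hκ).measurable.comp hs.snd)

theorem measurable_stopTime_toNat (h : A.PrimalAssumption Lf Lbar L Lψ) (hκ : 0 ≤ A.κ)
    (hd : 0 < d) (hm : 0 < m)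
    (hQ : Measurable (Function.uncurry A.Q)) (hQ₁ : Measurable (Function.uncurry A.Q₁))
    {s : α → Vec d × Vec d} (hs : Measurable s) {z : α → ℕ → Seed n m S S₁}
    (hz : ∀ k, Measurable fun a => z a k) (acc : ℝ) :
    Measurable fun a => (A.stopTime acc (s a) (z a)).toNat := by
  simp_rw [stopTime, toNat_sInf_image]
  refine measurable_nat_sInf fun K => ?_
  exact (MeasurableSet.const (1 ≤ K)).inter
    (measurableSet_le (measurable_innerGap h hκ hd hm hQ hQ₁ hs hz K) measurable_const)

theorem measurable_extrapolation {u v : α → Vec d} (hu : Measurable u) (hv : Measurable v)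
    (b : ℝ) : Measurable fun a => (u a, u a + b • (u a - v a)) :=
  hu.prodMk (hu.add ((hu.sub hv).const_smul b))

theorem measurable_apply_nat {f : ℕ → α → Vec d} (hf : ∀ K, Measurable (f K)) {N : α → ℕ}
    (hN : Measurable N) : Measurable fun a => f (N a) a := by
  have h : Measurable fun y : ℕ × α => f y.1 y.2 := measurable_from_prod_countable_right hf
  exact h.comp (hN.prodMk measurable_id)

theorem measurable_outer_step (h : A.PrimalAssumption Lf Lbar L Lψ) (hκ : 0 ≤ A.κ)
    (hd : 0 < d) (hm : 0 < m)
    (hQ : Measurable (Function.uncurry A.Q)) (hQ₁ : Measurable (Function.uncurry A.Q₁))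
    {s : α → Vec d × Vec d} (hs : Measurable s) {z : α → ℕ → Seed n m S S₁}
    (hz : ∀ k, Measurable fun a => z a k) (acc b : ℝ) :
    Measurable fun a =>
      (A.innerAverage (s a) (z a) (A.stopTime acc (s a) (z a)).toNat,
        A.innerAverage (s a) (z a) (A.stopTime acc (s a) (z a)).toNat
          + b • (A.innerAverage (s a) (z a) (A.stopTime acc (s a) (z a)).toNat - (s a).1)) := by
  have hx := measurable_apply_nat (fun K => measurable_innerAverage h hd hm hQ hQ₁ hs hz K)
    (measurable_stopTime_toNat h hκ hd hm hQ hQ₁ hs hz acc)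
  exact measurable_extrapolation hx hs.fst b

/-- The σ-algebra is the one generated by the seeds of rows at most `k`; the next subproblem uses
only row `k + 1`, which is independent of it. -/
theorem measurable_outer {Ω : Type*} (h : A.PrimalAssumption Lf Lbar L Lψ) (hκ : 0 ≤ A.κ)
    (hd : 0 < d) (hm : 0 < m)
    (hQ : Measurable (Function.uncurry A.Q)) (hQ₁ : Measurable (Function.uncurry A.Q₁))
    (ζ : ℕ → ℕ → Ω → Seed n m S S₁) (k : ℕ) :
    Measurable[genBy (fun j : ℕ × ℕ => ζ j.1 j.2) {j | j.1 ≤ k}]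
      fun ω => A.outer (fun k K => ζ k K ω) k := by
  induction k with
  | zero => exact measurable_const
  | succ k ih =>
    have hle : genBy (fun j : ℕ × ℕ => ζ j.1 j.2) {j | j.1 ≤ k}
        ≤ genBy (fun j : ℕ × ℕ => ζ j.1 j.2) {j | j.1 ≤ k + 1} :=
      biSup_mono fun j hj => Nat.le_succ_of_le hj
    exact measurable_outer_step (mα := genBy (fun j : ℕ × ℕ => ζ j.1 j.2) {j | j.1 ≤ k + 1})
      h hκ hd hm hQ hQ₁ (ih.mono hle le_rfl) (z := fun ω K => ζ (k + 1) K ω)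
      (fun K => measurable_genBy (ζ := fun j : ℕ × ℕ => ζ j.1 j.2) (i := (k + 1, K))
        (show k + 1 ≤ k + 1 from le_rfl)) (A.ε (k + 1)) (A.β (k + 1))

theorem indepFun_outer {Ω : Type*} {mΩ : MeasurableSpace Ω} {μ : Measure Ω}
    (h : A.PrimalAssumption Lf Lbar L Lψ) (hκ : 0 ≤ A.κ)
    (hd : 0 < d) (hm : 0 < m)
    (hQ : Measurable (Function.uncurry A.Q)) (hQ₁ : Measurable (Function.uncurry A.Q₁))
    {ζ : ℕ → ℕ → Ω → Seed n m S S₁} (hζ : ∀ k K, Measurable (ζ k K))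
    (hind : iIndepFun (fun j : ℕ × ℕ => ζ j.1 j.2) μ) (k : ℕ) :
    IndepFun (fun ω => A.outer (fun k K => ζ k K ω) k) (fun ω K => ζ (k + 1) K ω) μ := by
  refine indepFun_of_measurable_genBy (fun j => hζ _ _) hind (s := {j | j.1 ≤ k})
    (t := {j | j.1 = k + 1}) ?_ (measurable_outer h hκ hd hm hQ hQ₁ ζ k)
    (@measurable_pi_lambda _ _ _ (genBy (fun j : ℕ × ℕ => ζ j.1 j.2) {j | j.1 = k + 1}) _ _
      fun K => measurable_genBy (ζ := fun j : ℕ × ℕ => ζ j.1 j.2) (i := (k + 1, K))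
        (show k + 1 = k + 1 from rfl))
  rw [Set.disjoint_left]
  intro j (hj : j.1 ≤ k) (hj' : j.1 = k + 1)
  omega

theorem measurable_outer_of_measurable {Ω : Type*} {mΩ : MeasurableSpace Ω}
    (h : A.PrimalAssumption Lf Lbar L Lψ) (hκ : 0 ≤ A.κ)
    (hd : 0 < d) (hm : 0 < m)
    (hQ : Measurable (Function.uncurry A.Q)) (hQ₁ : Measurable (Function.uncurry A.Q₁))
    {ζ : ℕ → ℕ → Ω → Seed n m S S₁} (hζ : ∀ k K, Measurable (ζ k K)) (k : ℕ) :
    Measurable fun ω => A.outer (fun k K => ζ k K ω) k :=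
  (measurable_outer h hκ hd hm hQ hQ₁ ζ k).mono (genBy_le (fun _ => hζ _ _) _) le_rfl

end

/-! ### The expected number of inner iterations of one outer iteration -/

/-- A measurable upper bound on the number of inner iterations. -/
noncomputable def countBound (A : Run d n m S S₁) (K₀ : ℕ) (acc : ℝ) (s : Vec d × Vec d)
    (z : ℕ → Seed n m S S₁) : ℝ≥0∞ :=
  K₀ + ∑' j : ℕ, if acc < A.innerGap s z (K₀ + j) then 1 else 0

theorem stopTime_le_countBound {K₀ : ℕ} (hK₀ : 1 ≤ K₀) (acc : ℝ) (s : Vec d × Vec d)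
    (z : ℕ → Seed n m S S₁) : (A.stopTime acc s z : ℝ≥0∞) ≤ A.countBound K₀ acc s z :=
  sInf_le_add_tsum (A.innerGap s z) acc hK₀

theorem innerGap_toNat_le {acc : ℝ} {s : Vec d × Vec d} {z : ℕ → Seed n m S S₁}
    (h : A.stopTime acc s z ≠ ⊤) : A.innerGap s z (A.stopTime acc s z).toNat ≤ acc := by
  have hne : {K : ℕ | 1 ≤ K ∧ A.G s.2 (A.innerAverage s z K) - A.Gmin s.2 ≤ acc}.Nonempty := by
    by_contra! he
    exact h (by rw [stopTime, he, Set.image_empty, sInf_empty])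
  rw [stopTime, toNat_sInf_image]
  exact (Nat.sInf_mem hne).2

section

variable [MeasurableSpace S] [MeasurableSpace S₁] {ν : Measure S} [IsProbabilityMeasure ν]
  {ν₁ : Measure S₁} [IsProbabilityMeasure ν₁] {Ω : Type*} {mΩ : MeasurableSpace Ω}
  {μ : Measure Ω} [IsProbabilityMeasure μ]

theorem measurable_countBound {α : Type*} {mα : MeasurableSpace α}
    (h : A.PrimalAssumption Lf Lbar L Lψ) (hκ : 0 ≤ A.κ) (hd : 0 < d) (hm : 0 < m)
    (hQ : Measurable (Function.uncurry A.Q)) (hQ₁ : Measurable (Function.uncurry A.Q₁))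
    {s : α → Vec d × Vec d} (hs : Measurable s) {z : α → ℕ → Seed n m S S₁}
    (hz : ∀ k, Measurable fun a => z a k) (K₀ : ℕ) (acc : ℝ) :
    Measurable fun a => A.countBound K₀ acc (s a) (z a) :=
  (Measurable.tsum fun j => Measurable.ite (measurableSet_lt measurable_const
    (measurable_innerGap h hκ hd hm hQ hQ₁ hs hz (K₀ + j))) measurable_const
      measurable_const).const_add _

theorem lintegral_countBound_le (h : A.PrimalAssumption Lf Lbar L Lψ) (hκ : 0 ≤ A.κ)
    (hd : 0 < d) (hn : 0 < n) (hm : 0 < m)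
    (hQ : IsContractionCompressor ν A.Q A.δ) (hQ₁ : IsContractionCompressor ν₁ A.Q₁ A.δ₁)
    (c : StepParams n (A.lam + A.κ) (Lf + Lψ + A.κ) (Lbar + Lψ + A.κ) (L + Lψ + A.κ)
      A.δ A.δ₁ A.p A.η A.θ)
    {ξ : ℕ → Ω → Seed n m S S₁} (hξ : ∀ K, Measurable (ξ K))
    (hlaw : ∀ K, μ.map (ξ K) = seedLaw n m ν ν₁ A.p) (hind : iIndepFun ξ μ)
    {s : Vec d × Vec d} {acc R : ℝ} (hacc : 0 ≤ acc) (hR : 0 ≤ R)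
    (hgap : A.G s.2 s.1 - A.Gmin s.2 ≤ R * acc) :
    ∫⁻ ω, A.countBound ⌈Real.log (8 * R + 2) / A.θ⌉₊ acc s (fun k => ξ k ω) ∂μ
      ≤ ENNReal.ofReal ((Real.log (8 * R + 2) + 2) / A.θ) := by
  have hF := h.finiteSumProblem hd hn hm hκ s.2
  have hθ : A.θ < 1 := by have := c.θ_le_p; have := c.p_le; linarith
  refine lintegral_count_le (g := fun K ω => A.innerGap s (fun k => ξ k ω) K)
    (fun K => measurable_innerGap h hκ hd hm hQ.measurable hQ₁.measurable measurable_const hξ K)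
    hacc hR c.θ_pos hθ hgap fun K => ?_
  have := hF.lintegral_gap_weightedAverage_le hQ hQ₁ c hξ hlaw hind s.1 K
  rw [avgFun_subComp hn hm, ← h.Gmin_eq hκ] at this
  simp_rw [h.gradient_nodeFun_subComp hm] at this
  exact this

theorem lintegral_countBound_outer_le (h : A.PrimalAssumption Lf Lbar L Lψ)
    (cp : A.CatalystParams) (hd : 0 < d) (hn : 0 < n) (hm : 0 < m)
    (hQ : IsContractionCompressor ν A.Q A.δ) (hQ₁ : IsContractionCompressor ν₁ A.Q₁ A.δ₁)
    (c : StepParams n (A.lam + A.κ) (Lf + Lψ + A.κ) (Lbar + Lψ + A.κ) (L + Lψ + A.κ)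
      A.δ A.δ₁ A.p A.η A.θ)
    {ζ : ℕ → ℕ → Ω → Seed n m S S₁} (hζ : ∀ k K, Measurable (ζ k K))
    (hlaw : ∀ k K, μ.map (ζ k K) = seedLaw n m ν ν₁ A.p)
    (hind : iIndepFun (fun j : ℕ × ℕ => ζ j.1 j.2) μ) {xs : Vec d}
    (hgrow : ∀ x, A.Pmin + A.lam / 2 * ‖x - xs‖ ^ 2 ≤ A.P x) {k : ℕ}
    (hk : ∀ᵐ ω ∂μ, A.lyap xs (A.outer (fun k K => ζ k K ω) k) ≤ A.lyapBound k) :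
    ∫⁻ ω, A.countBound ⌈Real.log (8 * (45 / (√A.q - A.ρ₀) ^ 3) + 2) / A.θ⌉₊ (A.ε (k + 1))
        (A.outer (fun k K => ζ k K ω) k) (fun K => ζ (k + 1) K ω) ∂μ
      ≤ ENNReal.ofReal ((Real.log (8 * (45 / (√A.q - A.ρ₀) ^ 3) + 2) + 2) / A.θ) := by
  have hR : 0 ≤ 45 / (√A.q - A.ρ₀) ^ 3 := by
    have : 0 < √A.q - A.ρ₀ := sub_pos.2 cp.ρ₀_lt
    positivity
  refine lintegral_comp_le_of_indepFun
    (measurable_outer_of_measurable h cp.κ_nonneg hd hm hQ.measurable hQ₁.measurable hζ k)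
    (measurable_pi_iff.2 fun K => hζ (k + 1) K)
    (indepFun_outer h cp.κ_nonneg hd hm hQ.measurable hQ₁.measurable hζ hind k)
    (F := A.countBound ⌈Real.log (8 * (45 / (√A.q - A.ρ₀) ^ 3) + 2) / A.θ⌉₊ (A.ε (k + 1)))
    (measurable_countBound h cp.κ_nonneg hd hm hQ.measurable hQ₁.measurable measurable_fst
      (fun K => (measurable_pi_apply K).comp measurable_snd) _ _) ?_
  filter_upwards [hk] with ω hω
  exact lintegral_countBound_le h cp.κ_nonneg hd hn hm hQ hQ₁ c (hζ (k + 1)) (hlaw (k + 1))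
    (hind.precomp (g := fun K => (k + 1, K)) fun a b hab => (Prod.mk.inj hab).2)
    (ε_nonneg h cp _) hR (warm_start_gap_le h cp hgrow hω)

end

end Run

end ECCatalyst

/-! ### Coupling of the inner and outer analyses. -/

namespace ECCatalyst

namespace Run

variable {d n m : ℕ} {S S₁ : Type*} {A : Run d n m S S₁} {Lf Lbar L Lψ : ℝ}

/-- The bound on the expected number of inner iterations of one outer iteration. -/
noncomputable def meanCount (A : Run d n m S S₁) : ℝ :=
  (Real.log (8 * (45 / (√A.q - A.ρ₀) ^ 3) + 2) + 2) / A.θ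

theorem meanCount_le (h : A.PrimalAssumption Lf Lbar L Lψ) (cp : A.CatalystParams)
    (hθ : 0 < A.θ) {C B : ℝ} (hC : 1 / A.θ ≤ C * B) :
    0 ≤ A.meanCount ∧ A.meanCount ≤ 8 * C * B * A.logFactor := by
  obtain ⟨h1, h2⟩ := log_le_logFactor h cp
  have hg0 : 0 < √A.q - A.ρ₀ := sub_pos.2 cp.ρ₀_lt
  have hlog : 0 ≤ Real.log (8 * (45 / (√A.q - A.ρ₀) ^ 3) + 2) := by
    refine Real.log_nonneg ?_
    have : 0 ≤ 8 * (45 / (√A.q - A.ρ₀) ^ 3) := by positivity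
    linarith
  refine ⟨div_nonneg (by linarith) hθ.le, ?_⟩
  calc A.meanCount ≤ 8 * A.logFactor * (1 / A.θ) := by
        rw [meanCount, mul_one_div]
        exact div_le_div_of_nonneg_right h2 hθ.le
    _ ≤ 8 * A.logFactor * (C * B) := mul_le_mul_of_nonneg_left hC (by linarith)
    _ = _ := by ring

variable [MeasurableSpace S] [MeasurableSpace S₁] {ν : Measure S} [IsProbabilityMeasure ν]
  {ν₁ : Measure S₁} [IsProbabilityMeasure ν₁] {Ω : Type*} {mΩ : MeasurableSpace Ω}
  {μ : Measure Ω} [IsProbabilityMeasure μ]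

/-- A measurable majorant is provided instead of measurability of the stopping time itself. It
suffices for almost sure finiteness and for splitting the integral of a sum of costs. -/
theorem exists_measurable_T_le (h : A.PrimalAssumption Lf Lbar L Lψ)
    (cp : A.CatalystParams) (hd : 0 < d) (hn : 0 < n) (hm : 0 < m)
    (hQ : IsContractionCompressor ν A.Q A.δ) (hQ₁ : IsContractionCompressor ν₁ A.Q₁ A.δ₁)
    (c : StepParams n (A.lam + A.κ) (Lf + Lψ + A.κ) (Lbar + Lψ + A.κ) (L + Lψ + A.κ)
      A.δ A.δ₁ A.p A.η A.θ)
    {ζ : ℕ → ℕ → Ω → Seed n m S S₁} (hζ : ∀ k K, Measurable (ζ k K))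
    (hlaw : ∀ k K, μ.map (ζ k K) = seedLaw n m ν ν₁ A.p)
    (hind : iIndepFun (fun j : ℕ × ℕ => ζ j.1 j.2) μ) {xs : Vec d}
    (hgrow : ∀ x, A.Pmin + A.lam / 2 * ‖x - xs‖ ^ 2 ≤ A.P x) {k : ℕ}
    (hk : ∀ᵐ ω ∂μ, A.lyap xs (A.outer (fun k K => ζ k K ω) k) ≤ A.lyapBound k) :
    ∃ N : Ω → ℝ≥0∞, Measurable N ∧ (∀ ω, (A.T (fun k K => ζ k K ω) (k + 1) : ℝ≥0∞) ≤ N ω) ∧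
      ∫⁻ ω, N ω ∂μ ≤ ENNReal.ofReal A.meanCount := by
  have hg0 : 0 < √A.q - A.ρ₀ := sub_pos.2 cp.ρ₀_lt
  refine ⟨fun ω => A.countBound ⌈Real.log (8 * (45 / (√A.q - A.ρ₀) ^ 3) + 2) / A.θ⌉₊
    (A.ε (k + 1)) (A.outer (fun k K => ζ k K ω) k) (fun K => ζ (k + 1) K ω),
    measurable_countBound h cp.κ_nonneg hd hm hQ.measurable hQ₁.measurable
      (measurable_outer_of_measurable h cp.κ_nonneg hd hm hQ.measurable hQ₁.measurable hζ k)
      (fun K => hζ (k + 1) K) _ _, fun ω => ?_,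
    lintegral_countBound_outer_le h cp hd hn hm hQ hQ₁ c hζ hlaw hind hgrow hk⟩
  refine stopTime_le_countBound (Nat.one_le_ceil_iff.2 (div_pos (Real.log_pos ?_) c.θ_pos)) _ _ _
  have : 0 ≤ 8 * (45 / (√A.q - A.ρ₀) ^ 3) := by positivity
  linarith

/-- The bound at `k` gives the next majorant a finite mean, so the inner loop stops almost surely;
only then does its output meet the accuracy needed for the bound at `k + 1`. -/
theorem ae_lyap_outer_le (h : A.PrimalAssumption Lf Lbar L Lψ)
    (cp : A.CatalystParams) (hd : 0 < d) (hn : 0 < n) (hm : 0 < m)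
    (hQ : IsContractionCompressor ν A.Q A.δ) (hQ₁ : IsContractionCompressor ν₁ A.Q₁ A.δ₁)
    (c : StepParams n (A.lam + A.κ) (Lf + Lψ + A.κ) (Lbar + Lψ + A.κ) (L + Lψ + A.κ)
      A.δ A.δ₁ A.p A.η A.θ)
    {ζ : ℕ → ℕ → Ω → Seed n m S S₁} (hζ : ∀ k K, Measurable (ζ k K))
    (hlaw : ∀ k K, μ.map (ζ k K) = seedLaw n m ν ν₁ A.p)
    (hind : iIndepFun (fun j : ℕ × ℕ => ζ j.1 j.2) μ) {xs : Vec d} (hmin : A.P xs = A.Pmin)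
    (hgrow : ∀ x, A.Pmin + A.lam / 2 * ‖x - xs‖ ^ 2 ≤ A.P x) (k : ℕ) :
    ∀ᵐ ω ∂μ, A.lyap xs (A.outer (fun k K => ζ k K ω) k) ≤ A.lyapBound k := by
  induction k with
  | zero => exact .of_forall fun ω => lyap_zero_le h cp hgrow
  | succ k ih =>
    obtain ⟨N, hN, hTN, hint⟩ :=
      exists_measurable_T_le h cp hd hn hm hQ hQ₁ c hζ hlaw hind hgrow ih
    filter_upwards [ih, ae_lt_top hN (hint.trans_lt ENNReal.ofReal_lt_top).ne] with ω hω hω'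
    refine lyap_succ_le h cp hmin hω (innerGap_toNat_le fun htop => ?_)
    have h1 : A.T (fun k K => ζ k K ω) (k + 1) = ⊤ := htop
    have h2 := (hTN ω).trans_lt hω'
    rw [h1] at h2
    simp at h2

theorem lintegral_T_le (h : A.PrimalAssumption Lf Lbar L Lψ)
    (cp : A.CatalystParams) (hd : 0 < d) (hn : 0 < n) (hm : 0 < m)
    (hQ : IsContractionCompressor ν A.Q A.δ) (hQ₁ : IsContractionCompressor ν₁ A.Q₁ A.δ₁)
    (c : StepParams n (A.lam + A.κ) (Lf + Lψ + A.κ) (Lbar + Lψ + A.κ) (L + Lψ + A.κ)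
      A.δ A.δ₁ A.p A.η A.θ)
    {ζ : ℕ → ℕ → Ω → Seed n m S S₁} (hζ : ∀ k K, Measurable (ζ k K))
    (hlaw : ∀ k K, μ.map (ζ k K) = seedLaw n m ν ν₁ A.p)
    (hind : iIndepFun (fun j : ℕ × ℕ => ζ j.1 j.2) μ) {xs : Vec d}
    (hgrow : ∀ x, A.Pmin + A.lam / 2 * ‖x - xs‖ ^ 2 ≤ A.P x) {k : ℕ}
    (hk : ∀ᵐ ω ∂μ, A.lyap xs (A.outer (fun k K => ζ k K ω) k) ≤ A.lyapBound k) :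
    ∫⁻ ω, (A.T (fun k K => ζ k K ω) (k + 1) : ℝ≥0∞) ∂μ ≤ ENNReal.ofReal A.meanCount := by
  obtain ⟨N, -, hTN, hint⟩ :=
    exists_measurable_T_le h cp hd hn hm hQ hQ₁ c hζ hlaw hind hgrow hk
  exact (lintegral_mono hTN).trans hint

theorem lintegral_commCost_le (h : A.PrimalAssumption Lf Lbar L Lψ)
    (cp : A.CatalystParams) (hd : 0 < d) (hn : 0 < n) (hm : 0 < m)
    (hQ : IsContractionCompressor ν A.Q A.δ) (hQ₁ : IsContractionCompressor ν₁ A.Q₁ A.δ₁)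
    (c : StepParams n (A.lam + A.κ) (Lf + Lψ + A.κ) (Lbar + Lψ + A.κ) (L + Lψ + A.κ)
      A.δ A.δ₁ A.p A.η A.θ)
    {ζ : ℕ → ℕ → Ω → Seed n m S S₁} (hζ : ∀ k K, Measurable (ζ k K))
    (hlaw : ∀ k K, μ.map (ζ k K) = seedLaw n m ν ν₁ A.p)
    (hind : iIndepFun (fun j : ℕ × ℕ => ζ j.1 j.2) μ) {xs : Vec d}
    (hgrow : ∀ x, A.Pmin + A.lam / 2 * ‖x - xs‖ ^ 2 ≤ A.P x)
    (hk : ∀ k, ∀ᵐ ω ∂μ, A.lyap xs (A.outer (fun k K => ζ k K ω) k) ≤ A.lyapBound k)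
    (hmean : 0 ≤ A.meanCount) (U r : ℝ≥0) (N : ℕ) :
    ∫⁻ ω, A.commCost U r (fun k K => ζ k K ω) N ∂μ
      ≤ ENNReal.ofReal (N * (U + r * (2 * A.meanCount))) := by
  choose M hM hTM hint using fun k =>
    exists_measurable_T_le h cp hd hn hm hQ hQ₁ c hζ hlaw hind hgrow (hk k)
  have hcost : ∀ ω, A.commCost U r (fun k K => ζ k K ω) N
      ≤ ∑ k ∈ Finset.range N, ((U : ℝ≥0∞) + 2 * (r : ℝ≥0∞) * M k ω) := by
    intro ω
    -- The costs are indexed from `1`, the majorants by the preceding outer iteration, from `0`.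
    have hIcc : Finset.Icc 1 N = Finset.Ico (0 + 1) (N + 1) := by ext; simp
    rw [commCost, hIcc, ← Finset.sum_Ico_add', Finset.range_eq_Ico]
    exact Finset.sum_le_sum fun k _ => by gcongr; exact hTM k ω
  calc ∫⁻ ω, A.commCost U r (fun k K => ζ k K ω) N ∂μ
      ≤ ∫⁻ ω, ∑ k ∈ Finset.range N, ((U : ℝ≥0∞) + 2 * (r : ℝ≥0∞) * M k ω) ∂μ :=
        lintegral_mono hcost
    _ = ∑ k ∈ Finset.range N, ((U : ℝ≥0∞) + 2 * (r : ℝ≥0∞) * ∫⁻ ω, M k ω ∂μ) := by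
        rw [lintegral_finsetSum _ fun k _ => ((hM k).const_mul _).const_add _]
        refine Finset.sum_congr rfl fun k _ => ?_
        rw [lintegral_add_left measurable_const, lintegral_const, measure_univ, mul_one,
          lintegral_const_mul _ (hM k)]
    _ ≤ ∑ k ∈ Finset.range N, ENNReal.ofReal (U + r * (2 * A.meanCount)) := by
        refine Finset.sum_le_sum fun k _ => ?_
        rw [ENNReal.ofReal_add U.coe_nonneg (by positivity), mul_left_comm,
          ENNReal.ofReal_mul zero_le_two, ENNReal.ofReal_mul r.coe_nonneg, ENNReal.ofReal_ofNat,
          ENNReal.ofReal_coe_nnreal, ENNReal.ofReal_coe_nnreal, ← mul_assoc]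
        gcongr
        exact hint k
    _ = _ := by
        rw [Finset.sum_const, Finset.card_range, nsmul_eq_mul,
          ENNReal.ofReal_mul (Nat.cast_nonneg _), ENNReal.ofReal_natCast]

end Run

end ECCatalyst

/-! ### Choice of the constants and conclusion. -/

theorem mainTheorem3 (c₁ c₂ : ℝ) (hc₁ : 0 < c₁) (hc₂ : c₁ ≤ c₂) :
    ∃ c₀ C : ℝ, 0 < c₀ ∧ 0 < C ∧
      ∀ (d n m : ℕ) (_ : 0 < d) (_ : 0 < n) (_ : 0 < m)
        (S S₁ Ω : Type*) [MeasurableSpace S] [MeasurableSpace S₁] [MeasurableSpace Ω]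
        (ν : Measure S) [IsProbabilityMeasure ν] (ν₁ : Measure S₁) [IsProbabilityMeasure ν₁]
        (μ : Measure Ω) [IsProbabilityMeasure μ]
        (A : ECCatalyst.Run d n m S S₁) (Lf Lbar L Lψ : ℝ)
        (ζ : ℕ → ℕ → Ω → ECCatalyst.Seed n m S S₁),
        A.PrimalAssumption Lf Lbar L Lψ →
        ECCatalyst.IsContractionCompressor ν A.Q A.δ →
        ECCatalyst.IsContractionCompressor ν₁ A.Q₁ A.δ₁ →
        A.CatalystParams →
        0 < A.p → A.p ≤ 1 → c₁ * A.δ₁ ≤ A.p → A.p ≤ c₂ * A.δ₁ →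
        A.η = A.stepsize c₀ Lf Lbar L Lψ →
        (∀ k K, Measurable (ζ k K)) →
        (∀ k K, μ.map (ζ k K) = ECCatalyst.seedLaw n m ν ν₁ A.p) →
        iIndepFun (fun (j : ℕ × ℕ) => ζ j.1 j.2) μ →
        (∀ k, 1 ≤ k →
          ∫⁻ ω, (A.T (fun k K => ζ k K ω) k : ℝ≥0∞) ∂μ
            ≤ ENNReal.ofReal (C * A.iterBound Lf Lbar L Lψ * A.logFactor)) ∧
        (∀ acc : ℝ, 0 < acc →
          (∀ᵐ ω ∂μ, A.P (A.outer (fun k K => ζ k K ω) (A.outerBound C acc)).1 - A.Pmin ≤ acc) ∧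
          (A.δ₁ = A.δ → ∀ U r : ℝ≥0,
            ∫⁻ ω, A.commCost U r (fun k K => ζ k K ω) (A.outerBound C acc) ∂μ
              ≤ ENNReal.ofReal (A.outerBound C acc *
                  (U + r * (C / A.δ * A.condBound Lf Lbar L Lψ * A.logFactor))))) := by
  have hc₂' : 0 < c₂ := hc₁.trans_le hc₂
  have hD : 0 < 340 + 1152 * (c₂ * (1 + 2 * c₂)) := by positivity
  set c₀ := 1 / (16 * (340 + 1152 * (c₂ * (1 + 2 * c₂)))) with hc₀_def
  have hc₀ : 0 < c₀ := by positivity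
  have hc : c₀ * (340 + 1152 * (c₂ * (1 + 2 * c₂))) ≤ 1 / 16 := by
    rw [hc₀_def]
    field_simp
    rfl
  have hC : 0 < 4 / c₀ + 4 + 4 / c₁ := by positivity
  have hC2 : 2 ≤ 32 * (4 / c₀ + 4 + 4 / c₁) := by
    have : 0 < 4 / c₀ + 4 / c₁ := by positivity
    linarith
  -- The factor `32` is `8 * 2 * 2`: the logarithm against `logFactor`, the two compressed vectors
  -- per inner iteration, and the passage from `iterBound` to `condBound`. The iteration count alone
  -- would need only `8`.
  refine ⟨c₀, 32 * (4 / c₀ + 4 + 4 / c₁), hc₀, by positivity, ?_⟩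
  intro d n m hd hn hm S S₁ Ω _ _ _ ν _ ν₁ _ μ _ A Lf Lbar L Lψ ζ h hQ hQ₁ cp hp hp' hpc₁ hpc₂ hη
    hζ hlaw hind
  have hκ := cp.κ_nonneg
  have c := h.stepParams hd hn hm hκ hQ.pos hQ.le_one hQ₁.pos hp hp' hc₀ hc₂' hpc₂
    hc hη
  have hθ := h.inv_θ_le hd hn hm hκ hQ.pos hQ.le_one hQ₁.pos hQ₁.le_one hc₀ hc₁
    hpc₁ hη
  obtain ⟨xs, hmin, hgrow⟩ := h.exists_minimizer
  have hlyap := ECCatalyst.Run.ae_lyap_outer_le h cp hd hn hm hQ hQ₁ c hζ hlaw hind hmin hgrow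
  obtain ⟨hmean, hmean'⟩ := ECCatalyst.Run.meanCount_le h cp c.θ_pos hθ
  refine ⟨fun k hk => ?_, fun acc hacc => ⟨?_, fun hδ U r => ?_⟩⟩
  · obtain ⟨k, rfl⟩ := Nat.exists_eq_add_of_le' hk
    refine (ECCatalyst.Run.lintegral_T_le h cp hd hn hm hQ hQ₁ c hζ hlaw hind hgrow
      (hlyap k)).trans (ENNReal.ofReal_le_ofReal ?_)
    linarith
  · filter_upwards [hlyap (A.outerBound (32 * (4 / c₀ + 4 + 4 / c₁)) acc)] with ω hω
    exact ECCatalyst.Run.gap_outerBound_le h cp hC2 hacc hω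
  · refine (ECCatalyst.Run.lintegral_commCost_le h cp hd hn hm hQ hQ₁ c hζ hlaw hind hgrow hlyap
      hmean U r _).trans (ENNReal.ofReal_le_ofReal ?_)
    have hcond := h.iterBound_le_condBound hd hn hm hκ hQ.pos hQ.le_one hδ
    have hfac : 0 ≤ 8 * (4 / c₀ + 4 + 4 / c₁) * A.logFactor :=
      mul_nonneg (by positivity) (zero_le_one.trans (ECCatalyst.Run.log_le_logFactor h cp).1)
    have h2 : 2 * A.meanCount
        ≤ 32 * (4 / c₀ + 4 + 4 / c₁) / A.δ * A.condBound Lf Lbar L Lψ * A.logFactor := by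
      calc 2 * A.meanCount
          ≤ 2 * (8 * (4 / c₀ + 4 + 4 / c₁) * A.logFactor * A.iterBound Lf Lbar L Lψ) := by
            linarith
        _ ≤ 2 * (8 * (4 / c₀ + 4 + 4 / c₁) * A.logFactor
              * (2 / A.δ * A.condBound Lf Lbar L Lψ)) := by gcongr
        _ = _ := by ring
    gcongr
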